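/- For Schwartz functions $u,v$ on $\mathbb R$ let $\mathcal W(u,v)(x,\xi)=\int_{\mathbb R} e^{-2i\pi z\xi}\,u(x+\tfrac z2)\,\overline{v(x-\tfrac z2)}\,dz$. The Weyl quantization of a bounded measurable function $a$ on $\mathbb R^2$ is said to be bounded on $L^2(\mathbb R)$ if there is a bounded operator $\mathrm{Op}^w(a)$ on $L^2(\mathbb R)$ with $\langle \mathrm{Op}^w(a)u,v\rangle_{L^2(\mathbb R)}=\iint_{\mathbb R^2} a(x,\xi)\,\mathcal W(u,v)(x,\xi)\,dx\,d\xi$ for all Schwartz functions $u,v$; this operator is then unique. A triangle is a set $\mathcal T=\{X\in\mathbb R^2:\ L_j(X)\ge c_j,\ j=1,2,3\}$, where $c_1,c_2,c_3$ are real numbers and $L_1,L_2,L_3$ are linear forms on $\mathbb R^2$ (degenerate choices and sets of infinite area are allowed). It is called non-degenerate if $L_1,L_2,L_3$ can be chosen pairwise linearly independent, $\mathcal T$ has positive (possibly infinite) area, and $\mathcal T$ is not a cone (i.e. it is not invariant under all dilations of positive ratio about some point of the plane). A convex cone is a sector $\{X_0+r(\cos\varphi,\sin\varphi):\ r>0,\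 \alpha<\varphi<\alpha+\theta\}$ with $X_0\in\mathbb R^2$, $\alpha\in\mathbb R$, $0\le\theta\le\pi$. Then for every triangle $\mathcal T$ and every convex cone $\mathcal C$, the Weyl quantizations of $\mathbf 1_{\mathcal T}$ and $\mathbf 1_{\mathcal C}$ are bounded on $L^2(\mathbb R)$ and self-adjoint. Let $\mu_2^+$ be the largest element of the spectrum of $\mathrm{Op}^w(\mathbf 1_{\{x\ge 0,\ \xi\ge 0\}})$, and $\mu_3^+=\sup\{\|\mathrm{Op}^w(\mathbf 1_{\mathcal T})\|_{\mathcal B(L^2(\mathbb R))}:\ \mathcal T \text{ a triangle}\}$. Then $$\mu_2^+=\sup_{\mathcal C\text{ convex cone}}\|\mathrm{Op}^w(\mathbf 1_{\mathcal C})\|_{\mathcal B(L^2(\mathbb R))}\ \le\ \mu_3^+\ \le\ \tilde\mu_3:=\frac12\Bigl(\mu_2^++\sqrt{1+(\mu_2^+)^2}\Bigr),$$ where $|\mu_2^+-1.007680|\le 5\cdot10^{-7}$ and $|\tilde\mu_3-1.213668|\le 10^{-6}$. In particular $\mu_3^+$ is finite, so that the bound is independent of the area of the triangle. The same two inequalities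 hold if the supremum is taken over the non-degenerate triangles only. -/

import Mathlib

open MeasureTheory SchwartzMap

noncomputable section

/-- The complex Hilbert space `L²(ℝ)`. -/
abbrev L2R : Type := Lp ℂ 2 (volume : Measure ℝ)

/-- The joint Wigner distribution
`W(u,v)(x,ξ) = ∫ exp(-2iπ z ξ) u(x + z/2) conj(v(x - z/2)) dz`. -/
def wigner (u v : 𝓢(ℝ, ℂ)) (p : ℝ × ℝ) : ℂ :=
  ∫ z : ℝ, Complex.exp (-(2 * Real.pi * Complex.I * z * p.2)) *
    (u (p.1 + z / 2) * (starRingEnd ℂ) (v (p.1 - z / 2)))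

/-- `A` is the bounded operator on `L²(ℝ)` given by the Weyl quantization of the
(bounded measurable) symbol `a`, i.e. `⟨A u, v⟩ = ∬ a(x,ξ) W(u,v)(x,ξ) dx dξ` for all Schwartz
functions `u`, `v`. Mathlib's inner product is conjugate-linear in its first slot, so that
`⟨A u, v⟩ = ∫ (A u) conj v` is written `inner ℂ v (A u)`. -/
def IsWeylQuantization (a : ℝ × ℝ → ℂ) (A : L2R →L[ℂ] L2R) : Prop :=
  ∀ u v : 𝓢(ℝ, ℂ),
    inner ℂ (v.toLp 2 volume : L2R) (A (u.toLp 2 volume)) = ∫ p : ℝ × ℝ, a p * wigner u v p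

/-- The indicator function of a subset of the plane, as a complex valued symbol. -/
def indicatorSymbol (E : Set (ℝ × ℝ)) : ℝ × ℝ → ℂ := E.indicator (fun _ => 1)

/-- The operator norms of the (bounded) Weyl quantizations of the indicator functions of the
members of a family of subsets of the plane. -/
def weylNorms (S : Set (Set (ℝ × ℝ))) : Set ℝ :=
  {r | ∃ E ∈ S, ∃ A : L2R →L[ℂ] L2R, IsWeylQuantization (indicatorSymbol E) A ∧ r = ‖A‖}

/-- The set `{X | L_j(X) ≥ c_j, j = 1, 2, 3}`. -/
def triangleSet (L : Fin 3 → (ℝ × ℝ →ₗ[ℝ] ℝ)) (c : Fin 3 → ℝ) : Set (ℝ × ℝ) :=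
  {X | ∀ j, c j ≤ L j X}

/-- The family of all triangles in the wide sense: all linear forms (possibly zero or
proportional) and all real constants are allowed. -/
def triangles : Set (Set (ℝ × ℝ)) :=
  {T | ∃ L c, T = triangleSet L c}

/-- `E` is invariant under the dilations of positive ratio centred at some point. -/
def IsAffineCone (E : Set (ℝ × ℝ)) : Prop :=
  ∃ X₀ : ℝ × ℝ, ∀ X ∈ E, ∀ t : ℝ, 0 < t → X₀ + t • (X - X₀) ∈ E

/-- The non-degenerate triangles: the linear forms are pairwise independent, the area is positive
(possibly infinite), and the set is not a cone. -/
def properTriangles : Set (Set (ℝ × ℝ)) :=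
  {T | ∃ L c, (∀ j k, j ≠ k → LinearIndependent ℝ ![L j, L k]) ∧
    0 < volume (triangleSet L c) ∧ ¬ IsAffineCone (triangleSet L c) ∧ T = triangleSet L c}

/-- The plane sector with vertex `X₀`, aperture `θ` and first side in the direction of angle `α`. -/
def sector (X₀ : ℝ × ℝ) (α θ : ℝ) : Set (ℝ × ℝ) :=
  {X | ∃ r φ : ℝ, 0 < r ∧ α < φ ∧ φ < α + θ ∧ X = X₀ + r • (Real.cos φ, Real.sin φ)}

/-- The convex affine cones of the plane: the sectors of aperture at most `π`. -/
def convexCones : Set (Set (ℝ × ℝ)) :=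
  {C | ∃ X₀ α θ, 0 ≤ θ ∧ θ ≤ Real.pi ∧ C = sector X₀ α θ}

/-- The quarter plane `{x ≥ 0, ξ ≥ 0}`, whose indicator function is `H(x) H(ξ)`. -/
def quarterPlane : Set (ℝ × ℝ) := {X | 0 ≤ X.1 ∧ 0 ≤ X.2}

end

/-! ### The Wigner distribution of Schwartz functions: Fourier slices and decay -/

section
open scoped FourierTransform ComplexConjugate

/-! Everything is done with the sesquilinear form `wignerForm E u v`, the integral of W(u,v) over E,
and with the predicate `HasBound E r` bounding it in L² norm. By density and the Riesz theorem a
bound is the same as a bounded operator of norm at most r (`HasBound.exists_weyl`,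
`IsWeylQuantization.hasBound`). Translations, modulations, chirps and the Fourier transform act on W
by area-preserving affine maps of the plane, so bounds are transported by these maps; every
nontrivial half plane can be moved to x ≥ 0, and every intersection of two half planes to a quarter
plane or a trivial case.

The upper bound is the cutting lemma `HasBound.cut`: if E has interval sections by vertical lines
and bound M, then E ∩ {x ≥ 0} has bound (M + √(1 + M²))/2. Write u = p + n with p on the positive
and n on the negative half line. In the resulting 2 × 2 block form the (p, p) block does not see the
cut and is bounded by M, and the (n, n) block vanishes because its Wigner function lives in x < 0.
In the mixed blocks, integrating a Fourier transform over any interval costs at most (1/π)∫|g(z)/z|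
dz; in the coordinates a = x + z/2, b = z/2 - x this is the Hilbert kernel 1/(a + b) restricted to b
≤ a by the cut, of norm π/2 instead of π. So these blocks are bounded by 1/2, and the bound is the
largest eigenvalue of the matrix with rows (M, 1/2) and (1/2, 0). A triangle is an intersection of
two half planes, with bound μ₂, cut by a third.

The value of μ₂ comes from diagonalising the quarter plane. Its form commutes with dilations, so
logarithmic (Mellin) coordinates on both half lines turn it into a Fourier multiplier with values in
the Hermitian matrices with rows (p, q) and (q̄, 0), where p(ω) = 1/(1 + e^{-2πω}) and q(ω) =
(1/2πi) ∫₀^∞ e^{iωr}/(2 cosh(r/2)) dr. Thus the best upper bound is the supremum of the larger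
eigenvalue, and a number l with l ≥ p lies above that eigenvalue exactly when |q|² ≤ l(l - p). This
inequality is verified for all ω at one rational l (`multiplier_le`) and its reverse at ω =
4361/5000 for a slightly smaller l (`multiplier_ge`). As |q| ≤ 1/4 the form is at least -1/4, so the
operator norm is itself the top of the spectrum.

For the lower bound on triangles, the quarter plane is an increasing union of right triangles, and
W(u,v) is integrable, so any common bound for the triangles passes to the quarter plane. -/

lemma affine_growth (x : ℝ) {c : ℝ} (hc : c ≠ 0) (z : ℝ) :
    ‖z‖ ≤ (1 + |x|) / |c| * (1 + ‖x + c * z‖) ^ 1 := by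
  have h2 : |c| * |z| ≤ |x + c * z| + |x| := by
    rw [← abs_mul]
    simpa using norm_sub_le (x + c * z) x
  have hc' : 0 < |c| := abs_pos.2 hc
  rw [Real.norm_eq_abs, Real.norm_eq_abs, div_mul_eq_mul_div, le_div_iff₀ hc', pow_one]
  nlinarith [abs_nonneg x, abs_nonneg (x + c * z),
    mul_nonneg (abs_nonneg x) (abs_nonneg (x + c * z))]

/-- Composition of a Schwartz function on the line with the affine map `z ↦ x + c z`. -/
noncomputable def affineComp (u : 𝓢(ℝ, ℂ)) (x c : ℝ) (hc : c ≠ 0) : 𝓢(ℝ, ℂ) :=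
  SchwartzMap.compCLM ℝ (g := fun z : ℝ => x + c * z) (by fun_prop)
    ⟨1, (1 + |x|) / |c|, affine_growth x hc⟩ u

@[simp] lemma affineComp_apply (u : 𝓢(ℝ, ℂ)) (x c : ℝ) (hc : c ≠ 0) (z : ℝ) :
    affineComp u x c hc z = u (x + c * z) := rfl

/-- The pointwise complex conjugate of a Schwartz function. -/
noncomputable def conjSchwartz (u : 𝓢(ℝ, ℂ)) : 𝓢(ℝ, ℂ) :=
  SchwartzMap.postcompCLM (𝕜 := ℝ) (Complex.conjCLE : ℂ →L[ℝ] ℂ) u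

@[simp] lemma conjSchwartz_apply (u : 𝓢(ℝ, ℂ)) (z : ℝ) : conjSchwartz u z = conj (u z) := rfl

/-- The pointwise product of two Schwartz functions. -/
noncomputable def mulSchwartz (u v : 𝓢(ℝ, ℂ)) : 𝓢(ℝ, ℂ) :=
  SchwartzMap.pairing (ContinuousLinearMap.mul ℂ ℂ) u v

@[simp] lemma mulSchwartz_apply (u v : 𝓢(ℝ, ℂ)) (z : ℝ) : mulSchwartz u v z = u z * v z := rfl

/-- The function `z ↦ u(x + z/2) conj v(x - z/2)`, whose Fourier transform is the Wigner function
on the vertical line over `x`. -/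
noncomputable def slice (u v : 𝓢(ℝ, ℂ)) (x : ℝ) : 𝓢(ℝ, ℂ) :=
  mulSchwartz (affineComp u x (1 / 2) (by norm_num))
    (conjSchwartz (affineComp v x (-(1 / 2)) (by norm_num)))

lemma slice_apply (u v : 𝓢(ℝ, ℂ)) (x z : ℝ) :
    slice u v x z = u (x + z / 2) * conj (v (x - z / 2)) := by
  simp only [slice, mulSchwartz_apply, affineComp_apply, conjSchwartz_apply]
  ring_nf

lemma wigner_eq_fourier (u v : 𝓢(ℝ, ℂ)) (x ξ : ℝ) : wigner u v (x, ξ) = 𝓕 (slice u v x) ξ := by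
  rw [SchwartzMap.fourier_coe, Real.fourier_real_eq_integral_exp_smul]
  unfold wigner
  congr 1 with z
  rw [slice_apply, smul_eq_mul]
  congr 2
  push_cast; ring

lemma wigner_measurable (u v : 𝓢(ℝ, ℂ)) : StronglyMeasurable (wigner u v) := by
  unfold wigner
  apply StronglyMeasurable.integral_prod_right
    (f := fun (p : ℝ × ℝ) (z : ℝ) => Complex.exp (-(2 * Real.pi * Complex.I * z * p.2)) *
    (u (p.1 + z / 2) * (starRingEnd ℂ) (v (p.1 - z / 2))))
  apply Continuous.stronglyMeasurable
  have := u.continuous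
  have := v.continuous
  unfold Function.uncurry
  fun_prop

lemma wigner_conj (u v : 𝓢(ℝ, ℂ)) (p : ℝ × ℝ) : wigner v u p = conj (wigner u v p) := by
  unfold wigner
  rw [← integral_conj, ← integral_neg_eq_self]
  congr 1 with z
  rw [map_mul, map_mul, Complex.conj_conj, ← Complex.exp_conj]
  simp only [map_neg, map_mul, Complex.conj_I, Complex.conj_ofReal, Complex.conj_ofNat]
  push_cast
  ring_nf

lemma slice_add_left (u₁ u₂ v : 𝓢(ℝ, ℂ)) (x : ℝ) :
    slice (u₁ + u₂) v x = slice u₁ v x + slice u₂ v x := by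
  ext z; simp [slice_apply, add_mul]

lemma slice_smul_left (c : ℂ) (u v : 𝓢(ℝ, ℂ)) (x : ℝ) : slice (c • u) v x = c • slice u v x := by
  ext z; simp [slice_apply, mul_assoc]

lemma wigner_add_left (u₁ u₂ v : 𝓢(ℝ, ℂ)) (p : ℝ × ℝ) :
    wigner (u₁ + u₂) v p = wigner u₁ v p + wigner u₂ v p := by
  obtain ⟨x, ξ⟩ := p
  simp only [wigner_eq_fourier, slice_add_left, FourierTransform.fourier_add, add_apply]

lemma wigner_smul_left (c : ℂ) (u v : 𝓢(ℝ, ℂ)) (p : ℝ × ℝ) :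
    wigner (c • u) v p = c * wigner u v p := by
  obtain ⟨x, ξ⟩ := p
  simp only [wigner_eq_fourier, slice_smul_left, FourierTransform.fourier_smul, smul_apply,
    smul_eq_mul]

lemma wigner_add_right (u v₁ v₂ : 𝓢(ℝ, ℂ)) (p : ℝ × ℝ) :
    wigner u (v₁ + v₂) p = wigner u v₁ p + wigner u v₂ p := by
  rw [wigner_conj, wigner_add_left, map_add, ← wigner_conj, ← wigner_conj]

lemma wigner_smul_right (c : ℂ) (u v : 𝓢(ℝ, ℂ)) (p : ℝ × ℝ) :
    wigner u (c • v) p = conj c * wigner u v p := by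
  rw [wigner_conj, wigner_smul_left, map_mul, ← wigner_conj]

/-- Put the supremum norm on v and the L¹ norm on u; the substitution y = x + z/2 gives the factor
2. -/
lemma wigner_bounded (u v : 𝓢(ℝ, ℂ)) : ∃ C : ℝ, ∀ p, ‖wigner u v p‖ ≤ C := by
  obtain ⟨M, hM⟩ : ∃ M, ∀ y, ‖v y‖ ≤ M := ⟨_, fun y => SchwartzMap.norm_le_seminorm ℝ v y⟩
  have hu : Integrable (fun y : ℝ => ‖u y‖) := u.integrable.norm
  refine ⟨(∫ y, ‖u y‖) * 2 * M, fun p => ?_⟩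
  have h1 : Integrable (fun z : ℝ => ‖u (p.1 + z / 2)‖ * M) :=
    ((affineComp u p.1 (1 / 2) (by norm_num)).integrable.norm.mul_const M).congr
      (by filter_upwards with z; simp only [affineComp_apply]; ring_nf)
  calc ‖wigner u v p‖ ≤ ∫ z : ℝ, ‖u (p.1 + z / 2)‖ * M := by
        apply norm_integral_le_of_norm_le h1
        filter_upwards with z
        have : ‖Complex.exp (-(2 * Real.pi * Complex.I * z * p.2))‖ = 1 := by
          rw [show (-(2 * Real.pi * Complex.I * z * p.2) : ℂ)
            = ((-(2 * Real.pi * z * p.2) : ℝ) : ℂ) * Complex.I by push_cast; ring]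
          exact Complex.norm_exp_ofReal_mul_I _
        rw [norm_mul, norm_mul, this, one_mul, RCLike.norm_conj]
        gcongr
        exact hM _
    _ = (∫ y, ‖u y‖) * 2 * M := by
        rw [integral_mul_const]
        congr 1
        have := Measure.integral_comp_div (fun y => ‖u (p.1 + y)‖) (2 : ℝ)
        rw [this, integral_add_left_eq_self (fun y => ‖u y‖) p.1]
        simp [mul_comm]

/-- Multiplication of a Schwartz function by the variable. -/
noncomputable def mulX (u : 𝓢(ℝ, ℂ)) : 𝓢(ℝ, ℂ) :=
  SchwartzMap.smulLeftCLM ℂ (fun y : ℝ => (y : ℂ)) u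

@[simp] lemma mulX_apply (u : 𝓢(ℝ, ℂ)) (y : ℝ) : mulX u y = y * u y := by
  unfold mulX
  exact SchwartzMap.smulLeftCLM_apply_apply (g := fun y : ℝ => (y : ℂ))
    Complex.ofRealCLM.hasTemperateGrowth u y

/-- The point x is the mean of the two arguments x + z/2 and x - z/2. -/
lemma wigner_mul_fst (u v : 𝓢(ℝ, ℂ)) (p : ℝ × ℝ) :
    (p.1 : ℂ) * wigner u v p = (1 / 2) * (wigner (mulX u) v p + wigner u (mulX v) p) := by
  obtain ⟨x, ξ⟩ := p
  have : (x : ℂ) • slice u v x = (1 / 2 : ℂ) • (slice (mulX u) v x + slice u (mulX v) x) := by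
    ext z
    simp only [smul_apply, add_apply, slice_apply, mulX_apply, smul_eq_mul, map_mul,
      Complex.conj_ofReal]
    push_cast; ring
  simp only [wigner_eq_fourier]
  have h := congrArg (fun s => (𝓕 s : 𝓢(ℝ, ℂ)) ξ) this
  simpa only [FourierTransform.fourier_smul, FourierTransform.fourier_add, smul_apply, add_apply,
    smul_eq_mul] using h

lemma fourier_derivCLM (g : 𝓢(ℝ, ℂ)) (ξ : ℝ) :
    𝓕 (derivCLM ℂ ℂ g) ξ = (2 * Real.pi * Complex.I * ξ) * 𝓕 g ξ := by
  have := Real.fourier_deriv g.integrable g.differentiable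
    ((derivCLM ℂ ℂ g).integrable)
  have h := congrFun this ξ
  rw [SchwartzMap.fourier_coe, SchwartzMap.fourier_coe]
  have e : (derivCLM ℂ ℂ g : ℝ → ℂ) = deriv g := funext fun x => derivCLM_apply ℂ g x
  rw [e]
  simpa using h

/-- Multiplication by ξ is differentiation of the slice in z, which gives one half of each
derivative, with opposite signs. -/
lemma wigner_mul_snd (u v : 𝓢(ℝ, ℂ)) (p : ℝ × ℝ) :
    (p.2 : ℂ) * wigner u v p = (1 / (4 * Real.pi * Complex.I)) *
      (wigner (derivCLM ℂ ℂ u) v p - wigner u (derivCLM ℂ ℂ v) p) := by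
  obtain ⟨x, ξ⟩ := p
  have : derivCLM ℂ ℂ (slice u v x) = (1 / 2 : ℂ) • (slice (derivCLM ℂ ℂ u) v x +
      (-1 : ℂ) • slice u (derivCLM ℂ ℂ v) x) := by
    ext z
    simp only [derivCLM_apply, smul_apply, add_apply, smul_eq_mul]
    rw [show (slice u v x : ℝ → ℂ) = fun z => u (x + z / 2) * conj (v (x - z / 2)) from
      funext (slice_apply u v x)]
    have h1 : HasDerivAt (fun z : ℝ => u (x + z / 2)) (deriv u (x + z / 2) * (1 / 2)) z := by
      have := (u.hasDerivAt (x + z / 2)).scomp z (((hasDerivAt_id z).div_const 2).const_add x)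
      simpa [mul_comm, Function.comp_def] using this
    have h2 : HasDerivAt (fun z : ℝ => v (x - z / 2)) (deriv v (x - z / 2) * (-(1 / 2))) z := by
      have := (v.hasDerivAt (x - z / 2)).scomp z (((hasDerivAt_id z).div_const 2).const_sub x)
      simpa [mul_comm, Function.comp_def] using this
    have h3 : deriv (fun z => u (x + z / 2) * conj (v (x - z / 2))) z = _ := (h1.mul h2.star).deriv
    rw [h3]
    simp only [slice_apply, derivCLM_apply, starRingEnd_apply, star_mul', star_neg]
    have : star (1 / 2 : ℂ) = 1 / 2 := by simp
    rw [this]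
    ring
  have h := congrArg (fun s => (𝓕 s : 𝓢(ℝ, ℂ)) ξ) this
  simp only [fourier_derivCLM, FourierTransform.fourier_smul, FourierTransform.fourier_add,
    smul_apply, add_apply, smul_eq_mul] at h
  simp only [wigner_eq_fourier]
  have hpi : (Real.pi : ℂ) ≠ 0 := Complex.ofReal_ne_zero.2 Real.pi_ne_zero
  have hI := Complex.I_ne_zero
  rw [one_div_mul_eq_div, eq_div_iff (by simp [hpi, hI])]
  linear_combination 2 * h

/-- Multiplying W by x or ξ yields combinations of Wigner functions of other Schwartz functions. A
weighted bound valid for all pairs therefore survives one more factor, and can be iterated. -/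
lemma wigner_weight_bounded {m : ℝ × ℝ → ℂ}
    (h : ∀ u v : 𝓢(ℝ, ℂ), ∃ C : ℝ, ∀ p, ‖m p * wigner u v p‖ ≤ C) :
    (∀ u v : 𝓢(ℝ, ℂ), ∃ C : ℝ, ∀ p, ‖(m p * p.1) * wigner u v p‖ ≤ C) ∧
    (∀ u v : 𝓢(ℝ, ℂ), ∃ C : ℝ, ∀ p, ‖(m p * p.2) * wigner u v p‖ ≤ C) := by
  constructor
  · intro u v
    obtain ⟨C₁, h₁⟩ := h (mulX u) v
    obtain ⟨C₂, h₂⟩ := h u (mulX v)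
    refine ⟨‖(1 / 2 : ℂ)‖ * (C₁ + C₂), fun p => ?_⟩
    rw [mul_assoc, wigner_mul_fst, mul_left_comm, mul_add, norm_mul]
    gcongr
    exact (norm_add_le _ _).trans (add_le_add (h₁ p) (h₂ p))
  · intro u v
    obtain ⟨C₁, h₁⟩ := h (derivCLM ℂ ℂ u) v
    obtain ⟨C₂, h₂⟩ := h u (derivCLM ℂ ℂ v)
    refine ⟨‖(1 / (4 * Real.pi * Complex.I) : ℂ)‖ * (C₁ + C₂), fun p => ?_⟩
    rw [mul_assoc, wigner_mul_snd, mul_left_comm, mul_sub, norm_mul]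
    gcongr
    exact (norm_sub_le _ _).trans (add_le_add (h₁ p) (h₂ p))

lemma wigner_decay (u v : 𝓢(ℝ, ℂ)) :
    ∃ C : ℝ, 0 ≤ C ∧ ∀ p : ℝ × ℝ, ‖wigner u v p‖ ≤ C * ((1 + p.1 ^ 2)⁻¹ * (1 + p.2 ^ 2)⁻¹) := by
  have h0 : ∀ u v : 𝓢(ℝ, ℂ), ∃ C : ℝ, ∀ p, ‖(1 : ℝ × ℝ → ℂ) p * wigner u v p‖ ≤ C := by
    intro u v; simpa using wigner_bounded u v
  have h1 := (wigner_weight_bounded (wigner_weight_bounded h0).1).1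
  have h2 := (wigner_weight_bounded (wigner_weight_bounded h0).2).2
  have h3 := (wigner_weight_bounded (wigner_weight_bounded h1).2).2
  obtain ⟨C0, h0⟩ := h0 u v
  obtain ⟨C1, h1⟩ := h1 u v
  obtain ⟨C2, h2⟩ := h2 u v
  obtain ⟨C3, h3⟩ := h3 u v
  have key : ∀ p : ℝ × ℝ, ‖wigner u v p‖ ≤
      (C0 + C1 + C2 + C3) * ((1 + p.1 ^ 2)⁻¹ * (1 + p.2 ^ 2)⁻¹) := by
    intro p
    have e0 := h0 p
    have e1 := h1 p
    have e2 := h2 p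
    have e3 := h3 p
    simp only [norm_mul, Pi.one_apply, one_mul, Complex.norm_real,
      Real.norm_eq_abs] at e0 e1 e2 e3
    have a1 := abs_mul_abs_self p.1
    have a2 := abs_mul_abs_self p.2
    rw [← mul_inv, ← div_eq_mul_inv, le_div_iff₀ (by positivity)]
    calc ‖wigner u v p‖ * ((1 + p.1 ^ 2) * (1 + p.2 ^ 2)) = ‖wigner u v p‖ +
        |p.1| * |p.1| * ‖wigner u v p‖ + |p.2| * |p.2| * ‖wigner u v p‖ +
        |p.1| * |p.1| * |p.2| * |p.2| * ‖wigner u v p‖ := by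
          rw [mul_assoc (|p.1| * |p.1|), a1, a2]; ring
      _ ≤ _ := by linarith
  exact ⟨C0 + C1 + C2 + C3, by simpa using (norm_nonneg _).trans (key 0), key⟩

lemma wigner_integrable (u v : 𝓢(ℝ, ℂ)) : Integrable (wigner u v) := by
  obtain ⟨C, -, h⟩ := wigner_decay u v
  have : Integrable (fun p : ℝ × ℝ => C * ((1 + p.1 ^ 2)⁻¹ * (1 + p.2 ^ 2)⁻¹)) :=
    (integrable_inv_one_add_sq.mul_prod integrable_inv_one_add_sq).const_mul C
  exact this.mono' (wigner_measurable u v).aestronglyMeasurable (by filter_upwards with p using h p)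

/-! ### Bounded forms and bounded operators -/

/-- The integral of the Wigner distribution of `u, v` over the set `E`. -/
noncomputable def wignerForm (E : Set (ℝ × ℝ)) (u v : 𝓢(ℝ, ℂ)) : ℂ := ∫ p in E, wigner u v p

lemma integral_indicatorSymbol_mul {E : Set (ℝ × ℝ)} (hE : MeasurableSet E) (u v : 𝓢(ℝ, ℂ)) :
    ∫ p, indicatorSymbol E p * wigner u v p = wignerForm E u v := by
  rw [wignerForm, ← integral_indicator hE]
  congr 1 with p
  by_cases hp : p ∈ E <;> simp [indicatorSymbol, hp]

section form
variable (E : Set (ℝ × ℝ)) (u v w : 𝓢(ℝ, ℂ)) (c : ℂ)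

lemma wignerForm_add_left : wignerForm E (u + v) w = wignerForm E u w + wignerForm E v w := by
  simp only [wignerForm, wigner_add_left]
  exact integral_add (wigner_integrable _ _).integrableOn (wigner_integrable _ _).integrableOn

lemma wignerForm_add_right : wignerForm E u (v + w) = wignerForm E u v + wignerForm E u w := by
  simp only [wignerForm, wigner_add_right]
  exact integral_add (wigner_integrable _ _).integrableOn (wigner_integrable _ _).integrableOn

lemma wignerForm_smul_left : wignerForm E (c • u) v = c * wignerForm E u v := by
  simp only [wignerForm, wigner_smul_left]
  exact integral_const_mul _ _

lemma wignerForm_smul_right : wignerForm E u (c • v) = conj c * wignerForm E u v := by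
  simp only [wignerForm, wigner_smul_right]
  exact integral_const_mul _ _

lemma wignerForm_conj : wignerForm E v u = conj (wignerForm E u v) := by
  simp only [wignerForm, wigner_conj u v]
  exact integral_conj

end form

/-- The `L²` norm of a Schwartz function. -/
noncomputable def nrm (u : 𝓢(ℝ, ℂ)) : ℝ := ‖(u.toLp 2 volume : L2R)‖

lemma nrm_nonneg (u : 𝓢(ℝ, ℂ)) : 0 ≤ nrm u := norm_nonneg _

lemma nrm_sq (u : 𝓢(ℝ, ℂ)) : nrm u ^ 2 = ∫ x, ‖u x‖ ^ 2 := by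
  have h := inner_self_eq_norm_sq_to_K (𝕜 := ℂ) (u.toLp 2 volume : L2R)
  have h2 := SchwartzMap.inner_toL2_toL2_eq u u volume
  rw [h] at h2
  simp only [inner_self_eq_norm_sq_to_K] at h2
  apply Complex.ofRealLI.injective
  simp only [Complex.ofRealLI_apply]
  rw [← integral_complex_ofReal]
  simp only [nrm]
  push_cast
  exact h2

/-- The form `(u, v) ↦ ∬_E W(u, v)` is bounded by `r` for the `L²` norm. -/
def HasBound (E : Set (ℝ × ℝ)) (r : ℝ) : Prop :=
  ∀ u v : 𝓢(ℝ, ℂ), ‖wignerForm E u v‖ ≤ r * nrm u * nrm v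

lemma HasBound.mono {E : Set (ℝ × ℝ)} {r s : ℝ} (h : HasBound E r) (hrs : r ≤ s) :
    HasBound E s := fun u v => (h u v).trans (by
  have := nrm_nonneg u
  have := nrm_nonneg v
  gcongr)

lemma wignerForm_congr {E F : Set (ℝ × ℝ)} (h : E =ᵐ[volume] F) (u v : 𝓢(ℝ, ℂ)) :
    wignerForm E u v = wignerForm F u v := setIntegral_congr_set h

lemma HasBound.congr {E F : Set (ℝ × ℝ)} {r : ℝ} (h : HasBound E r) (hEF : E =ᵐ[volume] F) :
    HasBound F r := fun u v => by rw [← wignerForm_congr hEF]; exact h u v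

lemma denseRange_toLp : DenseRange (fun u : 𝓢(ℝ, ℂ) => (u.toLp 2 volume : L2R)) :=
  SchwartzMap.denseRange_toLpCLM (by norm_num)

lemma IsWeylQuantization.unique {a : ℝ × ℝ → ℂ} {A B : L2R →L[ℂ] L2R}
    (hA : IsWeylQuantization a A) (hB : IsWeylQuantization a B) : A = B := by
  apply ContinuousLinearMap.ext_on (s := Set.range fun u : 𝓢(ℝ, ℂ) => (u.toLp 2 volume : L2R))
  · exact denseRange_toLp.mono Submodule.subset_span
  · rintro _ ⟨u, rfl⟩
    apply denseRange_toLp.eq_of_inner_right ℂ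
    intro v
    exact (hA u v).trans (hB u v).symm

lemma IsWeylQuantization.isSelfAdjoint {E : Set (ℝ × ℝ)} (hE : MeasurableSet E)
    {A : L2R →L[ℂ] L2R} (hA : IsWeylQuantization (indicatorSymbol E) A) : IsSelfAdjoint A := by
  have : IsWeylQuantization (indicatorSymbol E) (ContinuousLinearMap.adjoint A) := by
    intro u v
    rw [ContinuousLinearMap.adjoint_inner_right, ← inner_conj_symm, hA v u,
      integral_indicatorSymbol_mul hE, integral_indicatorSymbol_mul hE, ← wignerForm_conj]
  exact this.unique hA

/-- For fixed v the form is a bounded functional of u, represented by a vector m(v). The map v ↦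
m(v) is linear and bounded by r, and the adjoint of its extension to L² is the required operator. -/
lemma HasBound.exists_weyl {E : Set (ℝ × ℝ)} (hE : MeasurableSet E) {r : ℝ} (hr : 0 ≤ r)
    (h : HasBound E r) :
    ∃ A : L2R →L[ℂ] L2R, IsWeylQuantization (indicatorSymbol E) A ∧ ‖A‖ ≤ r := by
  let e : 𝓢(ℝ, ℂ) →ₗ[ℂ] L2R := (SchwartzMap.toLpCLM ℂ ℂ 2 volume).toLinearMap
  have hd : DenseRange e := denseRange_toLp
  let ℓ : 𝓢(ℝ, ℂ) → (𝓢(ℝ, ℂ) →ₗ[ℂ] ℂ) := fun v =>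
    { toFun := fun u => wignerForm E u v
      map_add' := fun a b => wignerForm_add_left E a b v
      map_smul' := fun c a => wignerForm_smul_left E a v c }
  have hb : ∀ v u, ‖ℓ v u‖ ≤ (r * nrm v) * ‖e u‖ := fun v u =>
    (h u v).trans_eq (by rw [show ‖e u‖ = nrm u from rfl]; ring)
  let m : 𝓢(ℝ, ℂ) → L2R := fun v => (InnerProductSpace.toDual ℂ L2R).symm ((ℓ v).extendOfNorm e)
  have hm : ∀ v u, inner ℂ (m v) (e u) = wignerForm E u v := fun v u => by
    simp only [m, InnerProductSpace.toDual_symm_apply]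
    exact LinearMap.extendOfNorm_eq hd ⟨_, hb v⟩ u
  let M : 𝓢(ℝ, ℂ) →ₗ[ℂ] L2R :=
    { toFun := m
      map_add' := fun a b => by
        apply hd.eq_of_inner_left ℂ
        intro u
        rw [inner_add_left, hm, hm, hm, wignerForm_add_right]
      map_smul' := fun c a => by
        apply hd.eq_of_inner_left ℂ
        intro u
        rw [RingHom.id_apply, inner_smul_left, hm, hm, wignerForm_smul_right] }
  have hMb : ∀ v, ‖M v‖ ≤ r * ‖e v‖ := fun v => by
    change ‖(InnerProductSpace.toDual ℂ L2R).symm ((ℓ v).extendOfNorm e)‖ ≤ _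
    rw [LinearIsometryEquiv.norm_map]
    refine ContinuousLinearMap.opNorm_le_bound _ (by positivity) fun x => ?_
    exact LinearMap.norm_extendOfNorm_apply_le hd (r * nrm v) (hb v) x
  refine ⟨ContinuousLinearMap.adjoint (M.extendOfNorm e), fun u v => ?_, ?_⟩
  · rw [ContinuousLinearMap.adjoint_inner_right, integral_indicatorSymbol_mul hE]
    have := LinearMap.extendOfNorm_eq (f := M) hd ⟨_, hMb⟩ v
    change inner ℂ (M.extendOfNorm e (e v)) (e u) = _
    rw [this]
    exact hm v u
  · rw [LinearIsometryEquiv.norm_map]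
    exact ContinuousLinearMap.opNorm_le_bound _ hr
      fun x => LinearMap.norm_extendOfNorm_apply_le hd r hMb x

lemma IsWeylQuantization.hasBound {E : Set (ℝ × ℝ)} (hE : MeasurableSet E)
    {A : L2R →L[ℂ] L2R} (hA : IsWeylQuantization (indicatorSymbol E) A) : HasBound E ‖A‖ := by
  intro u v
  rw [← integral_indicatorSymbol_mul hE, ← hA u v]
  refine (norm_inner_le_norm _ _).trans ?_
  have := A.le_opNorm (u.toLp 2 volume)
  calc _ ≤ ‖(v.toLp 2 volume : L2R)‖ * (‖A‖ * ‖(u.toLp 2 volume : L2R)‖) := by gcongr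
    _ = ‖A‖ * nrm u * nrm v := by unfold nrm; ring

lemma integral_mul_le_sqrt {α : Type*} [MeasurableSpace α] {μ : Measure α} {f g : α → ℝ}
    (hf : 0 ≤ f) (hg : 0 ≤ g) (hf2 : MemLp f 2 μ) (hg2 : MemLp g 2 μ) :
    ∫ x, f x * g x ∂μ ≤ Real.sqrt (∫ x, f x ^ 2 ∂μ) * Real.sqrt (∫ x, g x ^ 2 ∂μ) := by
  have h := integral_mul_le_Lp_mul_Lq_of_nonneg (μ := μ) (p := 2) (q := 2)
    (by constructor <;> norm_num) (Filter.Eventually.of_forall hf) (Filter.Eventually.of_forall hg)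
    (by simpa using hf2) (by simpa using hg2)
  simpa [Real.sqrt_eq_rpow] using h

lemma nrm_eq_sqrt (u : 𝓢(ℝ, ℂ)) : nrm u = Real.sqrt (∫ x, ‖u x‖ ^ 2) := by
  rw [← nrm_sq, Real.sqrt_sq (nrm_nonneg u)]

lemma schwartz_memLp_norm (u : 𝓢(ℝ, ℂ)) : MemLp (fun x => ‖u x‖) 2 volume := (u.memLp 2 volume).norm

lemma integrable_norm_mul_norm (u v : 𝓢(ℝ, ℂ)) : Integrable (fun x => ‖u x‖ * ‖v x‖) :=
  (schwartz_memLp_norm u).integrable_mul (schwartz_memLp_norm v)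

lemma integral_norm_mul_norm_le (u v : 𝓢(ℝ, ℂ)) : ∫ x, ‖u x‖ * ‖v x‖ ≤ nrm u * nrm v := by
  rw [nrm_eq_sqrt, nrm_eq_sqrt]
  exact integral_mul_le_sqrt (fun x => norm_nonneg _) (fun x => norm_nonneg _)
    (schwartz_memLp_norm u) (schwartz_memLp_norm v)

lemma integral_exp_mul_fourier (f : 𝓢(ℝ, ℂ)) (x : ℝ) :
    ∫ w : ℝ, Complex.exp (((2 * Real.pi * (w * x) : ℝ) : ℂ) * Complex.I) * 𝓕 f w = f x := by
  have h : (𝓕⁻ (𝓕 f : 𝓢(ℝ, ℂ)) : 𝓢(ℝ, ℂ)) = f := FourierTransform.fourierInv_fourier_eq f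
  have h := congrArg (fun f : 𝓢(ℝ, ℂ) => f x) h
  simp only [SchwartzMap.fourierInv_coe] at h
  rw [Real.fourierInv_eq'] at h
  rw [← h]
  congr 1 with w
  simp [mul_comm]

/-- The marginal of the Wigner distribution: Fourier inversion of the slice at z = 0. -/
lemma wigner_integral_snd (u v : 𝓢(ℝ, ℂ)) (x : ℝ) : ∫ ξ, wigner u v (x, ξ) = u x * conj (v x) := by
  have h := integral_exp_mul_fourier (slice u v x) 0
  simp only [wigner_eq_fourier]
  simpa [slice_apply] using h

lemma wigner_integrable_snd (u v : 𝓢(ℝ, ℂ)) (x : ℝ) : Integrable (fun ξ => wigner u v (x, ξ)) := by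
  simp only [wigner_eq_fourier]
  exact (𝓕 (slice u v x)).integrable

/-- A vertical strip `{x ∈ S}` gives the multiplication by the indicator function of `S`. -/
lemma hasBound_strip (S : Set ℝ) : HasBound {p : ℝ × ℝ | p.1 ∈ S} 1 := by
  intro u v
  have h1 : wignerForm {p : ℝ × ℝ | p.1 ∈ S} u v = ∫ x in S, u x * conj (v x) := by
    have : {p : ℝ × ℝ | p.1 ∈ S} = S ×ˢ Set.univ := by ext p; simp
    rw [wignerForm, this, Measure.volume_eq_prod, setIntegral_prod]
    · simp only [Measure.restrict_univ, wigner_integral_snd]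
    · exact (wigner_integrable u v).integrableOn
  rw [h1, one_mul]
  refine le_trans ?_ (integral_norm_mul_norm_le u v)
  refine (norm_integral_le_integral_norm _).trans ?_
  simp only [norm_mul, RCLike.norm_conj]
  exact setIntegral_le_integral (integrable_norm_mul_norm u v)
    (Filter.Eventually.of_forall fun x => by positivity)

/-! ### Covariance under area-preserving affine maps -/

/-- Multiplication by the quadratic phase `exp(iπ(b y² + 2 a y))`. -/
noncomputable def chirp (a b : ℝ) (u : 𝓢(ℝ, ℂ)) : 𝓢(ℝ, ℂ) :=
  SchwartzMap.smulLeftCLM ℂ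
    (fun y : ℝ => Complex.exp (((Real.pi * (b * y ^ 2 + 2 * a * y) : ℝ) : ℂ) * Complex.I)) u

lemma hasTemperateGrowth_exp_I :
    Function.HasTemperateGrowth (fun t : ℝ => Complex.exp ((t : ℂ) * Complex.I)) := by
  have hd : ∀ n, iteratedDeriv n (fun t : ℝ => Complex.exp ((t : ℂ) * Complex.I)) =
      fun t : ℝ => Complex.I ^ n * Complex.exp ((t : ℂ) * Complex.I) := by
    intro n
    induction n with
    | zero => simp
    | succ n ih =>
      rw [iteratedDeriv_succ, ih]
      ext t
      have h : HasDerivAt (fun t : ℝ => Complex.exp ((t : ℂ) * Complex.I))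
          (Complex.exp ((t : ℂ) * Complex.I) * (1 * Complex.I)) t :=
        (((hasDerivAt_id t).ofReal_comp.mul_const Complex.I)).cexp
      rw [(h.const_mul (Complex.I ^ n)).deriv]
      ring
  refine ⟨?_, fun n => ⟨0, 1, fun t => ?_⟩⟩
  · exact (Complex.ofRealCLM.contDiff.mul contDiff_const).cexp
  · rw [norm_iteratedFDeriv_eq_norm_iteratedDeriv, hd]
    simp [Complex.norm_exp_ofReal_mul_I]

lemma chirp_apply (a b : ℝ) (u : 𝓢(ℝ, ℂ)) (y : ℝ) :
    chirp a b u y =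
      Complex.exp (((Real.pi * (b * y ^ 2 + 2 * a * y) : ℝ) : ℂ) * Complex.I) * u y := by
  refine SchwartzMap.smulLeftCLM_apply_apply (g := fun y : ℝ =>
    Complex.exp (((Real.pi * (b * y ^ 2 + 2 * a * y) : ℝ) : ℂ) * Complex.I)) ?_ u y
  exact hasTemperateGrowth_exp_I.comp (f := fun y : ℝ => Real.pi * (b * y ^ 2 + 2 * a * y))
    (by fun_prop)

lemma nrm_congr {u v : 𝓢(ℝ, ℂ)} (h : ∀ x, ‖u x‖ = ‖v x‖) : nrm u = nrm v := by
  simp only [nrm_eq_sqrt, h]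

lemma nrm_chirp (a b : ℝ) (u : 𝓢(ℝ, ℂ)) : nrm (chirp a b u) = nrm u :=
  nrm_congr fun x => by rw [chirp_apply, norm_mul, Complex.norm_exp_ofReal_mul_I, one_mul]

/-- The difference of the quadratic phases at x + z/2 and x - z/2 is 2πz(bx + a), which is linear in
z and hence only shifts ξ. -/
lemma wigner_chirp (a b : ℝ) (u v : 𝓢(ℝ, ℂ)) (x ξ : ℝ) :
    wigner u v (x, ξ) = wigner (chirp a b u) (chirp a b v) (x, ξ + b * x + a) := by
  unfold wigner
  congr 1 with z
  simp only [chirp_apply, map_mul, ← Complex.exp_conj, Complex.conj_ofReal, Complex.conj_I]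
  rw [show ∀ A B C D E : ℂ, A * (B * C * (D * E)) = (A * B * D) * (C * E) by intros; ring,
    ← Complex.exp_add, ← Complex.exp_add]
  congr 2
  push_cast
  ring

/-- Translation of a Schwartz function. -/
noncomputable def shift (a : ℝ) (u : 𝓢(ℝ, ℂ)) : 𝓢(ℝ, ℂ) := affineComp u (-a) 1 one_ne_zero

lemma shift_apply (a : ℝ) (u : 𝓢(ℝ, ℂ)) (y : ℝ) : shift a u y = u (y - a) := by
  simp only [shift, affineComp_apply]; ring_nf

lemma nrm_shift (a : ℝ) (u : 𝓢(ℝ, ℂ)) : nrm (shift a u) = nrm u := by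
  simp only [nrm_eq_sqrt, shift_apply]
  rw [integral_sub_right_eq_self (fun x => ‖u x‖ ^ 2) a]

lemma wigner_shift (a : ℝ) (u v : 𝓢(ℝ, ℂ)) (x ξ : ℝ) :
    wigner u v (x, ξ) = wigner (shift a u) (shift a v) (x + a, ξ) := by
  unfold wigner
  congr 1 with z
  simp only [shift_apply]
  ring_nf

lemma nrm_fourier (u : 𝓢(ℝ, ℂ)) : nrm (𝓕 u) = nrm u := SchwartzMap.norm_fourier_toL2_eq u

/-- With y = x + z/2 the Wigner function becomes a pairing of u with v reflected through the phase
space point (x, ξ), a form suited to the Fourier transform. -/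
lemma wigner_eq_integral_reflection (u v : 𝓢(ℝ, ℂ)) (x ξ : ℝ) :
    wigner u v (x, ξ) = ∫ y : ℝ, u y *
      (2 * Complex.exp (((-4 * Real.pi * (y - x) * ξ : ℝ) : ℂ) * Complex.I) *
        conj (v (2 * x - y))) := by
  have h1 := integral_sub_right_eq_self (μ := volume) (fun y : ℝ => u (y + x) *
      (2 * Complex.exp (((-4 * Real.pi * y * ξ : ℝ) : ℂ) * Complex.I) * conj (v (x - y)))) x
  have h2 := Measure.integral_comp_div (fun y : ℝ => u (y + x) *
      (2 * Complex.exp (((-4 * Real.pi * y * ξ : ℝ) : ℂ) * Complex.I) * conj (v (x - y)))) (2 : ℝ)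
  have h3 : (fun y : ℝ => u y *
      (2 * Complex.exp (((-4 * Real.pi * (y - x) * ξ : ℝ) : ℂ) * Complex.I) *
        conj (v (2 * x - y)))) = fun y : ℝ => u (y - x + x) *
      (2 * Complex.exp (((-4 * Real.pi * (y - x) * ξ : ℝ) : ℂ) * Complex.I) *
        conj (v (x - (y - x)))) := by
    ext y; ring_nf
  rw [h3, h1]
  have h4 : ∀ I : ℂ, |(2 : ℝ)| • I = 2 * I := by intro I; simp
  rw [h4] at h2
  have h5 : (2 : ℂ) ≠ 0 := two_ne_zero
  rw [← mul_right_inj' h5, ← h2]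
  unfold wigner
  rw [← integral_const_mul]
  congr 1 with z
  rw [add_comm (z / 2) x]
  have : (-(2 * Real.pi * Complex.I * z * ξ) : ℂ) =
    (((-4 * Real.pi * (z / 2) * ξ : ℝ) : ℂ) * Complex.I) := by push_cast; ring
  simp only [this]
  ring

lemma wigner_fourier (u v : 𝓢(ℝ, ℂ)) (x ξ : ℝ) :
    wigner u v (x, ξ) = wigner (𝓕 u) (𝓕 v) (ξ, -x) := by
  rw [wigner_eq_integral_reflection, wigner_eq_integral_reflection]
  -- The function k is the reflection kernel of 𝓕 v at (ξ, -x). Its Fourier transform is the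
  -- reflection kernel of v at (x, ξ), so the claim is the multiplication formula ∫ 𝓕u · k = ∫ u ·
  -- 𝓕k.
  let k : 𝓢(ℝ, ℂ) := (2 * Complex.exp (((-4 * Real.pi * x * ξ : ℝ) : ℂ) * Complex.I)) •
    chirp (2 * x) 0 (conjSchwartz (affineComp (𝓕 v) (2 * ξ) (-1) (by norm_num)))
  have hk : ∀ η : ℝ, k η = 2 * Complex.exp (((-4 * Real.pi * (η - ξ) * -x : ℝ) : ℂ) * Complex.I) *
      conj (𝓕 v (2 * ξ - η)) := by
    intro η
    simp only [k, smul_apply, chirp_apply, conjSchwartz_apply, affineComp_apply, smul_eq_mul]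
    rw [show ∀ A B C : ℂ, 2 * A * (B * C) = 2 * (A * B) * C by intros; ring, ← Complex.exp_add]
    congr 4
    · push_cast; ring
    · ring
  have hk2 : ∀ y : ℝ, 𝓕 k y = 2 * Complex.exp (((-4 * Real.pi * (y - x) * ξ : ℝ) : ℂ) * Complex.I)
      * conj (v (2 * x - y)) := by
    intro y
    have hv : v (2 * x - y) = ∫ w : ℝ,
        Complex.exp (((2 * Real.pi * (w * (2 * x - y)) : ℝ) : ℂ) * Complex.I) * 𝓕 v w :=
      (integral_exp_mul_fourier v _).symm
    rw [hv, ← integral_conj, ← integral_const_mul, SchwartzMap.fourier_coe,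
      Real.fourier_real_eq_integral_exp_smul,
      ← integral_sub_left_eq_self (μ := volume) _ (2 * ξ)]
    congr 1 with w
    rw [hk, smul_eq_mul]
    simp only [map_mul, ← Complex.exp_conj, Complex.conj_ofReal, Complex.conj_I, sub_sub_cancel]
    rw [show ∀ A B C : ℂ, A * (2 * B * C) = 2 * (A * B) * C by intros; ring, ← Complex.exp_add,
      show ∀ A B C : ℂ, 2 * A * (B * C) = 2 * (A * B) * C by intros; ring, ← Complex.exp_add]
    congr 3
    push_cast; ring
  have := SchwartzMap.integral_fourier_mul_eq u k
  simp only [hk, hk2] at this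
  exact this.symm

/-- The half plane `{a x + b ξ ≥ c}`. -/
def halfPlane (a b c : ℝ) : Set (ℝ × ℝ) := {p | c ≤ a * p.1 + b * p.2}

/-- A map of the plane under which the bounds of the Weyl quantizations and the class of half
planes are invariant. -/
structure IsCovariance (g : ℝ × ℝ → ℝ × ℝ) : Prop where
  bound : ∀ (E : Set (ℝ × ℝ)) (r : ℝ), HasBound E r → HasBound (g ⁻¹' E) r
  half : ∀ a b c : ℝ, ∃ a' b' c' : ℝ, halfPlane a b c = g ⁻¹' halfPlane a' b' c'

lemma IsCovariance.comp {g h : ℝ × ℝ → ℝ × ℝ} (hg : IsCovariance g) (hh : IsCovariance h) :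
    IsCovariance (g ∘ h) where
  bound E r hE := hh.bound _ r (hg.bound E r hE)
  half a b c := by
    obtain ⟨a', b', c', h1⟩ := hh.half a b c
    obtain ⟨a'', b'', c'', h2⟩ := hg.half a' b' c'
    exact ⟨a'', b'', c'', by rw [h1, h2]; rfl⟩

lemma hasBound_preimage {g : ℝ × ℝ → ℝ × ℝ} (hm : MeasurePreserving g)
    (hc : Continuous g) (hi : Function.Injective g) (S : 𝓢(ℝ, ℂ) → 𝓢(ℝ, ℂ))
    (hS : ∀ u, nrm (S u) = nrm u)
    (hW : ∀ u v p, wigner u v p = wigner (S u) (S v) (g p)) {E : Set (ℝ × ℝ)} {r : ℝ}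
    (h : HasBound E r) : HasBound (g ⁻¹' E) r := by
  intro u v
  have := hm.setIntegral_preimage_emb (hc.measurableEmbedding hi) (wigner (S u) (S v)) E
  simp only [← hW] at this
  rw [wignerForm, this, ← hS u, ← hS v]
  exact h _ _

lemma isCovariance_translate (a : ℝ) : IsCovariance (fun p : ℝ × ℝ => (p.1 + a, p.2)) where
  bound E r hE := by
    refine hasBound_preimage ?_ (by fun_prop) ?_ (shift a) (nrm_shift a)
      (fun u v p => wigner_shift a u v p.1 p.2) hE
    · have := measurePreserving_add_right (volume : Measure (ℝ × ℝ)) ((a, 0) : ℝ × ℝ)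
      have e : (fun p : ℝ × ℝ => (p.1 + a, p.2)) = fun p => p + (a, 0) := by
        ext p <;> simp
      rw [e]
      exact this
    · rintro ⟨x, y⟩ ⟨x', y'⟩ h
      simpa using h
  half α β c := ⟨α, β, c + α * a, by
    ext p
    simp only [halfPlane, Set.mem_ofPred_eq, Set.mem_preimage]
    constructor <;> intro h <;> linarith⟩

lemma isCovariance_shear (a b : ℝ) :
    IsCovariance (fun p : ℝ × ℝ => (p.1, p.2 + b * p.1 + a)) where
  bound E r hE := by
    refine hasBound_preimage ?_ (by fun_prop) ?_ (chirp a b) (nrm_chirp a b)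
      (fun u v p => wigner_chirp a b u v p.1 p.2) hE
    · refine MeasurePreserving.skew_product (MeasurePreserving.id volume)
        (g := fun x ξ => ξ + b * x + a) (by fun_prop) ?_
      filter_upwards with x
      have := (measurePreserving_add_right (volume : Measure ℝ) (b * x + a)).map_eq
      have e : (fun ξ : ℝ => ξ + b * x + a) = fun ξ => ξ + (b * x + a) := by
        ext ξ; ring
      rw [e]
      exact this
    · rintro ⟨x, y⟩ ⟨x', y'⟩ h
      simp only [Prod.mk.injEq] at h
      obtain ⟨rfl, h⟩ := h
      simpa using h
  half α β c := ⟨α - β * b, β, c + β * a, by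
    ext p
    simp only [halfPlane, Set.mem_ofPred_eq, Set.mem_preimage]
    constructor <;> intro h <;> linarith⟩

lemma isCovariance_rotate : IsCovariance (fun p : ℝ × ℝ => (p.2, -p.1)) where
  bound E r hE := by
    refine hasBound_preimage ?_ (by fun_prop) ?_ (fun u => 𝓕 u) nrm_fourier
      (fun u v p => wigner_fourier u v p.1 p.2) hE
    · have h1 := (MeasurePreserving.id (volume : Measure ℝ)).prod
        (Measure.measurePreserving_neg (volume : Measure ℝ))
      have h2 := Measure.measurePreserving_swap (μ := (volume : Measure ℝ))
        (ν := (volume : Measure ℝ))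
      exact h1.comp h2
    · rintro ⟨x, y⟩ ⟨x', y'⟩ h
      simp only [Prod.mk.injEq, neg_inj] at h
      exact Prod.ext h.2 h.1
  half α β c := ⟨β, -α, c, by
    ext p
    simp only [halfPlane, Set.mem_ofPred_eq, Set.mem_preimage]
    constructor <;> intro h <;> linarith⟩

/-! ### Half planes and intersections of two half planes -/

/-- Every half plane can be moved to `{x ≥ 0}`. -/
lemma exists_covariance_halfPlane {a b : ℝ} (h : a ≠ 0 ∨ b ≠ 0) (c : ℝ) :
    ∃ g, IsCovariance g ∧ halfPlane a b c = g ⁻¹' {p | 0 ≤ p.1} := by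
  have hpos : ∀ a c : ℝ, 0 < a → ∃ g, IsCovariance g ∧ halfPlane a 0 c = g ⁻¹' {p | 0 ≤ p.1} := by
    intro a c ha
    refine ⟨_, isCovariance_translate (-(c / a)), ?_⟩
    ext p
    simp only [halfPlane, Set.mem_ofPred_eq, Set.mem_preimage, zero_mul, add_zero]
    rw [← div_le_iff₀' ha]
    constructor <;> intro h <;> linarith
  have hx : ∀ a c : ℝ, a ≠ 0 → ∃ g, IsCovariance g ∧ halfPlane a 0 c = g ⁻¹' {p | 0 ≤ p.1} := by
    intro a c ha
    rcases lt_or_gt_of_ne ha with ha | ha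
    · obtain ⟨g, hg, h⟩ := hpos (-a) c (neg_pos.2 ha)
      -- Two quarter turns are the point reflection, which changes the sign of a.
      refine ⟨_, hg.comp (isCovariance_rotate.comp isCovariance_rotate), ?_⟩
      rw [Set.preimage_comp, ← h]
      ext p
      simp [halfPlane]
    · exact hpos a c ha
  by_cases hb : b = 0
  · subst hb
    exact hx a c (by simpa using h)
  · obtain ⟨g, hg, h⟩ := hx b c hb
    -- The shear turns the form aξ-part and x-part into a multiple of the second coordinate alone,
    -- which the rotation exchanges with the first.
    refine ⟨_, hg.comp (isCovariance_rotate.comp (isCovariance_shear 0 (a / b))), ?_⟩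
    rw [Set.preimage_comp, ← h]
    ext p
    simp only [halfPlane, Set.mem_ofPred_eq, Set.mem_preimage, Function.comp]
    have : b * (p.2 + a / b * p.1 + 0) = a * p.1 + b * p.2 := by field_simp; ring
    rw [this]; simp

lemma hasBound_univ : HasBound Set.univ 1 := by
  simpa using hasBound_strip Set.univ

lemma hasBound_empty : HasBound ∅ 1 := by
  simpa using hasBound_strip ∅

/-- An intersection of two half planes has the bound of the quarter plane. -/
lemma hasBound_inter_halfPlane {μ : ℝ} (h1 : 1 ≤ μ) (hq : HasBound quarterPlane μ)
    (a b c a' b' c' : ℝ) : HasBound (halfPlane a b c ∩ halfPlane a' b' c') μ := by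
  have hrot := fun E => isCovariance_rotate.bound E μ
  have hquad : ∀ β : ℝ, β ≠ 0 → HasBound {p : ℝ × ℝ | 0 ≤ p.1 ∧ 0 ≤ β * p.2} μ := by
    intro β hβ
    rcases lt_or_gt_of_ne hβ with hβ | hβ
    -- The fourth quadrant is the quarter plane turned once; three quarter turns invert one.
    · convert hrot _ (hrot _ (hrot _ hq)) using 1
      ext p
      simp only [quarterPlane, Set.mem_ofPred_eq, Set.mem_preimage, neg_neg]
      constructor
      · rintro ⟨h, h'⟩
        exact ⟨by nlinarith, h⟩
      · rintro ⟨h, h'⟩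
        exact ⟨h', by nlinarith⟩
    · convert hq using 1
      ext p
      simp only [quarterPlane, Set.mem_ofPred_eq]
      rw [mul_nonneg_iff_of_pos_left hβ]
  have hmain : ∀ a b c a' b' c' : ℝ, (a ≠ 0 ∨ b ≠ 0) →
      HasBound (halfPlane a b c ∩ halfPlane a' b' c') μ := by
    intro a b c a' b' c' h
    obtain ⟨g, hg, e⟩ := exists_covariance_halfPlane h c
    obtain ⟨α, β, γ, e'⟩ := hg.half a' b' c'
    rw [e, e', ← Set.preimage_inter]
    apply hg.bound
    -- Once the first half plane is x ≥ 0, the second either has a vertical boundary, leaving a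
    -- strip, or is sheared to 0 ≤ βξ without disturbing the first.
    by_cases hβ : β = 0
    · subst hβ
      refine HasBound.mono ?_ h1
      convert hasBound_strip {x : ℝ | 0 ≤ x ∧ γ ≤ α * x} using 1
      ext p; simp [halfPlane]
    · convert (isCovariance_shear (-(γ / β)) (α / β)).bound _ μ (hquad β hβ) using 1
      ext p
      simp only [halfPlane, Set.mem_inter_iff, Set.mem_ofPred_eq, Set.mem_preimage]
      have : β * (p.2 + α / β * p.1 + -(γ / β)) = α * p.1 + β * p.2 - γ := by field_simp; ring
      rw [this, sub_nonneg]
  by_cases h : a ≠ 0 ∨ b ≠ 0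
  · exact hmain a b c a' b' c' h
  by_cases h' : a' ≠ 0 ∨ b' ≠ 0
  · rw [Set.inter_comm]
    exact hmain _ _ _ _ _ _ h'
  · push Not at h h'
    obtain ⟨rfl, rfl⟩ := h
    obtain ⟨rfl, rfl⟩ := h'
    by_cases hc : c ≤ 0 ∧ c' ≤ 0
    · convert hasBound_univ.mono h1 using 1
      ext p; simp [halfPlane, hc]
    · convert hasBound_empty.mono h1 using 1
      ext p; simpa [halfPlane] using fun h => lt_of_not_ge fun h' => hc ⟨h, h'⟩

end

section
open Set Filter Topology
open scoped FourierTransform ComplexConjugate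

/-! ### Integrals of a Fourier transform over intervals -/

section interval
variable {g h : ℝ → ℂ}

/-- Differentiating 𝓕 h brings down -2πiz, so division by z on the physical side provides a
primitive of 𝓕 g. -/
lemma hasDerivAt_fourier_div (hh : Integrable h) (hg : Integrable g)
    (hgh : ∀ z : ℝ, g z = z * h z) (ξ : ℝ) :
    HasDerivAt (fun ξ => Complex.I / (2 * Real.pi) * 𝓕 h ξ) (𝓕 g ξ) ξ := by
  have h1 : Integrable (fun z : ℝ => z • h z) := hg.congr (by
    filter_upwards with z; rw [hgh]; simp)
  have h2 := (Real.hasDerivAt_fourier hh h1 ξ).const_mul (Complex.I / (2 * Real.pi))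
  refine h2.congr_deriv ?_
  have hpi : (Real.pi : ℂ) ≠ 0 := Complex.ofReal_ne_zero.2 Real.pi_ne_zero
  rw [Real.fourier_real_eq_integral_exp_smul, Real.fourier_real_eq_integral_exp_smul,
    ← integral_const_mul]
  congr 1 with z
  rw [hgh]
  simp only [smul_eq_mul]
  field_simp
  linear_combination (-(z * h z)) * Complex.I_sq

lemma norm_fourier_le_integral (ξ : ℝ) : ‖𝓕 h ξ‖ ≤ ∫ z, ‖h z‖ := by
  rw [Real.fourier_eq]
  refine (norm_integral_le_integral_norm _).trans_eq ?_
  simp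

lemma norm_I_div_two_pi : ‖(Complex.I / (2 * Real.pi) : ℂ)‖ = 1 / (2 * Real.pi) := by
  rw [norm_div, Complex.norm_I, norm_mul, Complex.norm_real, Real.norm_of_nonneg Real.pi_pos.le]
  simp

lemma norm_intervalIntegral_fourier_le (hh : Integrable h) (hg : Integrable g)
    (hgh : ∀ z : ℝ, g z = z * h z) (hF : Integrable (𝓕 g)) (a b : ℝ) :
    ‖∫ ξ in a..b, 𝓕 g ξ‖ ≤ 1 / Real.pi * ∫ z, ‖h z‖ := by
  rw [intervalIntegral.integral_eq_sub_of_hasDerivAt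
    (fun ξ _ => hasDerivAt_fourier_div hh hg hgh ξ) hF.intervalIntegrable, ← mul_sub, norm_mul,
    norm_I_div_two_pi]
  have := (norm_sub_le (𝓕 h b) (𝓕 h a)).trans
    (add_le_add (norm_fourier_le_integral b) (norm_fourier_le_integral a))
  have hpi := Real.pi_pos
  calc _ ≤ 1 / (2 * Real.pi) * ((∫ z, ‖h z‖) + ∫ z, ‖h z‖) := by gcongr
    _ = _ := by field_simp; ring

/-- The primitive is bounded by (1/2π)∫|h| and an interval has two ends. The bound does not depend
on the interval, which makes the final constants independent of the shape and the area of the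
symbol. -/
lemma norm_setIntegral_fourier_le (hh : Integrable h) (hg : Integrable g)
    (hgh : ∀ z : ℝ, g z = z * h z) (hF : Integrable (𝓕 g)) {I : Set ℝ} (hI : I.OrdConnected) :
    ‖∫ ξ in I, 𝓕 g ξ‖ ≤ 1 / Real.pi * ∫ z, ‖h z‖ := by
  have key := norm_intervalIntegral_fourier_le hh hg hgh hF
  have h0 : 0 ≤ 1 / Real.pi * ∫ z, ‖h z‖ := (norm_nonneg _).trans (key 0 0)
  have hIoc : ∀ a b : ℝ, ‖∫ ξ in Ioc a b, 𝓕 g ξ‖ ≤ 1 / Real.pi * ∫ z, ‖h z‖ := by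
    intro a b
    rcases le_total a b with hab | hab
    · rw [← intervalIntegral.integral_of_le hab]; exact key a b
    · rw [Ioc_eq_empty (not_lt.2 hab)]; simpa using h0
  have hIoi : ∀ a : ℝ, ‖∫ ξ in Ioi a, 𝓕 g ξ‖ ≤ 1 / Real.pi * ∫ z, ‖h z‖ := fun a =>
    le_of_tendsto (intervalIntegral_tendsto_integral_Ioi a hF.integrableOn tendsto_id).norm
      (Eventually.of_forall fun b => key a b)
  have hIic : ∀ a : ℝ, ‖∫ ξ in Iic a, 𝓕 g ξ‖ ≤ 1 / Real.pi * ∫ z, ‖h z‖ := fun a =>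
    le_of_tendsto (intervalIntegral_tendsto_integral_Iic a hF.integrableOn tendsto_id).norm
      (Eventually.of_forall fun b => key b a)
  have huniv : ‖∫ ξ, 𝓕 g ξ‖ ≤ 1 / Real.pi * ∫ z, ‖h z‖ :=
    le_of_tendsto (intervalIntegral_tendsto_integral hF tendsto_neg_atTop_atBot tendsto_id).norm
      (Eventually.of_forall fun b => key _ _)
  rcases hI.isPreconnected.mem_intervals with (hs | hs | hs | hs | hs | hs | hs | hs | hs | hs) <;>
    rw [hs]
  · rw [integral_Icc_eq_integral_Ioc]; exact hIoc _ _
  · rw [integral_Ico_eq_integral_Ioc]; exact hIoc _ _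
  · exact hIoc _ _
  · rw [← integral_Ioc_eq_integral_Ioo]; exact hIoc _ _
  · rw [integral_Ici_eq_integral_Ioi]; exact hIoi _
  · exact hIoi _
  · exact hIic _
  · rw [← integral_Iic_eq_integral_Iio]; exact hIic _
  · rw [Measure.restrict_univ]; exact huniv
  · simpa using h0

/-- By the Riemann–Lebesgue lemma the primitive vanishes at infinity, so only its value at 0
remains. -/
lemma setIntegral_Ici_fourier (hh : Integrable h) (hg : Integrable g)
    (hgh : ∀ z : ℝ, g z = z * h z) (hF : Integrable (𝓕 g)) :
    ∫ ξ in Ici (0 : ℝ), 𝓕 g ξ = 1 / (2 * Real.pi * Complex.I) * ∫ z, h z := by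
  have h1 : Tendsto (fun ξ => Complex.I / (2 * Real.pi) * 𝓕 h ξ) atTop (𝓝 0) := by
    have := (Real.zero_at_infty_fourier h).mono_left atTop_le_cocompact
    simpa using this.const_mul (Complex.I / (2 * Real.pi))
  rw [integral_Ici_eq_integral_Ioi, integral_Ioi_of_hasDerivAt_of_tendsto' (fun ξ _ =>
    hasDerivAt_fourier_div hh hg hgh ξ) hF.integrableOn h1, Real.fourier_real_eq_integral_exp_smul]
  have hpi : (Real.pi : ℂ) ≠ 0 := Complex.ofReal_ne_zero.2 Real.pi_ne_zero
  have hI := Complex.I_ne_zero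
  simp only [mul_zero, Complex.ofReal_zero, zero_mul, Complex.exp_zero, one_smul]
  field_simp
  linear_combination (-(∫ z, h z)) * Complex.I_sq

end interval

/-! ### Splitting a function at the origin -/

/-- The Schwartz function `u` vanishes in a neighbourhood of the origin. -/
def VanishesNearZero (u : 𝓢(ℝ, ℂ)) : Prop := ∃ ε > 0, ∀ y : ℝ, |y| ≤ ε → u y = 0

lemma indicator_contDiff_and_decay (u : 𝓢(ℝ, ℂ)) {S : Set ℝ}
    (hS : ∀ y, u =ᶠ[𝓝 y] 0 ∨ S ∈ 𝓝 y ∨ Sᶜ ∈ 𝓝 y) (y : ℝ) :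
    S.indicator u =ᶠ[𝓝 y] u ∨ S.indicator u =ᶠ[𝓝 y] 0 := by
  rcases hS y with h | h | h
  · right
    filter_upwards [h] with z hz
    by_cases hzS : z ∈ S <;> simp [hzS, hz]
  · left
    filter_upwards [h] with z hz
    simp [hz]
  · right
    filter_upwards [h] with z hz
    simp [show z ∉ S from hz]

/-- The restriction of a Schwartz function to a set whose boundary avoids its support. -/
noncomputable def restrictSchwartz (u : 𝓢(ℝ, ℂ)) (S : Set ℝ)
    (hS : ∀ y, u =ᶠ[𝓝 y] 0 ∨ S ∈ 𝓝 y ∨ Sᶜ ∈ 𝓝 y) : 𝓢(ℝ, ℂ) where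
  toFun := S.indicator u
  smooth' := by
    rw [contDiff_iff_contDiffAt]
    intro y
    rcases indicator_contDiff_and_decay u hS y with h | h
    · exact (u.contDiffAt _).congr_of_eventuallyEq h
    · exact contDiffAt_const.congr_of_eventuallyEq h
  decay' k n := by
    obtain ⟨C, hC⟩ := u.decay' k n
    refine ⟨C, fun y => ?_⟩
    rcases indicator_contDiff_and_decay u hS y with h | h
    · rw [(h.iteratedFDeriv ℝ n).eq_of_nhds]; exact hC y
    · rw [(h.iteratedFDeriv ℝ n).eq_of_nhds]
      have h0 : iteratedFDeriv ℝ n (0 : ℝ → ℂ) y = 0 := by simp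
      rw [h0, norm_zero, mul_zero]
      exact le_trans (by positivity) (hC y)

lemma VanishesNearZero.dichotomy {u : 𝓢(ℝ, ℂ)} (hu : VanishesNearZero u) (y : ℝ) :
    u =ᶠ[𝓝 y] 0 ∨ Ioi (0 : ℝ) ∈ 𝓝 y ∨ (Ioi (0 : ℝ))ᶜ ∈ 𝓝 y := by
  obtain ⟨ε, hε, h⟩ := hu
  rcases lt_trichotomy y 0 with hy | rfl | hy
  · right; right
    filter_upwards [Iio_mem_nhds hy] with z hz
    simpa using le_of_lt hz
  · left
    filter_upwards [Metric.ball_mem_nhds (0 : ℝ) hε] with z hz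
    exact h z (by simpa using (mem_ball_zero_iff.1 hz).le)
  · right; left
    exact Ioi_mem_nhds hy

/-- The decomposition of a Schwartz function which vanishes near the origin into the parts
supported by the two half lines. -/
lemma VanishesNearZero.decompose {u : 𝓢(ℝ, ℂ)} (hu : VanishesNearZero u) :
    ∃ p n : 𝓢(ℝ, ℂ), ∃ ε > 0, u = p + n ∧ (∀ y, y ≤ ε → p y = 0) ∧ (∀ y, -ε ≤ y → n y = 0) ∧
      (∀ y, 0 < y → p y = u y) ∧ (∀ y, y < 0 → n y = u y) := by
  obtain ⟨ε, hε, h⟩ := id hu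
  let p := restrictSchwartz u (Ioi 0) hu.dichotomy
  have hp : ∀ y, p y = (Ioi (0 : ℝ)).indicator u y := fun y => rfl
  have h1 : ∀ y, 0 < y → p y = u y := fun y hy => by rw [hp]; simp [hy]
  have h2 : ∀ y, y ≤ 0 → p y = 0 := fun y hy => by rw [hp]; simp [hy]
  have h3 : ∀ y, y ≤ ε → p y = 0 := fun y hy => by
    rcases le_or_gt y 0 with h0 | h0
    · exact h2 y h0
    · rw [h1 y h0, h y (by rw [abs_of_pos h0]; exact hy)]
  refine ⟨p, u - p, ε, hε, by simp, h3, ?_, h1, ?_⟩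
  · intro y hy
    rw [sub_apply, sub_eq_zero]
    rcases le_or_gt y 0 with h0 | h0
    · rw [h2 y h0, h y (by rw [abs_of_nonpos h0]; linarith)]
    · exact (h1 y h0).symm
  · intro y hy
    rw [sub_apply, h2 y hy.le, sub_zero]

lemma nrm_sq_decompose {u p n : 𝓢(ℝ, ℂ)} (h : u = p + n) (hpn : ∀ y, p y = 0 ∨ n y = 0) :
    nrm u ^ 2 = nrm p ^ 2 + nrm n ^ 2 := by
  rw [nrm_sq, nrm_sq, nrm_sq, ← integral_add]
  · congr 1 with y
    rw [h, add_apply]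
    rcases hpn y with h | h <;> simp [h]
  · exact (p.memLp 2 volume).integrable_norm_pow (by norm_num)
  · exact (n.memLp 2 volume).integrable_norm_pow (by norm_num)

/-! ### Linear and logarithmic changes of variables in the plane -/

section planar

/-- The linear map of the plane with matrix `!![a, b; c, d]`. -/
noncomputable def planeMap (a b c d : ℝ) : ℝ × ℝ →L[ℝ] ℝ × ℝ :=
  (a • ContinuousLinearMap.fst ℝ ℝ ℝ + b • ContinuousLinearMap.snd ℝ ℝ ℝ).prod
    (c • ContinuousLinearMap.fst ℝ ℝ ℝ + d • ContinuousLinearMap.snd ℝ ℝ ℝ)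

lemma planeMap_apply (a b c d : ℝ) (p : ℝ × ℝ) :
    planeMap a b c d p = (a * p.1 + b * p.2, c * p.1 + d * p.2) := rfl

lemma planeMap_det (a b c d : ℝ) : (planeMap a b c d).det = a * d - b * c := by
  rw [ContinuousLinearMap.det, ← LinearMap.det_toMatrix (Module.Basis.finTwoProd ℝ),
    Matrix.det_fin_two]
  simp [LinearMap.toMatrix_apply, planeMap_apply]

lemma measurePreserving_planeMap {a b c d : ℝ} (h : |a * d - b * c| = 1) :
    MeasurePreserving (planeMap a b c d) := by
  refine ⟨(planeMap a b c d).continuous.measurable, ?_⟩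
  have hd : LinearMap.det (planeMap a b c d : ℝ × ℝ →ₗ[ℝ] ℝ × ℝ) = a * d - b * c :=
    planeMap_det a b c d
  have h0 : a * d - b * c ≠ 0 := fun h0 => by simp [h0] at h
  have := Measure.map_linearMap_addHaar_eq_smul_addHaar (volume : Measure (ℝ × ℝ))
    (f := (planeMap a b c d : ℝ × ℝ →ₗ[ℝ] ℝ × ℝ)) (by rw [hd]; exact h0)
  rw [hd, abs_inv, h] at this
  simpa using this

lemma planeMap_measurableEmbedding {a b c d : ℝ} (h : |a * d - b * c| = 1) :
    MeasurableEmbedding (planeMap a b c d) := by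
  refine (planeMap a b c d).continuous.measurableEmbedding ?_
  have h0 : a * d - b * c ≠ 0 := fun h0 => by simp [h0] at h
  rintro ⟨x, y⟩ ⟨x', y'⟩ e
  simp only [planeMap_apply, Prod.mk.injEq] at e
  obtain ⟨e1, e2⟩ := e
  apply Prod.ext
  · have : (a * d - b * c) * (x - x') = 0 := by linear_combination d * e1 - b * e2
    simpa [h0, sub_eq_zero] using this
  · have : (a * d - b * c) * (y - y') = 0 := by linear_combination a * e2 - c * e1
    simpa [h0, sub_eq_zero] using this

/-- Logarithmic polar coordinates `(σ, r) ↦ (exp (σ + r/2), exp (σ - r/2))` of the quadrant. -/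
noncomputable def logCoord (q : ℝ × ℝ) : ℝ × ℝ :=
  (Real.exp (q.1 + q.2 / 2), Real.exp (q.1 - q.2 / 2))

lemma logCoord_injective : Function.Injective logCoord := by
  rintro ⟨s, r⟩ ⟨s', r'⟩ h
  simp only [logCoord, Prod.mk.injEq, Real.exp_eq_exp] at h
  obtain ⟨h1, h2⟩ := h
  exact Prod.ext (by linarith) (by linarith)

lemma logCoord_range : range logCoord = Ioi (0 : ℝ) ×ˢ Ioi (0 : ℝ) := by
  ext ⟨a, b⟩
  simp only [mem_range, mem_prod, mem_Ioi]
  constructor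
  · rintro ⟨q, hq⟩
    simp only [logCoord, Prod.mk.injEq] at hq
    exact ⟨hq.1 ▸ Real.exp_pos _, hq.2 ▸ Real.exp_pos _⟩
  · rintro ⟨ha, hb⟩
    refine ⟨((Real.log a + Real.log b) / 2, Real.log a - Real.log b), ?_⟩
    simp only [logCoord, Prod.mk.injEq]
    constructor
    · rw [← Real.exp_log ha]; congr 1; simp only [Real.exp_log ha]; ring
    · rw [← Real.exp_log hb]; congr 1; simp only [Real.exp_log hb]; ring

lemma hasFDerivAt_logCoord (q : ℝ × ℝ) :
    HasFDerivAt logCoord (planeMap (logCoord q).1 ((logCoord q).1 / 2) (logCoord q).2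
      (-(logCoord q).2 / 2)) q := by
  have h1 : HasFDerivAt (fun q : ℝ × ℝ => q.1) (ContinuousLinearMap.fst ℝ ℝ ℝ) q :=
    hasFDerivAt_fst
  have h2 : HasFDerivAt (fun q : ℝ × ℝ => q.2) (ContinuousLinearMap.snd ℝ ℝ ℝ) q :=
    hasFDerivAt_snd
  have h3 := ((h1.add (h2.mul_const (1 / 2))).exp).prodMk ((h1.sub (h2.mul_const (1 / 2))).exp)
  refine (h3.congr_fderiv ?_).congr_of_eventuallyEq (Eventually.of_forall fun q => ?_)
  · ext <;> simp [planeMap_apply, logCoord] <;> ring_nf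
  · simp only [logCoord, Pi.add_apply, Pi.sub_apply]; ring_nf

lemma logCoord_det (q : ℝ × ℝ) :
    |(planeMap (logCoord q).1 ((logCoord q).1 / 2) (logCoord q).2 (-(logCoord q).2 / 2)).det| =
      Real.exp (2 * q.1) := by
  rw [planeMap_det]
  have : (logCoord q).1 * (logCoord q).2 = Real.exp (2 * q.1) := by
    simp only [logCoord]
    rw [← Real.exp_add]; congr 1; ring
  rw [show (logCoord q).1 * (-(logCoord q).2 / 2) - (logCoord q).1 / 2 * (logCoord q).2
    = -((logCoord q).1 * (logCoord q).2) by ring, this, abs_neg, abs_of_pos (Real.exp_pos _)]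

lemma lintegral_logCoord (F : ℝ × ℝ → ENNReal) :
    ∫⁻ p in Ioi (0 : ℝ) ×ˢ Ioi (0 : ℝ), F p =
      ∫⁻ q, ENNReal.ofReal (Real.exp (2 * q.1)) * F (logCoord q) := by
  rw [← logCoord_range, ← image_univ, lintegral_image_eq_lintegral_abs_det_fderiv_mul volume
    MeasurableSet.univ (fun q _ => (hasFDerivAt_logCoord q).hasFDerivWithinAt)
    logCoord_injective.injOn]
  simp only [logCoord_det, Measure.restrict_univ]

lemma integral_logCoord (F : ℝ × ℝ → ℂ) :
    ∫ p in Ioi (0 : ℝ) ×ˢ Ioi (0 : ℝ), F p =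
      ∫ q : ℝ × ℝ, Real.exp (2 * q.1) • F (logCoord q) := by
  rw [← logCoord_range, ← image_univ, integral_image_eq_integral_abs_det_fderiv_smul volume
    MeasurableSet.univ (fun q _ => (hasFDerivAt_logCoord q).hasFDerivWithinAt)
    logCoord_injective.injOn]
  simp only [logCoord_det, Measure.restrict_univ]

lemma lintegral_exp_comp (F : ℝ → ENNReal) :
    ∫⁻ x in Ioi (0 : ℝ), F x = ∫⁻ s, ENNReal.ofReal (Real.exp s) * F (Real.exp s) := by
  rw [← Real.range_exp, ← image_univ, lintegral_image_eq_lintegral_abs_deriv_mul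
    MeasurableSet.univ (fun s _ => (Real.hasDerivAt_exp s).hasDerivWithinAt)
    Real.exp_injective.injOn]
  simp only [Real.abs_exp, Measure.restrict_univ]

end planar

/-! ### Hilbert's inequality on half of the quadrant -/

/-- The function `1 / (2 cosh (r/2))`. -/
noncomputable def sechHalf (r : ℝ) : ℝ := 1 / (2 * Real.cosh (r / 2))

lemma sechHalf_pos (r : ℝ) : 0 < sechHalf r := by
  have := Real.cosh_pos (r / 2)
  unfold sechHalf; positivity

lemma sechHalf_eq (r : ℝ) : sechHalf r = Real.exp (r / 2) / (1 + Real.exp r) := by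
  rw [sechHalf, Real.cosh_eq, div_eq_div_iff (by positivity) (by positivity)]
  have h1 : Real.exp r = Real.exp (r / 2) * Real.exp (r / 2) := by rw [← Real.exp_add]; ring_nf
  have h2 : Real.exp (r / 2) * Real.exp (-(r / 2)) = 1 := by rw [← Real.exp_add]; simp
  rw [h1]; linear_combination (-1) * h2

lemma continuous_sechHalf : Continuous sechHalf := by
  unfold sechHalf
  exact continuous_const.div (by fun_prop) fun r => by
    have := Real.cosh_pos (r / 2); positivity

lemma hasDerivAt_arctan_exp (r : ℝ) :
    HasDerivAt (fun r => 2 * Real.arctan (Real.exp (r / 2))) (sechHalf r) r := by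
  have h := (((hasDerivAt_id r).div_const 2).exp.arctan).const_mul 2
  refine h.congr_deriv ?_
  rw [sechHalf_eq]
  have h1 : Real.exp r = Real.exp (r / 2) ^ 2 := by rw [← Real.exp_nat_mul]; ring_nf
  rw [h1]
  simp only [id]
  ring

lemma tendsto_arctan_exp :
    Tendsto (fun r => 2 * Real.arctan (Real.exp (r / 2))) atTop (𝓝 Real.pi) := by
  have h1 : Tendsto (fun r : ℝ => Real.exp (r / 2)) atTop atTop :=
    Real.tendsto_exp_atTop.comp (tendsto_id.atTop_div_const two_pos)
  have h2 := (Real.tendsto_arctan_atTop.mono_right nhdsWithin_le_nhds).comp h1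
  have := h2.const_mul 2
  rwa [mul_div_cancel₀ _ (two_ne_zero)] at this

lemma integrableOn_sechHalf : IntegrableOn sechHalf (Ioi 0) :=
  integrableOn_Ioi_deriv_of_nonneg' (fun r _ => hasDerivAt_arctan_exp r)
    (fun r _ => (sechHalf_pos r).le) tendsto_arctan_exp

lemma integral_sechHalf : ∫ r in Ioi (0 : ℝ), sechHalf r = Real.pi / 2 := by
  rw [integral_Ioi_of_hasDerivAt_of_tendsto' (fun r _ => hasDerivAt_arctan_exp r)
    integrableOn_sechHalf tendsto_arctan_exp]
  simp only [zero_div, Real.exp_zero, Real.arctan_one]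
  ring

lemma lintegral_sechHalf :
    ∫⁻ r in Ici (0 : ℝ), ENNReal.ofReal (sechHalf r) = ENNReal.ofReal (Real.pi / 2) := by
  rw [setLIntegral_congr Ioi_ae_eq_Ici.symm, ← integral_sechHalf,
    ofReal_integral_eq_lintegral_ofReal integrableOn_sechHalf
    (Eventually.of_forall fun r => (sechHalf_pos r).le)]

/-- Hilbert's inequality on the half quadrant `0 < b ≤ a`. -/
lemma lintegral_hilbert_le {f g : ℝ → ENNReal} (hf : Measurable f) (hg : Measurable g) :
    ∫⁻ p, {p : ℝ × ℝ | 0 < p.2 ∧ p.2 ≤ p.1}.indicator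
      (fun p => f p.1 * g p.2 * ENNReal.ofReal (1 / (p.1 + p.2))) p ≤
    ENNReal.ofReal (Real.pi / 2) * ((∫⁻ x in Ioi (0 : ℝ), f x ^ 2) ^ (1 / 2 : ℝ) *
      (∫⁻ x in Ioi (0 : ℝ), g x ^ 2) ^ (1 / 2 : ℝ)) := by
  set S : Set (ℝ × ℝ) := {p : ℝ × ℝ | 0 < p.2 ∧ p.2 ≤ p.1}
  -- The factor exp(s/2) makes x = exp s an isometry from L² of the half line to L² of the line.
  let F : ℝ → ENNReal := fun s => f (Real.exp s) * ENNReal.ofReal (Real.exp (s / 2))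
  let G : ℝ → ENNReal := fun s => g (Real.exp s) * ENNReal.ofReal (Real.exp (s / 2))
  have hFm : Measurable F := by fun_prop
  have hGm : Measurable G := by fun_prop
  have hnorm : ∀ φ : ℝ → ENNReal, ∫⁻ s, (φ (Real.exp s) * ENNReal.ofReal (Real.exp (s / 2))) ^ 2 =
      ∫⁻ x in Ioi (0 : ℝ), φ x ^ 2 := by
    intro φ
    rw [lintegral_exp_comp]
    congr 1 with s
    rw [mul_pow, ← ENNReal.ofReal_pow (Real.exp_pos _).le, ← Real.exp_nat_mul, mul_comm]
    congr 3; push_cast; ring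
  have h1 : ∫⁻ p, S.indicator (fun p => f p.1 * g p.2 * ENNReal.ofReal (1 / (p.1 + p.2))) p =
      ∫⁻ p in Ioi (0 : ℝ) ×ˢ Ioi (0 : ℝ),
        S.indicator (fun p => f p.1 * g p.2 * ENNReal.ofReal (1 / (p.1 + p.2))) p := by
    rw [← lintegral_indicator (measurableSet_Ioi.prod measurableSet_Ioi)]
    congr 1 with p
    by_cases hp : p ∈ S
    · have : p ∈ Ioi (0 : ℝ) ×ˢ Ioi (0 : ℝ) := ⟨lt_of_lt_of_le hp.1 hp.2, hp.1⟩
      rw [indicator_of_mem this]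
    · rw [indicator_of_notMem hp, indicator_apply, indicator_of_notMem hp, ite_self]
  -- In logarithmic coordinates the kernel 1/(a + b) depends only on the ratio exp r, and b ≤ a
  -- becomes r ≥ 0. What is left is a correlation of F and G weighted by `sechHalf`, whose mass on
  -- the half line is π/2.
  have h2 : ∀ q : ℝ × ℝ, ENNReal.ofReal (Real.exp (2 * q.1)) *
      S.indicator (fun p => f p.1 * g p.2 * ENNReal.ofReal (1 / (p.1 + p.2))) (logCoord q) =
      (Ici (0 : ℝ)).indicator (fun r => ENNReal.ofReal (sechHalf r)) q.2 *
        (F (q.1 + q.2 / 2) * G (q.1 - q.2 / 2)) := by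
    rintro ⟨s, r⟩
    have hmem : logCoord (s, r) ∈ S ↔ r ∈ Ici (0 : ℝ) := by
      simp only [S, logCoord, mem_ofPred_eq, Real.exp_pos, true_and, Real.exp_le_exp, mem_Ici]
      constructor <;> intro h <;> linarith
    by_cases hr : r ∈ Ici (0 : ℝ)
    · rw [indicator_of_mem (hmem.2 hr), indicator_of_mem hr]
      simp only [logCoord, F, G]
      rw [show ∀ a b c d : ENNReal, a * (b * c * d) = (a * d) * (b * c) by intros; ring,
        show ∀ a b c d e : ENNReal, a * (b * d * (c * e)) = (a * d * e) * (b * c) by intros; ring,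
        ← ENNReal.ofReal_mul (by positivity), ← ENNReal.ofReal_mul (sechHalf_pos r).le,
        ← ENNReal.ofReal_mul (by have := sechHalf_pos r; positivity)]
      congr 2
      rw [sechHalf, Real.cosh_eq]
      have e1 : Real.exp (s + r / 2) = Real.exp s * Real.exp (r / 2) := Real.exp_add _ _
      have e2 : Real.exp (s - r / 2) = Real.exp s * Real.exp (-(r / 2)) := by
        rw [← Real.exp_add]; ring_nf
      have e3 : Real.exp ((s + r / 2) / 2) * Real.exp ((s - r / 2) / 2) = Real.exp s := by
        rw [← Real.exp_add]; ring_nf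
      have e4 : Real.exp (2 * s) = Real.exp s * Real.exp s := by rw [← Real.exp_add]; ring_nf
      rw [mul_assoc (1 / _), e3, e1, e2, e4]
      field_simp
    · rw [indicator_of_notMem (fun h => hr (hmem.1 h)), indicator_of_notMem hr]
      simp
  rw [h1, lintegral_logCoord]
  simp only [h2]
  rw [Measure.volume_eq_prod, lintegral_prod_symm]
  · have h3 : ∀ r : ℝ, ∫⁻ s, (Ici (0 : ℝ)).indicator (fun r => ENNReal.ofReal (sechHalf r)) r *
        (F (s + r / 2) * G (s - r / 2)) ≤
        (Ici (0 : ℝ)).indicator (fun r => ENNReal.ofReal (sechHalf r)) r *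
        ((∫⁻ x in Ioi (0 : ℝ), f x ^ 2) ^ (1 / 2 : ℝ) *
        (∫⁻ x in Ioi (0 : ℝ), g x ^ 2) ^ (1 / 2 : ℝ)) := by
      intro r
      rw [lintegral_const_mul _ (by fun_prop)]
      gcongr
      have := ENNReal.lintegral_mul_le_Lp_mul_Lq volume (p := 2) (q := 2)
        (by constructor <;> norm_num)
        (f := fun s => F (s + r / 2)) (g := fun s => G (s - r / 2))
        (by fun_prop) (by fun_prop)
      simp only [ENNReal.rpow_ofNat] at this
      rw [lintegral_add_right_eq_self (fun s => F s ^ 2),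
        lintegral_sub_right_eq_self (fun s => G s ^ 2), hnorm, hnorm] at this
      exact this
    refine (lintegral_mono h3).trans ?_
    rw [lintegral_mul_const _ ((continuous_sechHalf.measurable.ennreal_ofReal).indicator
      measurableSet_Ici), lintegral_indicator measurableSet_Ici, lintegral_sechHalf]
  · refine Measurable.aemeasurable (Measurable.mul ?_ (by fun_prop))
    exact ((continuous_sechHalf.measurable.ennreal_ofReal).indicator measurableSet_Ici).comp
      measurable_snd

/-! ### The cutting lemma: off-diagonal terms -/

lemma integrable_div_of_vanishes (g : 𝓢(ℝ, ℂ)) {δ : ℝ} (hδ : 0 < δ)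
    (h : ∀ z : ℝ, |z| ≤ δ → g z = 0) :
    Integrable (fun z : ℝ => g z / z) ∧ ∀ z : ℝ, g z = z * (g z / z) := by
  constructor
  · refine (g.integrable.norm.div_const δ).mono' ?_ (Eventually.of_forall fun z => ?_)
    · exact (g.continuous.measurable.div Complex.continuous_ofReal.measurable).aestronglyMeasurable
    · rw [norm_div, Complex.norm_real, Real.norm_eq_abs]
      by_cases hz : |z| ≤ δ
      · simp [h z hz]
      · push Not at hz
        gcongr
  · intro z
    by_cases hz : z = 0
    · rw [hz, h 0 (by simpa using hδ.le)]; simp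
    · rw [mul_div_cancel₀ _ (by exact_mod_cast hz)]

lemma norm_setIntegral_fourier_le_of_vanishes (g : 𝓢(ℝ, ℂ)) {δ : ℝ} (hδ : 0 < δ)
    (h : ∀ z : ℝ, |z| ≤ δ → g z = 0) {I : Set ℝ} (hI : I.OrdConnected) :
    ‖∫ ξ in I, 𝓕 g ξ‖ ≤ 1 / Real.pi * ∫ z : ℝ, ‖g z / z‖ := by
  obtain ⟨h1, h2⟩ := integrable_div_of_vanishes g hδ h
  exact norm_setIntegral_fourier_le h1 g.integrable h2 (𝓕 g : 𝓢(ℝ, ℂ)).integrable hI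

/-- The section of a subset of the plane by a vertical line. -/
def vsection (E : Set (ℝ × ℝ)) (x : ℝ) : Set ℝ := {ξ | (x, ξ) ∈ E}

lemma wignerForm_eq_iterated {E : Set (ℝ × ℝ)} (hE : MeasurableSet E) (u v : 𝓢(ℝ, ℂ)) :
    wignerForm E u v = ∫ x, ∫ ξ in vsection E x, wigner u v (x, ξ) := by
  rw [wignerForm, ← integral_indicator hE, Measure.volume_eq_prod, integral_prod]
  · congr 1 with x
    exact integral_indicator (measurable_prodMk_left hE)
  · exact (wigner_integrable u v).indicator hE

lemma vsection_inter_nonneg (E : Set (ℝ × ℝ)) (x : ℝ) :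
    vsection (E ∩ {p | 0 ≤ p.1}) x = if 0 ≤ x then vsection E x else ∅ := by
  ext ξ
  by_cases hx : 0 ≤ x <;> simp [vsection, hx]

lemma measurableSet_nonneg_fst : MeasurableSet {p : ℝ × ℝ | 0 ≤ p.1} :=
  (isClosed_le continuous_const continuous_fst).measurableSet

lemma lintegral_sq_le_nrm (u : 𝓢(ℝ, ℂ)) :
    (∫⁻ x in Ioi (0 : ℝ), ‖u x‖ₑ ^ 2) ^ (1 / 2 : ℝ) ≤ ENNReal.ofReal (nrm u) := by
  have h : ∫⁻ x, ‖u x‖ₑ ^ 2 = ENNReal.ofReal (nrm u ^ 2) := by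
    rw [nrm_sq, ofReal_integral_eq_lintegral_ofReal
      ((u.memLp 2 volume).integrable_norm_pow (by norm_num))
      (Eventually.of_forall fun x => by positivity)]
    congr 1 with x
    rw [ENNReal.ofReal_pow (norm_nonneg _), ofReal_norm]
  calc _ ≤ (ENNReal.ofReal (nrm u ^ 2)) ^ (1 / 2 : ℝ) := by
        rw [← h]
        gcongr
        exact Measure.restrict_le_self
    _ = ENNReal.ofReal (nrm u) := by
        rw [ENNReal.ofReal_pow (nrm_nonneg u), ← ENNReal.rpow_natCast, ← ENNReal.rpow_mul]
        norm_num

/-- A nonzero slice forces x + z/2 and -(x - z/2) to exceed ε, so z stays away from 0 and dividing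
by z is harmless. -/
lemma slice_eq_zero_of_opposite {u v : 𝓢(ℝ, ℂ)} {ε : ℝ} (hu : ∀ y, y ≤ ε → u y = 0)
    (hv : ∀ y, -ε ≤ y → v y = 0) (x z : ℝ) (h : slice u v x z ≠ 0) :
    ε < x + z / 2 ∧ ε < -(x - z / 2) := by
  rw [slice_apply] at h
  constructor
  · by_contra hc
    exact h (by rw [hu _ (not_lt.1 hc)]; simp)
  · by_contra hc
    exact h (by rw [hv _ (by linarith)]; simp)

lemma slice_vanishes_of_opposite {u v : 𝓢(ℝ, ℂ)} {ε : ℝ} (hε : 0 < ε)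
    (hu : ∀ y, y ≤ ε → u y = 0) (hv : ∀ y, -ε ≤ y → v y = 0) (x z : ℝ) (hz : |z| ≤ ε) :
    slice u v x z = 0 := by
  by_contra h
  have := slice_eq_zero_of_opposite hu hv x z h
  have := (abs_le.1 hz).2
  linarith

/-- The off-diagonal terms of a symbol which is cut along the line `x = 0`. -/
lemma norm_wignerForm_cross_le {E : Set (ℝ × ℝ)} (hE : MeasurableSet E)
    (hconn : ∀ x, (vsection E x).OrdConnected) {u v : 𝓢(ℝ, ℂ)} {ε : ℝ} (hε : 0 < ε)
    (hu : ∀ y, y ≤ ε → u y = 0) (hv : ∀ y, -ε ≤ y → v y = 0) :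
    ‖wignerForm (E ∩ {p | 0 ≤ p.1}) u v‖ ≤ 1 / 2 * (nrm u * nrm v) := by
  set S : Set (ℝ × ℝ) := {p : ℝ × ℝ | 0 < p.2 ∧ p.2 ≤ p.1}
  have hSm : MeasurableSet S :=
    (isOpen_lt continuous_const continuous_snd).measurableSet.inter
      (isClosed_le continuous_snd continuous_fst).measurableSet
  -- Reflecting v brings both functions to the positive half line, as Hilbert's inequality requires.
  let v' : 𝓢(ℝ, ℂ) := affineComp v 0 (-1) (by norm_num)
  have hv' : ∀ y, v' y = v (-y) := fun y => by simp [v']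
  have hnv : nrm v' = nrm v := by
    simp only [nrm_eq_sqrt, hv']
    rw [integral_neg_eq_self (fun y => ‖v y‖ ^ 2)]
  let F : ℝ × ℝ → ENNReal := S.indicator
    (fun p => ‖u p.1‖ₑ * ‖v' p.2‖ₑ * ENNReal.ofReal (1 / (p.1 + p.2)))
  have hFm : Measurable F := by
    refine Measurable.indicator ?_ hSm
    have hu := u.continuous.enorm.measurable
    have hv := v'.continuous.enorm.measurable
    exact ((hu.comp measurable_fst).mul (hv.comp measurable_snd)).mul (by fun_prop)
  -- With a = x + z/2 and b = z/2 - x one has z = a + b, and x ≥ 0 says b ≤ a. The determinant of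
  -- this change of variables is 1.
  have hpt : ∀ x z : ℝ, 0 ≤ x → ‖slice u v x z / z‖ₑ ≤ F (planeMap 1 (1 / 2) (-1) (1 / 2) (x, z)) := by
    intro x z hx
    by_cases h : slice u v x z = 0
    · simp [h]
    obtain ⟨h1, h2⟩ := slice_eq_zero_of_opposite hu hv x z h
    have hmem : planeMap 1 (1 / 2) (-1) (1 / 2) (x, z) ∈ S := by
      simp only [S, planeMap_apply, mem_ofPred_eq]
      constructor <;> linarith
    have hz : 0 < z := by linarith
    simp only [F]
    rw [indicator_of_mem hmem]
    simp only [planeMap_apply, hv', slice_apply]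
    rw [← ofReal_norm, norm_div, norm_mul, RCLike.norm_conj, Complex.norm_real,
      Real.norm_of_nonneg hz.le, div_eq_mul_one_div, ENNReal.ofReal_mul (by positivity),
      ENNReal.ofReal_mul (by positivity), ofReal_norm, ofReal_norm]
    apply le_of_eq
    congr <;> ring
  have hx : ∀ x, ‖∫ ξ in vsection (E ∩ {p | 0 ≤ p.1}) x, wigner u v (x, ξ)‖ₑ ≤
      ENNReal.ofReal (1 / Real.pi) * ∫⁻ z, F (planeMap 1 (1 / 2) (-1) (1 / 2) (x, z)) := by
    intro x
    rw [vsection_inter_nonneg]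
    split_ifs with h0
    · have hvan := fun z => slice_vanishes_of_opposite hε hu hv x z
      have h1 := norm_setIntegral_fourier_le_of_vanishes (slice u v x) hε hvan (hconn x)
      simp only [wigner_eq_fourier]
      rw [← ofReal_norm]
      refine (ENNReal.ofReal_le_ofReal h1).trans ?_
      rw [ENNReal.ofReal_mul (by have := Real.pi_pos; positivity),
        ofReal_integral_norm_eq_lintegral_enorm (integrable_div_of_vanishes _ hε hvan).1]
      gcongr with z
      exact hpt x z h0
    · simp
  have hmp : |(1 : ℝ) * (1 / 2) - 1 / 2 * -1| = 1 := by norm_num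
  have hmain : ‖wignerForm (E ∩ {p | 0 ≤ p.1}) u v‖ₑ ≤ ENNReal.ofReal (1 / 2 * (nrm u * nrm v)) := by
    rw [wignerForm_eq_iterated (hE.inter measurableSet_nonneg_fst)]
    refine (enorm_integral_le_lintegral_enorm _).trans ((lintegral_mono hx).trans ?_)
    have hcm : Measurable fun p => F (planeMap 1 (1 / 2) (-1) (1 / 2) p) :=
      hFm.comp (planeMap _ _ _ _).continuous.measurable
    rw [lintegral_const_mul _ hcm.lintegral_prod_right',
      ← lintegral_prod (fun p => F (planeMap 1 (1 / 2) (-1) (1 / 2) p)) hcm.aemeasurable,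
      ← Measure.volume_eq_prod, (measurePreserving_planeMap hmp).lintegral_comp hFm]
    have := lintegral_hilbert_le (f := fun x => ‖u x‖ₑ) (g := fun x => ‖v' x‖ₑ)
      (u.continuous.enorm.measurable) (v'.continuous.enorm.measurable)
    refine (mul_le_mul_right this _).trans ?_
    have hpi := Real.pi_pos
    -- The constant of the interval estimate times that of the half Hilbert inequality is (1/π)(π/2)
    -- = 1/2.
    calc _ ≤ ENNReal.ofReal (1 / Real.pi) * (ENNReal.ofReal (Real.pi / 2) *
          (ENNReal.ofReal (nrm u) * ENNReal.ofReal (nrm v'))) := by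
          gcongr
          · exact lintegral_sq_le_nrm u
          · exact lintegral_sq_le_nrm v'
      _ = _ := by
          rw [hnv, ← ENNReal.ofReal_mul (nrm_nonneg u), ← ENNReal.ofReal_mul (by positivity),
            ← ENNReal.ofReal_mul (by positivity)]
          congr 1
          field_simp
  rw [← ofReal_norm] at hmain
  have hnn : 0 ≤ 1 / 2 * (nrm u * nrm v) := by
    have := nrm_nonneg u
    have := nrm_nonneg v
    positivity
  exact (ENNReal.ofReal_le_ofReal_iff hnn).1 hmain

/-! ### The cutting lemma: the 2 × 2 block estimate -/

/-- The largest eigenvalue of the matrix `!![M, 1/2; 1/2, 0]`. -/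
noncomputable def cutBound (M : ℝ) : ℝ := (M + Real.sqrt (1 + M ^ 2)) / 2

lemma cutBound_sq (M : ℝ) : cutBound M ^ 2 = M * cutBound M + 1 / 4 := by
  have := Real.sq_sqrt (show 0 ≤ 1 + M ^ 2 by positivity)
  unfold cutBound
  linear_combination (1 / 4) * this

lemma cutBound_pos {M : ℝ} (hM : 0 ≤ M) : 0 < cutBound M := by
  have : 0 < Real.sqrt (1 + M ^ 2) := by positivity
  unfold cutBound; positivity

/-- Cauchy–Schwarz after bounding the image of (a, b) under the matrix with rows (M, 1/2), (1/2, 0)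
by l times its norm. -/
lemma bilinear_le_cutBound {M a b c d s t : ℝ} (hM : 0 ≤ M)
    (hs : 0 ≤ s) (ht : 0 ≤ t) (hab : s ^ 2 = a ^ 2 + b ^ 2) (hcd : t ^ 2 = c ^ 2 + d ^ 2) :
    M * a * c + 1 / 2 * (a * d) + 1 / 2 * (b * c) ≤ cutBound M * s * t := by
  have hl := cutBound_pos hM
  have hl2 := cutBound_sq M
  set l := cutBound M
  have h1 : (M * a + b / 2) ^ 2 + (a / 2) ^ 2 ≤ l ^ 2 * s ^ 2 := by
    -- The eigenvalue equation l² = Ml + 1/4 makes l times the defect a square: l² I - A² has rank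
    -- one.
    have key : l * (l ^ 2 * s ^ 2 - ((M * a + b / 2) ^ 2 + (a / 2) ^ 2)) =
        M * (a / 2 - l * b) ^ 2 := by
      rw [hab]
      linear_combination (a ^ 2 * l + a ^ 2 * M + l * b ^ 2) * hl2
    by_contra hc
    have : l * (l ^ 2 * s ^ 2 - ((M * a + b / 2) ^ 2 + (a / 2) ^ 2)) < 0 :=
      mul_neg_of_pos_of_neg hl (by linarith)
    have : 0 ≤ M * (a / 2 - l * b) ^ 2 := by positivity
    linarith
  have h2 : (M * a * c + 1 / 2 * (a * d) + 1 / 2 * (b * c)) ^ 2 ≤ (l * s * t) ^ 2 := by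
    calc _ = ((M * a + b / 2) * c + a / 2 * d) ^ 2 := by ring
      _ ≤ ((M * a + b / 2) ^ 2 + (a / 2) ^ 2) * (c ^ 2 + d ^ 2) := by
        nlinarith [sq_nonneg ((M * a + b / 2) * d - a / 2 * c)]
      _ ≤ l ^ 2 * s ^ 2 * t ^ 2 := by rw [hcd]; gcongr
      _ = _ := by ring
  exact abs_le_of_sq_le_sq' h2 (by positivity) |>.2

/-- For x ≥ 0 at least one of x + z/2 and x - z/2 is nonnegative. -/
lemma wigner_eq_zero_of_negative {u v : 𝓢(ℝ, ℂ)} (hu : ∀ y, 0 ≤ y → u y = 0)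
    (hv : ∀ y, 0 ≤ y → v y = 0) (x ξ : ℝ) (hx : 0 ≤ x) : wigner u v (x, ξ) = 0 := by
  unfold wigner
  rw [integral_eq_zero_of_ae]
  filter_upwards with z
  rcases le_total 0 z with hz | hz
  · simp [hu (x + z / 2) (by positivity)]
  · simp [hv (x - z / 2) (by linarith)]

lemma wigner_eq_zero_of_positive {u v : 𝓢(ℝ, ℂ)} (hu : ∀ y, y ≤ 0 → u y = 0)
    (hv : ∀ y, y ≤ 0 → v y = 0) (x ξ : ℝ) (hx : x ≤ 0) : wigner u v (x, ξ) = 0 := by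
  unfold wigner
  rw [integral_eq_zero_of_ae]
  filter_upwards with z
  rcases le_total 0 z with hz | hz
  · simp [hv (x - z / 2) (by linarith)]
  · simp [hu (x + z / 2) (by linarith)]

/-- On the positive half line the cut is invisible. -/
lemma wignerForm_cut_positive {E : Set (ℝ × ℝ)} (hE : MeasurableSet E) {u v : 𝓢(ℝ, ℂ)}
    (hu : ∀ y, y ≤ 0 → u y = 0) (hv : ∀ y, y ≤ 0 → v y = 0) :
    wignerForm (E ∩ {p | 0 ≤ p.1}) u v = wignerForm E u v := by
  rw [wignerForm, wignerForm, ← integral_indicator (hE.inter measurableSet_nonneg_fst),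
    ← integral_indicator hE]
  congr 1 with ⟨x, ξ⟩
  by_cases h : 0 ≤ x
  · by_cases h' : (x, ξ) ∈ E <;> simp [indicator, h, h']
  · simp [indicator, h, wigner_eq_zero_of_positive hu hv x ξ (by linarith)]

lemma wignerForm_cut_negative {E : Set (ℝ × ℝ)} {u v : 𝓢(ℝ, ℂ)}
    (hu : ∀ y, 0 ≤ y → u y = 0) (hv : ∀ y, 0 ≤ y → v y = 0) :
    wignerForm (E ∩ {p | 0 ≤ p.1}) u v = 0 := by
  rw [wignerForm, setIntegral_eq_zero_of_forall_eq_zero]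
  rintro ⟨x, ξ⟩ ⟨-, h⟩
  exact wigner_eq_zero_of_negative hu hv x ξ h

/-- Splitting both functions at the origin gives four blocks: M on (positive, positive), 0 on
(negative, negative), and 1/2 on the two mixed ones, which are related by conjugation. -/
lemma norm_wignerForm_cut_le_of_vanishes {E : Set (ℝ × ℝ)} (hE : MeasurableSet E)
    (hconn : ∀ x, (vsection E x).OrdConnected) {M : ℝ} (hM : 0 ≤ M) (hb : HasBound E M)
    {u v : 𝓢(ℝ, ℂ)} (hu : VanishesNearZero u) (hv : VanishesNearZero v) :
    ‖wignerForm (E ∩ {p | 0 ≤ p.1}) u v‖ ≤ cutBound M * nrm u * nrm v := by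
  obtain ⟨p, n, ε, hε, rfl, hp, hn, -, -⟩ := hu.decompose
  obtain ⟨p', n', ε', hε', rfl, hp', hn', -, -⟩ := hv.decompose
  have hpn : ∀ y, p y = 0 ∨ n y = 0 := fun y =>
    (le_total y 0).imp (fun h => hp y (by linarith)) (fun h => hn y (by linarith))
  have hpn' : ∀ y, p' y = 0 ∨ n' y = 0 := fun y =>
    (le_total y 0).imp (fun h => hp' y (by linarith)) (fun h => hn' y (by linarith))
  have hmin : 0 < min ε ε' := lt_min hε hε'
  have h1 : ‖wignerForm (E ∩ {p | 0 ≤ p.1}) p p'‖ ≤ M * nrm p * nrm p' := by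
    rw [wignerForm_cut_positive hE (fun y hy => hp y (by linarith))
      (fun y hy => hp' y (by linarith))]
    exact hb _ _
  have h2 : wignerForm (E ∩ {p | 0 ≤ p.1}) n n' = 0 :=
    wignerForm_cut_negative (fun y hy => hn y (by linarith)) (fun y hy => hn' y (by linarith))
  have h3 : ‖wignerForm (E ∩ {p | 0 ≤ p.1}) p n'‖ ≤ 1 / 2 * (nrm p * nrm n') :=
    norm_wignerForm_cross_le hE hconn hmin (fun y hy => hp y (hy.trans (min_le_left _ _)))
      (fun y hy => hn' y (by linarith [min_le_right ε ε']))
  have h4 : ‖wignerForm (E ∩ {p | 0 ≤ p.1}) n p'‖ ≤ 1 / 2 * (nrm n * nrm p') := by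
    rw [wignerForm_conj, RCLike.norm_conj, mul_comm (nrm n)]
    exact norm_wignerForm_cross_le hE hconn hmin (fun y hy => hp' y (hy.trans (min_le_right _ _)))
      (fun y hy => hn y (by linarith [min_le_left ε ε']))
  refine le_trans ?_ (bilinear_le_cutBound hM (nrm_nonneg _)
    (nrm_nonneg _) (nrm_sq_decompose rfl hpn) (nrm_sq_decompose rfl hpn'))
  rw [wignerForm_add_left, wignerForm_add_right, wignerForm_add_right, h2, add_zero]
  refine (norm_add_le _ _).trans (add_le_add ((norm_add_le _ _).trans (add_le_add h1 h3)) h4)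

/-! ### The cutting lemma: removing the condition at the origin -/

/-- The `L¹` norm of the Fourier transform of a product of Schwartz functions. -/
lemma integral_norm_fourier_mul_le (f g : 𝓢(ℝ, ℂ)) :
    ∫ ξ, ‖𝓕 (mulSchwartz f g) ξ‖ ≤ (∫ ξ, ‖𝓕 f ξ‖) * ∫ ξ, ‖𝓕 g ξ‖ := by
  have hinv : ∀ h : 𝓢(ℝ, ℂ), (𝓕 (𝓕⁻ h : 𝓢(ℝ, ℂ)) : 𝓢(ℝ, ℂ)) = h := fun h =>
    FourierTransform.fourier_fourierInv_eq h
  have hneg : ∀ (h : 𝓢(ℝ, ℂ)) (x : ℝ), (𝓕⁻ h : 𝓢(ℝ, ℂ)) x = 𝓕 h (-x) := fun h x => rfl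
  have hint : ∀ h : 𝓢(ℝ, ℂ), ∫ x, ‖(𝓕⁻ h : 𝓢(ℝ, ℂ)) x‖ = ∫ ξ, ‖𝓕 h ξ‖ := fun h => by
    simp only [hneg]
    exact integral_neg_eq_self (fun x => ‖𝓕 h x‖) volume
  have hc : (𝓕⁻ (mulSchwartz f g) : 𝓢(ℝ, ℂ)) =
      SchwartzMap.convolution (ContinuousLinearMap.mul ℂ ℂ) (𝓕⁻ f) (𝓕⁻ g) := by
    have h1 := SchwartzMap.fourier_convolution (ContinuousLinearMap.mul ℂ ℂ)
      (𝓕⁻ f : 𝓢(ℝ, ℂ)) (𝓕⁻ g : 𝓢(ℝ, ℂ))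
    rw [hinv, hinv] at h1
    have h2 : mulSchwartz f g = SchwartzMap.pairing (ContinuousLinearMap.mul ℂ ℂ) f g := rfl
    rw [h2, ← h1]
    exact FourierTransform.fourierInv_fourier_eq _
  rw [← hint, ← hint f, ← hint g, hc]
  set f' : 𝓢(ℝ, ℂ) := 𝓕⁻ f
  set g' : 𝓢(ℝ, ℂ) := 𝓕⁻ g
  have hI := integral_convolution (μ := (volume : Measure ℝ)) (ν := (volume : Measure ℝ))
    (ContinuousLinearMap.mul ℝ ℝ) f'.integrable.norm g'.integrable.norm
  simp only [ContinuousLinearMap.mul_apply'] at hI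
  rw [← hI]
  refine integral_mono (SchwartzMap.integrable _).norm
    (Integrable.integrable_convolution (ContinuousLinearMap.mul ℝ ℝ) f'.integrable.norm
      g'.integrable.norm) fun x => ?_
  rw [SchwartzMap.convolution_apply]
  refine (norm_integral_le_integral_norm _).trans_eq ?_
  simp [MeasureTheory.convolution]

lemma fourier_affineComp (f : 𝓢(ℝ, ℂ)) (x c : ℝ) (hc : c ≠ 0) (ξ : ℝ) :
    𝓕 (affineComp f x c hc) ξ =
      Complex.exp (((2 * Real.pi * (x / c) * ξ : ℝ) : ℂ) * Complex.I) *
        (|c⁻¹| • 𝓕 f (ξ / c)) := by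
  symm
  rw [SchwartzMap.fourier_coe, SchwartzMap.fourier_coe,
    Real.fourier_real_eq_integral_exp_smul, Real.fourier_real_eq_integral_exp_smul,
    ← Measure.integral_comp_mul_left, ← integral_add_left_eq_self _ (x / c),
    ← integral_const_mul]
  congr 1 with z
  have hc' : (c : ℂ) ≠ 0 := Complex.ofReal_ne_zero.2 hc
  rw [affineComp_apply, smul_eq_mul, smul_eq_mul, ← mul_assoc, ← Complex.exp_add, mul_add,
    mul_div_cancel₀ x hc]
  congr 2
  push_cast
  field_simp
  ring

/-- The `L¹` norm of the Fourier transform is invariant under affine changes of variable. -/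
lemma integral_norm_fourier_affineComp (f : 𝓢(ℝ, ℂ)) (x c : ℝ) (hc : c ≠ 0) :
    ∫ ξ, ‖𝓕 (affineComp f x c hc) ξ‖ = ∫ ξ, ‖𝓕 f ξ‖ := by
  have h1 : ∀ ξ : ℝ, ‖𝓕 (affineComp f x c hc) ξ‖ = |c⁻¹| * ‖𝓕 f (ξ / c)‖ := by
    intro ξ
    rw [fourier_affineComp, norm_mul, Complex.norm_exp_ofReal_mul_I, one_mul, norm_smul,
      Real.norm_eq_abs, abs_abs]
  simp only [h1]
  rw [integral_const_mul, Measure.integral_comp_div (fun ξ => ‖𝓕 f ξ‖), smul_eq_mul, ← mul_assoc,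
    ← abs_mul, inv_mul_cancel₀ hc]
  simp

lemma exists_bump : ∃ χ : 𝓢(ℝ, ℂ), (∀ y, |y| ≤ 1 → χ y = 1) ∧ (∀ y, 2 ≤ |y| → χ y = 0) ∧
    ∀ y, ‖1 - χ y‖ ≤ 1 ∧ ‖χ y‖ ≤ 1 := by
  let b : ContDiffBump (0 : ℝ) := ⟨1, 2, one_pos, one_lt_two⟩
  have h1 : HasCompactSupport (fun y : ℝ => ((b y : ℝ) : ℂ)) :=
    b.hasCompactSupport.comp_left (g := fun t : ℝ => (t : ℂ)) Complex.ofReal_zero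
  have h2 : ContDiff ℝ (⊤ : ℕ∞) (fun y : ℝ => ((b y : ℝ) : ℂ)) :=
    Complex.ofRealCLM.contDiff.comp b.contDiff
  refine ⟨h1.toSchwartzMap h2, fun y hy => ?_, fun y hy => ?_, fun y => ?_⟩
  · change ((b y : ℝ) : ℂ) = 1
    rw [b.one_of_mem_closedBall (by simpa [b] using hy)]; simp
  · change ((b y : ℝ) : ℂ) = 0
    rw [b.zero_of_le_dist (by simpa [b] using hy)]; simp
  · change ‖1 - ((b y : ℝ) : ℂ)‖ ≤ 1 ∧ ‖((b y : ℝ) : ℂ)‖ ≤ 1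
    rw [← Complex.ofReal_one, ← Complex.ofReal_sub, Complex.norm_real, Complex.norm_real,
      Real.norm_eq_abs, Real.norm_eq_abs, abs_le, abs_le]
    have := b.nonneg (x := y)
    have := b.le_one (x := y)
    refine ⟨⟨?_, ?_⟩, ?_, ?_⟩ <;> linarith

lemma nrm_le_of_norm_le {u v : 𝓢(ℝ, ℂ)} (h : ∀ y, ‖u y‖ ≤ ‖v y‖) : nrm u ≤ nrm v := by
  rw [nrm_eq_sqrt, nrm_eq_sqrt]
  refine Real.sqrt_le_sqrt (integral_mono ?_ ?_ fun y => ?_)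
  · exact (u.memLp 2 volume).integrable_norm_pow (by norm_num)
  · exact (v.memLp 2 volume).integrable_norm_pow (by norm_num)
  · exact pow_le_pow_left₀ (norm_nonneg _) (h y) 2

/-- The piece of `u` near the origin at scale `1/(n+1)`. -/
noncomputable def nearZero (χ u : 𝓢(ℝ, ℂ)) (n : ℕ) : 𝓢(ℝ, ℂ) :=
  mulSchwartz (affineComp χ 0 (n + 1) (by positivity)) u

lemma nearZero_apply (χ u : 𝓢(ℝ, ℂ)) (n : ℕ) (y : ℝ) :
    nearZero χ u n y = χ ((n + 1) * y) * u y := by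
  simp [nearZero]

/-- The cutoff multiplies the slice by an affine rescaling of χ, hence convolves W in ξ with a
function whose L¹ norm depends neither on n nor on x. This is the domination for the limit n → ∞. -/
lemma integral_norm_wigner_nearZero_le (χ u v : 𝓢(ℝ, ℂ)) (n : ℕ) (x : ℝ) :
    ∫ ξ, ‖wigner (nearZero χ u n) v (x, ξ)‖ ≤ (∫ ξ, ‖𝓕 χ ξ‖) * ∫ ξ, ‖wigner u v (x, ξ)‖ := by
  simp only [wigner_eq_fourier]
  have h : slice (nearZero χ u n) v x =
      mulSchwartz (affineComp (affineComp χ 0 (n + 1) (by positivity)) x (1 / 2) (by norm_num))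
        (slice u v x) := by
    ext z
    simp only [slice_apply, nearZero_apply, mulSchwartz_apply, affineComp_apply]
    ring_nf
  rw [h]
  refine (integral_norm_fourier_mul_le _ _).trans_eq ?_
  rw [integral_norm_fourier_affineComp, integral_norm_fourier_affineComp]

/-- For x > 0 the slice is supported near z = -2x in a window of width of order 1/n, away from z =
0, so the interval estimate is O(1/n). -/
lemma tendsto_section_nearZero {χ : 𝓢(ℝ, ℂ)} (hχ : ∀ y, 2 ≤ |y| → χ y = 0) (u v : 𝓢(ℝ, ℂ))
    {I : Set ℝ} (hI : I.OrdConnected) {x : ℝ} (hx : 0 < x) :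
    Tendsto (fun n => ∫ ξ in I, wigner (nearZero χ u n) v (x, ξ)) atTop (𝓝 0) := by
  let J : ℝ := ∫ z, ‖affineComp χ x (1 / 2) (by norm_num) z‖
  obtain ⟨B, hB⟩ : ∃ B, ∀ z, ‖slice u v x z‖ ≤ B :=
    ⟨_, fun z => SchwartzMap.norm_le_seminorm ℝ _ z⟩
  have hB0 : 0 ≤ B := (norm_nonneg _).trans (hB 0)
  have hlim : Tendsto (fun n : ℕ => 1 / Real.pi * (B / x * (2 * ∫ z, ‖χ z‖)) * (1 / ((n : ℝ) + 1)))
      atTop (𝓝 0) := by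
    simpa using tendsto_one_div_add_atTop_nhds_zero_nat.const_mul
      (1 / Real.pi * (B / x * (2 * ∫ z, ‖χ z‖)))
  refine squeeze_zero_norm' ?_ hlim
  -- For |z| ≤ x one has (n + 1)(x + z/2) ≥ (n + 1)x/2, and this must reach 2, beyond which χ
  -- vanishes.
  have hlarge : ∀ᶠ n : ℕ in atTop, 4 / x ≤ n := eventually_ge_atTop ⌈4 / x⌉₊ |>.mono
    fun n hn => (Nat.le_ceil _).trans (by exact_mod_cast hn)
  filter_upwards [hlarge] with n hn
  have hn1 : (0 : ℝ) < n + 1 := by positivity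
  have hnx : 4 ≤ (n + 1) * x := by
    have := (div_le_iff₀ hx).1 hn
    nlinarith
  have hval : ∀ z, slice (nearZero χ u n) v x z = χ ((n + 1) * (x + z / 2)) * slice u v x z := by
    intro z; rw [slice_apply, nearZero_apply, slice_apply]; ring
  have hvan : ∀ z : ℝ, |z| ≤ x → slice (nearZero χ u n) v x z = 0 := by
    intro z hz
    rw [hval, hχ, zero_mul]
    have : x / 2 ≤ x + z / 2 := by linarith [(abs_le.1 hz).1]
    rw [abs_of_nonneg (mul_nonneg hn1.le (by linarith))]
    nlinarith
  simp only [wigner_eq_fourier]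
  refine (norm_setIntegral_fourier_le_of_vanishes _ hx hvan hI).trans ?_
  have hχint : Integrable (fun z : ℝ => ‖χ ((n + 1) * (x + z / 2))‖) := by
    have := SchwartzMap.integrable (μ := (volume : Measure ℝ))
      (affineComp χ ((n + 1) * x) ((n + 1) / 2) (by positivity)) |>.norm
    refine this.congr (Eventually.of_forall fun z => ?_)
    simp only [affineComp_apply]; ring_nf
  have hχval : ∫ z : ℝ, ‖χ ((n + 1) * (x + z / 2))‖ = (2 * ∫ z, ‖χ z‖) * (1 / ((n : ℝ) + 1)) := by
    rw [Measure.integral_comp_div (fun z : ℝ => ‖χ ((n + 1) * (x + z))‖),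
      integral_add_left_eq_self (fun z : ℝ => ‖χ ((n + 1) * z)‖),
      Measure.integral_comp_mul_left (fun z => ‖χ z‖), smul_eq_mul, smul_eq_mul,
      abs_of_pos (inv_pos.2 hn1), abs_of_pos two_pos]
    ring
  rw [mul_assoc]
  have hpi := Real.pi_pos
  gcongr
  rw [mul_assoc, ← hχval, ← integral_const_mul]
  refine integral_mono_of_nonneg (Eventually.of_forall fun z => norm_nonneg _)
    (hχint.const_mul _) (Eventually.of_forall fun z => ?_)
  simp only [norm_div, Complex.norm_real, Real.norm_eq_abs]
  by_cases hz : |z| ≤ x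
  · rw [hvan z hz]
    simp only [norm_zero, zero_div]
    positivity
  · push Not at hz
    rw [hval, norm_mul]
    calc ‖χ ((n + 1) * (x + z / 2))‖ * ‖slice u v x z‖ / |z|
        ≤ ‖χ ((n + 1) * (x + z / 2))‖ * B / x := by
          gcongr
          exact hB z
      _ = _ := by ring

/-- The form is not yet known to be continuous for the L² norm, so density alone cannot discard the
part near the origin. Dominated convergence over x does it, the line x = 0 being negligible. -/
lemma tendsto_wignerForm_nearZero {E : Set (ℝ × ℝ)} (hE : MeasurableSet E)
    (hconn : ∀ x, (vsection E x).OrdConnected) {χ : 𝓢(ℝ, ℂ)} (hχ : ∀ y, 2 ≤ |y| → χ y = 0)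
    (u v : 𝓢(ℝ, ℂ)) :
    Tendsto (fun n => wignerForm (E ∩ {p | 0 ≤ p.1}) (nearZero χ u n) v) atTop (𝓝 0) := by
  simp only [wignerForm_eq_iterated (hE.inter measurableSet_nonneg_fst)]
  have hint : Integrable (fun x => ∫ ξ, ‖wigner u v (x, ξ)‖) :=
    (wigner_integrable u v).integral_norm_prod_left
  have := tendsto_integral_of_dominated_convergence
    (F := fun n x => ∫ ξ in vsection (E ∩ {p | 0 ≤ p.1}) x, wigner (nearZero χ u n) v (x, ξ))
    (f := fun _ => (0 : ℂ)) (fun x => (∫ ξ, ‖𝓕 χ ξ‖) * ∫ ξ, ‖wigner u v (x, ξ)‖) ?_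
    (hint.const_mul _) ?_ ?_ (μ := volume)
  · simpa using this
  · intro n
    have h1 : Integrable ((E ∩ {p | 0 ≤ p.1}).indicator (wigner (nearZero χ u n) v))
        ((volume : Measure ℝ).prod volume) :=
      (wigner_integrable _ v).indicator (hE.inter measurableSet_nonneg_fst)
    refine h1.integral_prod_left.aestronglyMeasurable.congr (Eventually.of_forall fun x => ?_)
    exact integral_indicator (measurable_prodMk_left (hE.inter measurableSet_nonneg_fst))
  · intro n
    filter_upwards with x
    refine (norm_integral_le_integral_norm _).trans ((setIntegral_le_integral
      (wigner_integrable_snd _ v x).norm (Eventually.of_forall fun ξ => norm_nonneg _)).trans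
      (integral_norm_wigner_nearZero_le χ u v n x))
  · have h0 : ∀ᵐ x : ℝ, x ≠ 0 := by simp [ae_iff]
    filter_upwards [h0] with x hx
    simp only [vsection_inter_nonneg]
    split_ifs with h
    · exact tendsto_section_nearZero hχ u v (hconn x) (lt_of_le_of_ne h hx.symm)
    · simp

/-- A form which is bounded on the Schwartz functions vanishing near the origin is bounded, for a
symbol cut along the line `x = 0`. -/
lemma hasBound_of_vanishes {E : Set (ℝ × ℝ)} (hE : MeasurableSet E)
    (hconn : ∀ x, (vsection E x).OrdConnected) {r : ℝ} (hr : 0 ≤ r)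
    (h : ∀ u v : 𝓢(ℝ, ℂ), VanishesNearZero u → VanishesNearZero v →
      ‖wignerForm (E ∩ {p | 0 ≤ p.1}) u v‖ ≤ r * nrm u * nrm v) :
    HasBound (E ∩ {p | 0 ≤ p.1}) r := by
  obtain ⟨χ, h1, h2, h3⟩ := exists_bump
  have hfar : ∀ (u : 𝓢(ℝ, ℂ)) (n : ℕ), VanishesNearZero (u - nearZero χ u n) := by
    intro u n
    refine ⟨1 / (n + 1), by positivity, fun y hy => ?_⟩
    rw [sub_apply, nearZero_apply, h1, one_mul, sub_self]
    rw [abs_mul, abs_of_pos (by positivity : (0 : ℝ) < n + 1)]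
    rwa [le_div_iff₀' (by positivity)] at hy
  have hle : ∀ (u : 𝓢(ℝ, ℂ)) (n : ℕ), nrm (u - nearZero χ u n) ≤ nrm u := by
    intro u n
    refine nrm_le_of_norm_le fun y => ?_
    rw [sub_apply, nearZero_apply, ← one_sub_mul, norm_mul]
    exact mul_le_of_le_one_left (norm_nonneg _) (h3 _).1
  have hsub : ∀ (u v : 𝓢(ℝ, ℂ)) (n : ℕ),
      wignerForm (E ∩ {p | 0 ≤ p.1}) (u - nearZero χ u n) v =
      wignerForm (E ∩ {p | 0 ≤ p.1}) u v - wignerForm (E ∩ {p | 0 ≤ p.1}) (nearZero χ u n) v := by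
    intro u v n
    rw [eq_sub_iff_add_eq, ← wignerForm_add_left, sub_add_cancel]
  -- One argument is freed at a time: subtracting the part near the origin does not increase the
  -- norm, and conjugate symmetry then exchanges the roles of u and v.
  have key : ∀ (Q : 𝓢(ℝ, ℂ) → Prop), (∀ v u, Q v → VanishesNearZero u →
      ‖wignerForm (E ∩ {p | 0 ≤ p.1}) u v‖ ≤ r * nrm u * nrm v) →
      ∀ v u, Q v → ‖wignerForm (E ∩ {p | 0 ≤ p.1}) u v‖ ≤ r * nrm u * nrm v := by
    intro Q hQ v u hv
    have hlim : Tendsto (fun n => wignerForm (E ∩ {p | 0 ≤ p.1}) (u - nearZero χ u n) v) atTop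
        (𝓝 (wignerForm (E ∩ {p | 0 ≤ p.1}) u v)) := by
      simp only [hsub]
      simpa using (tendsto_wignerForm_nearZero hE hconn h2 u v).const_sub
        (wignerForm (E ∩ {p | 0 ≤ p.1}) u v)
    refine le_of_tendsto hlim.norm (Eventually.of_forall fun n => ?_)
    refine (hQ v _ hv (hfar u n)).trans ?_
    have := hle u n
    have := nrm_nonneg v
    gcongr
  have step1 := key VanishesNearZero fun v u hv hu => h u v hu hv
  intro u v
  refine key (fun _ => True) (fun v u _ hu => ?_) v u trivial
  rw [wignerForm_conj, RCLike.norm_conj]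
  exact (step1 u v hu).trans_eq (by ring)

/-- **Cutting lemma**: cutting a symbol along a line changes the bound `M` at most into the largest
eigenvalue of `!![M, 1/2; 1/2, 0]`. -/
theorem HasBound.cut {E : Set (ℝ × ℝ)} (hE : MeasurableSet E)
    (hconn : ∀ x, (vsection E x).OrdConnected) {M : ℝ} (hM : 0 ≤ M) (hb : HasBound E M) :
    HasBound (E ∩ {p | 0 ≤ p.1}) (cutBound M) :=
  hasBound_of_vanishes hE hconn (cutBound_pos hM).le
    fun _ _ hu hv => norm_wignerForm_cut_le_of_vanishes hE hconn hM hb hu hv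

/-! ### Mellin coordinates -/

/-- Parseval's formula for the correlation of two Schwartz functions. -/
lemma integral_correlation (Φ Ψ : 𝓢(ℝ, ℂ)) (r : ℝ) :
    ∫ s, Φ (s + r / 2) * conj (Ψ (s - r / 2)) =
      ∫ τ, Complex.exp (((2 * Real.pi * τ * r : ℝ) : ℂ) * Complex.I) * (𝓕 Φ τ * conj (𝓕 Ψ τ)) := by
  have h := SchwartzMap.integral_inner_fourier_fourier
    (affineComp Ψ (-(r / 2)) 1 one_ne_zero) (affineComp Φ (r / 2) 1 one_ne_zero)
  simp only [RCLike.inner_apply, affineComp_apply, fourier_affineComp, one_mul, div_one] at h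
  convert h.symm using 2
  · ext s; rw [add_comm (r / 2), neg_add_eq_sub]
  · ext τ
    simp only [inv_one, abs_one, one_smul, map_mul, ← Complex.exp_conj, Complex.conj_ofReal,
      Complex.conj_I]
    rw [mul_mul_mul_comm, ← Complex.exp_add]
    congr 2
    push_cast; ring

lemma integrable_shear {f g : ℝ → ℂ} (hf : Integrable f) (hg : Integrable g) :
    Integrable (fun q : ℝ × ℝ => g (q.1 - q.2 / 2) * f q.2) := by
  have h1 : Integrable (fun q : ℝ × ℝ => g q.1 * f q.2) := hg.mul_prod hf
  have hdet : |(1 : ℝ) * 1 - (-1 / 2) * 0| = 1 := by norm_num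
  have := (measurePreserving_planeMap hdet).integrable_comp_of_integrable h1
  refine this.congr (Eventually.of_forall fun q => ?_)
  simp only [Function.comp, planeMap_apply]
  ring_nf

lemma integrableOn_logCoord_iff (F : ℝ × ℝ → ℂ) :
    IntegrableOn F (Ioi (0 : ℝ) ×ˢ Ioi (0 : ℝ)) ↔
      Integrable (fun q : ℝ × ℝ => Real.exp (2 * q.1) • F (logCoord q)) := by
  rw [← logCoord_range, ← image_univ, integrableOn_image_iff_integrableOn_abs_det_fderiv_smul
    volume MeasurableSet.univ (fun q _ => (hasFDerivAt_logCoord q).hasFDerivWithinAt)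
    logCoord_injective.injOn]
  simp only [logCoord_det, integrableOn_univ]

/-- Fubini's theorem in logarithmic polar coordinates. -/
lemma integral_integral_eq_of_logCoord {F : ℝ → ℝ → ℂ} {K : ℝ × ℝ → ℂ} {a b c d : ℝ}
    (hdet : |a * d - b * c| = 1)
    (hFK : ∀ x z, F x z = (Ioi (0 : ℝ) ×ˢ Ioi (0 : ℝ)).indicator K (planeMap a b c d (x, z)))
    {k : ℝ × ℝ → ℂ} (hk : Integrable k)
    (hKk : ∀ q, Real.exp (2 * q.1) • K (logCoord q) = k q) :
    Integrable (fun x => ∫ z, F x z) ∧ ∫ x, ∫ z, F x z = ∫ r, ∫ s, k (s, r) := by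
  have hQ : MeasurableSet (Ioi (0 : ℝ) ×ˢ Ioi (0 : ℝ)) := measurableSet_Ioi.prod measurableSet_Ioi
  have h1 : IntegrableOn K (Ioi (0 : ℝ) ×ˢ Ioi (0 : ℝ)) := by
    rw [integrableOn_logCoord_iff]; simpa only [hKk] using hk
  have h2 := (measurePreserving_planeMap hdet).integrable_comp_of_integrable
    ((integrable_indicator_iff hQ).2 h1)
  simp only [hFK]
  have h3 := integral_prod (fun q : ℝ × ℝ =>
    (Ioi (0 : ℝ) ×ˢ Ioi (0 : ℝ)).indicator K (planeMap a b c d q)) h2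
  refine ⟨h2.integral_prod_left, ?_⟩
  rw [← h3, ← Measure.volume_eq_prod,
    (measurePreserving_planeMap hdet).integral_comp (planeMap_measurableEmbedding hdet),
    integral_indicator hQ, integral_logCoord]
  simp only [hKk]
  exact integral_prod_symm _ hk

/-- `Φ` is the logarithmic rescaling of the restriction of `u` to the half line of sign `σ`. -/
def IsMellinOf (σ : ℝ) (u Φ : 𝓢(ℝ, ℂ)) : Prop :=
  ∀ s : ℝ, Φ s = Real.exp (s / 2) * u (σ * Real.exp s)

/-- The two half-density factors multiply to exp s, whatever r is. -/
lemma IsMellinOf.exp_mul {u v Φ Ψ : 𝓢(ℝ, ℂ)} {σ τ : ℝ} (h : IsMellinOf σ u Φ)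
    (h' : IsMellinOf τ v Ψ) (s r : ℝ) :
    Real.exp s * (u (σ * Real.exp (s + r / 2)) * conj (v (τ * Real.exp (s - r / 2)))) =
      Φ (s + r / 2) * conj (Ψ (s - r / 2)) := by
  rw [h, h', (starRingEnd ℂ).map_mul, Complex.conj_ofReal, mul_mul_mul_comm, ← Complex.ofReal_mul, ← Real.exp_add]
  congr 3; ring

lemma integral_exp_comp (F : ℝ → ℝ) :
    ∫ x in Ioi (0 : ℝ), F x = ∫ s, Real.exp s * F (Real.exp s) := by
  rw [← Real.range_exp, ← image_univ, integral_image_eq_integral_abs_deriv_smul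
    MeasurableSet.univ (fun s _ => (Real.hasDerivAt_exp s).hasDerivWithinAt)
    Real.exp_injective.injOn]
  simp only [Real.abs_exp, Measure.restrict_univ, smul_eq_mul]

lemma nrm_fourier_sq (u : 𝓢(ℝ, ℂ)) : ∫ τ, ‖𝓕 u τ‖ ^ 2 = nrm u ^ 2 := by
  rw [← nrm_fourier u, nrm_sq]

lemma IsMellinOf.nrm_pos {u Φ : 𝓢(ℝ, ℂ)} (h : IsMellinOf 1 u Φ) (hu : ∀ y, y ≤ 0 → u y = 0) :
    nrm Φ ^ 2 = nrm u ^ 2 := by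
  have h1 : ∫ y, ‖u y‖ ^ 2 = ∫ y in Ioi (0 : ℝ), ‖u y‖ ^ 2 :=
    (setIntegral_eq_integral_of_forall_compl_eq_zero
      fun y hy => by rw [hu y (not_lt.1 hy)]; simp).symm
  rw [nrm_sq, nrm_sq, h1, integral_exp_comp]
  congr 1 with s
  rw [h, norm_mul, Complex.norm_real, Real.norm_of_nonneg (Real.exp_pos _).le, one_mul, mul_pow,
    ← Real.exp_nat_mul]
  congr 2; push_cast; ring

lemma IsMellinOf.nrm_neg {u Φ : 𝓢(ℝ, ℂ)} (h : IsMellinOf (-1) u Φ) (hu : ∀ y, 0 ≤ y → u y = 0) :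
    nrm Φ ^ 2 = nrm u ^ 2 := by
  let u' : 𝓢(ℝ, ℂ) := affineComp u 0 (-1) (by norm_num)
  have hu' : ∀ y, u' y = u (-y) := fun y => by simp [u']
  have h1 : IsMellinOf 1 u' Φ := fun s => by rw [h s, hu']; simp
  rw [h1.nrm_pos fun y hy => by rw [hu']; exact hu _ (by linarith), nrm_sq, nrm_sq]
  simp only [hu']
  exact integral_neg_eq_self (fun y => ‖u y‖ ^ 2) volume

/-! ### The off-diagonal entry of the quarter plane multiplier -/

section crossTerm

lemma integrableOn_Ici_sechHalf : IntegrableOn sechHalf (Ici 0) := by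
  rw [integrableOn_Ici_iff_integrableOn_Ioi]; exact integrableOn_sechHalf

/-- The Fourier–Laplace transform `∫₀^∞ exp(iωr) / (2 cosh (r/2)) dr`. -/
noncomputable def sechTransform (ω : ℝ) : ℂ :=
  ∫ r in Ici (0 : ℝ), Complex.exp ((ω * r : ℝ) * Complex.I) * sechHalf r

lemma integrable_fourier_mul (Φ Ψ : 𝓢(ℝ, ℂ)) : Integrable (fun τ => 𝓕 Φ τ * conj (𝓕 Ψ τ)) :=
  (mulSchwartz (𝓕 Φ) (conjSchwartz (𝓕 Ψ))).integrable

/-- The off-diagonal part of the quadratic form of the quarter plane. -/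
lemma wignerForm_quarterPlane_cross {u v Φ Ψ : 𝓢(ℝ, ℂ)} {ε : ℝ} (hε : 0 < ε)
    (hu : ∀ y, y ≤ ε → u y = 0) (hv : ∀ y, -ε ≤ y → v y = 0)
    (hΦ : IsMellinOf 1 u Φ) (hΨ : IsMellinOf (-1) v Ψ) :
    wignerForm quarterPlane u v = 1 / (2 * Real.pi * Complex.I) *
      ∫ τ, sechTransform (2 * Real.pi * τ) * (𝓕 Φ τ * conj (𝓕 Ψ τ)) := by
  have hE : MeasurableSet quarterPlane :=
    ((isClosed_le continuous_const continuous_fst).inter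
      (isClosed_le continuous_const continuous_snd)).measurableSet
  let F : ℝ → ℝ → ℂ := fun x z => (Ici (0 : ℝ)).indicator (fun x => slice u v x z / z) x
  have hx : ∀ x, ∫ ξ in vsection quarterPlane x, wigner u v (x, ξ) =
      1 / (2 * Real.pi * Complex.I) * ∫ z, F x z := by
    intro x
    by_cases h : 0 ≤ x
    · have hvan := fun z => slice_vanishes_of_opposite hε hu hv x z
      obtain ⟨h1, h2⟩ := integrable_div_of_vanishes _ hε hvan
      have := setIntegral_Ici_fourier h1 (slice u v x).integrable h2
        (𝓕 (slice u v x) : 𝓢(ℝ, ℂ)).integrable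
      have hs : vsection quarterPlane x = Ici 0 := by
        ext ξ; simp [vsection, quarterPlane, h]
      simp only [wigner_eq_fourier, hs, F, indicator_of_mem (show x ∈ Ici (0 : ℝ) from h)]
      exact this
    · have hs : vsection quarterPlane x = ∅ := by
        ext ξ; simp [vsection, quarterPlane, h]
      simp [hs, F, h]
  rw [wignerForm_eq_iterated hE]
  simp only [hx]
  rw [integral_const_mul]
  congr 1
  let K : ℝ × ℝ → ℂ := fun p =>
    {p : ℝ × ℝ | p.2 ≤ p.1}.indicator (fun p => u p.1 * conj (v (-p.2)) / (p.1 + p.2)) p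
  -- In logarithmic coordinates the cross term is the correlation of Φ and Ψ at lag r, weighted by
  -- `sechHalf` on r ≥ 0. Parseval in s followed by integration in r produces the multiplier
  -- `sechTransform`.
  let k : ℝ × ℝ → ℂ := fun q => Φ (q.1 + q.2 / 2) * conj (Ψ (q.1 - q.2 / 2)) *
    (Ici (0 : ℝ)).indicator (fun r => (sechHalf r : ℂ)) q.2
  have hdet : |(1 : ℝ) * (1 / 2) - 1 / 2 * -1| = 1 := by norm_num
  have hsech : Integrable ((Ici (0 : ℝ)).indicator (fun r => (sechHalf r : ℂ))) :=
    (integrable_indicator_iff measurableSet_Ici).2 integrableOn_Ici_sechHalf.ofReal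
  have hk : Integrable k := by
    obtain ⟨B, hB⟩ : ∃ B, ∀ z, ‖Φ z‖ ≤ B := ⟨_, fun z => SchwartzMap.norm_le_seminorm ℝ _ z⟩
    refine ((integrable_shear hsech (conjSchwartz Ψ).integrable).bdd_mul (c := B)
      (f := fun q : ℝ × ℝ => Φ (q.1 + q.2 / 2)) ?_ ?_).congr ?_
    · exact (Φ.continuous.comp (by fun_prop)).aestronglyMeasurable
    · exact Eventually.of_forall fun q => hB _
    · exact Eventually.of_forall fun q => by simp only [k, conjSchwartz_apply]; ring
  rw [(integral_integral_eq_of_logCoord (K := K) hdet ?_ hk ?_).2]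
  · have h1 : ∀ r, ∫ s, k (s, r) = ∫ τ, (Ici (0 : ℝ)).indicator (fun r =>
        Complex.exp (((2 * Real.pi * τ * r : ℝ) : ℂ) * Complex.I) * (sechHalf r : ℂ)) r *
          (𝓕 Φ τ * conj (𝓕 Ψ τ)) := by
      intro r
      simp only [k]
      rw [integral_mul_const, integral_correlation, ← integral_mul_const]
      congr 1 with τ
      by_cases hr : r ∈ Ici (0 : ℝ)
      · simp only [indicator_of_mem hr]; ring
      · simp only [indicator_of_notMem hr]; ring
    simp only [h1]
    rw [integral_integral_swap]
    · congr 1 with τ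
      rw [integral_mul_const, integral_indicator measurableSet_Ici, sechTransform]
    · have h2 : Integrable (fun q : ℝ × ℝ => (Ici (0 : ℝ)).indicator (fun r => (sechHalf r : ℂ)) q.1
          * (𝓕 Φ q.2 * conj (𝓕 Ψ q.2))) (volume.prod volume) :=
        hsech.mul_prod (integrable_fourier_mul Φ Ψ)
      refine (h2.bdd_mul (c := 1) (f := fun q : ℝ × ℝ =>
        Complex.exp (((2 * Real.pi * q.2 * q.1 : ℝ) : ℂ) * Complex.I)) ?_ ?_).congr ?_
      · exact Continuous.aestronglyMeasurable (by fun_prop)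
      · exact Eventually.of_forall fun q => (Complex.norm_exp_ofReal_mul_I _).le
      · refine Eventually.of_forall fun q => ?_
        simp only [Function.uncurry]
        by_cases hr : q.1 ∈ Ici (0 : ℝ)
        · simp only [indicator_of_mem hr]; ring
        · simp only [indicator_of_notMem hr]; ring
  · intro x z
    simp only [F, K, planeMap_apply]
    by_cases h : slice u v x z = 0
    · have h' : u (1 * x + 1 / 2 * z) * conj (v (-(-1 * x + 1 / 2 * z))) = 0 := by
        rw [slice_apply] at h
        rw [← h]; congr 3 <;> ring
      simp only [indicator, h, h', zero_div, ite_self]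
    · obtain ⟨h1, h2⟩ := slice_eq_zero_of_opposite hu hv x z h
      have hmem : ((1 * x + 1 / 2 * z, -1 * x + 1 / 2 * z) : ℝ × ℝ) ∈
          Ioi (0 : ℝ) ×ˢ Ioi (0 : ℝ) := ⟨by simp; linarith, by simp; linarith⟩
      rw [indicator_of_mem hmem]
      by_cases hx0 : 0 ≤ x
      · rw [indicator_of_mem (show x ∈ Ici (0 : ℝ) from hx0), indicator_of_mem, slice_apply]
        · push_cast
          congr 1
          · congr 3 <;> ring
          · ring
        · simp only [mem_ofPred_eq]; linarith
      · rw [indicator_of_notMem (show x ∉ Ici (0 : ℝ) from hx0), indicator_of_notMem]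
        simp only [mem_ofPred_eq]; linarith
  · rintro ⟨s, r⟩
    simp only [K, k, logCoord]
    by_cases hr : 0 ≤ r
    · rw [indicator_of_mem (show r ∈ Ici (0 : ℝ) from hr), indicator_of_mem
        (by simp only [mem_ofPred_eq, Real.exp_le_exp]; linarith), ← hΦ.exp_mul hΨ,
        Complex.real_smul, one_mul, neg_one_mul]
      have e1 : Real.exp (s + r / 2) + Real.exp (s - r / 2) =
          Real.exp s * (2 * Real.cosh (r / 2)) := by
        rw [Real.cosh_eq, Real.exp_add, sub_eq_add_neg, Real.exp_add]; ring
      have e2 : Real.exp (2 * s) = Real.exp s * Real.exp s := by rw [← Real.exp_add]; ring_nf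
      rw [← Complex.ofReal_add, e1, e2, sechHalf]
      have := Real.cosh_pos (r / 2)
      push_cast
      have h0 : (Complex.exp s) ≠ 0 := Complex.exp_ne_zero _
      field_simp
    · rw [indicator_of_notMem (show r ∉ Ici (0 : ℝ) from hr), indicator_of_notMem]
      · simp
      · simp only [mem_ofPred_eq, Real.exp_le_exp]; linarith

end crossTerm

/-! ### The diagonal entry of the quarter plane multiplier -/

lemma schwartz_lipschitz (g : 𝓢(ℝ, ℂ)) : ∃ D, 0 ≤ D ∧ ∀ x y : ℝ, ‖g x - g y‖ ≤ D * |x - y| := by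
  obtain ⟨D, hD⟩ : ∃ D, ∀ z, ‖derivCLM ℝ ℂ g z‖ ≤ D :=
    ⟨_, fun z => SchwartzMap.norm_le_seminorm ℝ _ z⟩
  refine ⟨D, (norm_nonneg _).trans (hD 0), fun x y => ?_⟩
  exact convex_univ.norm_image_sub_le_of_norm_deriv_le
    (fun z _ => g.differentiableAt) (fun z _ => hD z) (mem_univ y) (mem_univ x)

lemma abs_im_mul_conj_le (a b : ℂ) : |(a * conj b).im| ≤ ‖a - b‖ * ‖b‖ := by
  have h : (a * conj b).im = ((a - b) * conj b).im := by
    simp [Complex.mul_im]; ring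
  rw [h]
  exact (Complex.abs_im_le_norm _).trans_eq (by rw [norm_mul, RCLike.norm_conj])

/-- The half-line integral of the Fourier transform of a Hermitian function. -/
lemma setIntegral_Ici_fourier_of_hermitian (g : 𝓢(ℝ, ℂ)) (hg : ∀ z, g (-z) = conj (g z)) :
    ∫ ξ in Ici (0 : ℝ), 𝓕 g ξ = 1 / 2 * g 0 + 1 / (2 * Real.pi) * ∫ z : ℝ, ((g z).im / z : ℂ) := by
  let g' : 𝓢(ℝ, ℂ) := affineComp g 0 (-1) (by norm_num)
  have hg' : ∀ z, g' z = conj (g z) := fun z => by simp [g', hg]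
  have hF' : ∀ ξ, 𝓕 g' ξ = 𝓕 g (-ξ) := fun ξ => by
    simp [g', fourier_affineComp, div_neg]
  -- Only the odd part of g can be divided by z. The difference of the two half-line integrals of 𝓕
  -- g comes from d, and their sum is g(0) by Fourier inversion.
  let d : 𝓢(ℝ, ℂ) := g - g'
  have hd : ∀ z, d z = 2 * Complex.I * (g z).im := fun z => by
    rw [sub_apply, hg', Complex.sub_conj]; push_cast; ring
  have hd0 : d 0 = 0 := by
    have := hg 0
    rw [neg_zero] at this
    rw [sub_apply, hg', ← this, sub_self]
  have hFd : ∀ ξ, 𝓕 d ξ = 𝓕 g ξ - 𝓕 g (-ξ) := fun ξ => by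
    have h : 𝓕 (d + g') = 𝓕 d + 𝓕 g' := FourierTransform.fourier_add d g'
    rw [← hF', eq_sub_iff_add_eq, ← add_apply, ← h, sub_add_cancel]
  obtain ⟨D, hD0, hD⟩ := schwartz_lipschitz d
  have hh : Integrable (fun z : ℝ => d z / z) := by
    have hb : Integrable (fun z => (Icc (-1 : ℝ) 1).indicator (fun _ => D) z + ‖d z‖) :=
      ((integrable_indicator_iff measurableSet_Icc).2 (integrableOn_const (by simp))).add
        d.integrable.norm
    refine hb.mono' (d.continuous.measurable.div
      Complex.continuous_ofReal.measurable).aestronglyMeasurable (Eventually.of_forall fun z => ?_)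
    rw [norm_div, Complex.norm_real, Real.norm_eq_abs]
    by_cases hz : |z| ≤ 1
    · rw [indicator_of_mem (show z ∈ Icc (-1 : ℝ) 1 from abs_le.1 hz)]
      have h1 := hD z 0
      rw [hd0, sub_zero, sub_zero] at h1
      have : ‖d z‖ / |z| ≤ D := div_le_of_le_mul₀ (abs_nonneg _) hD0 h1
      linarith [norm_nonneg (d z)]
    · push Not at hz
      have h1 : 0 ≤ (Icc (-1 : ℝ) 1).indicator (fun _ => D) z := indicator_nonneg (fun _ _ => hD0) _
      have : ‖d z‖ / |z| ≤ ‖d z‖ := div_le_self (norm_nonneg _) hz.le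
      linarith
  have hgh : ∀ z : ℝ, d z = z * (d z / z) := fun z => by
    by_cases hz : z = 0
    · rw [hz, hd0]; simp
    · rw [mul_div_cancel₀ _ (by exact_mod_cast hz)]
  have hFint : ∀ f : 𝓢(ℝ, ℂ), Integrable (fun ξ => 𝓕 f ξ) := fun f =>
    (𝓕 f : 𝓢(ℝ, ℂ)).integrable
  have h1 : ∫ ξ in Ici (0 : ℝ), 𝓕 d ξ = 1 / (2 * Real.pi * Complex.I) * ∫ z : ℝ, d z / z :=
    setIntegral_Ici_fourier hh d.integrable hgh (hFint d)
  have h2 : ∫ z : ℝ, d z / z = 2 * Complex.I * ∫ z : ℝ, ((g z).im / z : ℂ) := by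
    rw [← integral_const_mul]
    congr 1 with z
    rw [hd]; ring
  have h3 : ∫ ξ in Ici (0 : ℝ), 𝓕 d ξ =
      (∫ ξ in Ici (0 : ℝ), 𝓕 g ξ) - ∫ ξ in Iic (0 : ℝ), 𝓕 g ξ := by
    have e1 : ∫ ξ in Ici (0 : ℝ), 𝓕 g (-ξ) = ∫ ξ in Iic (0 : ℝ), 𝓕 g ξ := by
      rw [integral_Ici_eq_integral_Ioi, integral_comp_neg_Ioi, neg_zero]
    simp only [hFd]
    rw [integral_sub (hFint g).integrableOn (hFint g).comp_neg.integrableOn, e1]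
  have h4 : (∫ ξ in Ici (0 : ℝ), 𝓕 g ξ) + ∫ ξ in Iic (0 : ℝ), 𝓕 g ξ = g 0 := by
    have e2 := integral_exp_mul_fourier g 0
    simp only [Complex.ofReal_zero, mul_zero, zero_mul, Complex.exp_zero, one_mul] at e2
    rw [← e2, add_comm, integral_Ici_eq_integral_Ioi]
    exact intervalIntegral.integral_Iic_add_Ioi (hFint g).integrableOn (hFint g).integrableOn
  have hpi : (Real.pi : ℂ) ≠ 0 := Complex.ofReal_ne_zero.2 Real.pi_ne_zero
  have hI := Complex.I_ne_zero
  have h5 : 1 / (2 * Real.pi * Complex.I) * (2 * Complex.I * ∫ z : ℝ, ((g z).im / z : ℂ)) =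
      1 / Real.pi * ∫ z : ℝ, ((g z).im / z : ℂ) := by field_simp
  rw [h3, h2, h5] at h1
  have h6 : 1 / (2 * Real.pi : ℂ) = 1 / 2 * (1 / Real.pi) := by field_simp
  rw [h6]
  linear_combination (1 / 2) * h1 + (1 / 2) * h4

section diagonalTerm

/-- The function `1 / (2 sinh (r/2))`. -/
noncomputable def cschHalf (r : ℝ) : ℝ := 1 / (2 * Real.sinh (r / 2))

lemma measurable_cschHalf : Measurable cschHalf := by
  unfold cschHalf
  exact measurable_const.div (by fun_prop)

lemma sechHalf_neg (r : ℝ) : sechHalf (-r) = sechHalf r := by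
  rw [sechHalf, sechHalf, neg_div, Real.cosh_neg]

lemma integrable_sechHalf : Integrable sechHalf := by
  have h : IntegrableOn sechHalf (Iic 0) := by
    have := (Measure.measurePreserving_neg (volume : Measure ℝ)).integrableOn_comp_preimage
      (Homeomorph.neg ℝ).measurableEmbedding (f := sechHalf) (s := Ici 0)
    have := this.2 integrableOn_Ici_sechHalf
    simpa [Function.comp_def, sechHalf_neg] using this
  rw [← integrableOn_univ, ← Iic_union_Ioi (a := (0 : ℝ))]
  exact h.union integrableOn_sechHalf

lemma abs_le_abs_sinh (x : ℝ) : |x| ≤ |Real.sinh x| := by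
  rw [Real.abs_sinh]
  exact Real.self_le_sinh_iff.2 (abs_nonneg x)

/-- Halve the argument once more: sinh(r/2) = 2 sinh(r/4) cosh(r/4), and the first factor absorbs r.
-/
lemma abs_mul_cschHalf_le (r : ℝ) : |r| * |cschHalf r| ≤ 2 * sechHalf (r / 2) := by
  have hc := Real.cosh_pos (r / 2 / 2)
  have h1 : Real.sinh (r / 2) = 2 * Real.sinh (r / 2 / 2) * Real.cosh (r / 2 / 2) := by
    rw [← Real.sinh_two_mul]; ring_nf
  have h2 := abs_le_abs_sinh (r / 2 / 2)
  rw [cschHalf, sechHalf, abs_div, h1, abs_one, mul_one_div]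
  have h3 : |2 * (2 * Real.sinh (r / 2 / 2) * Real.cosh (r / 2 / 2))| =
      4 * |Real.sinh (r / 2 / 2)| * Real.cosh (r / 2 / 2) := by
    rw [abs_mul, abs_mul, abs_mul, abs_of_pos hc, abs_two]; ring
  rw [h3]
  refine div_le_of_le_mul₀ (by positivity) (by positivity) ?_
  have h4 : |r| = 4 * |r / 2 / 2| := by rw [abs_div, abs_div, abs_two]; ring
  rw [h4]
  calc 4 * |r / 2 / 2| ≤ 4 * |Real.sinh (r / 2 / 2)| := by linarith
    _ = _ := by field_simp

lemma integrable_mul_cschHalf : Integrable (fun r => r * cschHalf r) := by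
  refine ((integrable_sechHalf.comp_div two_ne_zero).const_mul 2).mono'
    (measurable_id.mul measurable_cschHalf).aestronglyMeasurable (Eventually.of_forall fun r => ?_)
  rw [Real.norm_eq_abs, abs_mul]
  exact abs_mul_cschHalf_le r

/-- The sine transform `∫ sin(ωr) / (2 sinh (r/2)) dr`. -/
noncomputable def cschTransform (ω : ℝ) : ℝ := ∫ r, cschHalf r * Real.sin (ω * r)

/-- The diagonal part of the quadratic form of the quarter plane. -/
lemma wignerForm_quarterPlane_self {u Φ : 𝓢(ℝ, ℂ)} (hu : ∀ y, y ≤ 0 → u y = 0)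
    (hΦ : IsMellinOf 1 u Φ) :
    wignerForm quarterPlane u u = ((∫ τ, (1 / 2 + 1 / (2 * Real.pi) *
      cschTransform (2 * Real.pi * τ)) * ‖𝓕 Φ τ‖ ^ 2 : ℝ) : ℂ) := by
  have hE : MeasurableSet quarterPlane :=
    ((isClosed_le continuous_const continuous_fst).inter
      (isClosed_le continuous_const continuous_snd)).measurableSet
  have hsupp : ∀ x z, slice u u x z ≠ 0 → 0 < x + z / 2 ∧ 0 < x - z / 2 := by
    intro x z h
    rw [slice_apply] at h
    constructor
    · by_contra hc
      exact h (by rw [hu _ (not_lt.1 hc)]; simp)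
    · by_contra hc
      exact h (by rw [hu _ (not_lt.1 hc)]; simp)
  have hherm : ∀ x z, slice u u x (-z) = conj (slice u u x z) := by
    intro x z
    rw [slice_apply, slice_apply, map_mul, Complex.conj_conj, mul_comm]
    congr 2 <;> ring_nf
  let F : ℝ → ℝ → ℂ := fun x z => ((slice u u x z).im / z : ℂ)
  have hx : ∀ x, ∫ ξ in vsection quarterPlane x, wigner u u (x, ξ) =
      1 / 2 * ((‖u x‖ ^ 2 : ℝ) : ℂ) + 1 / (2 * Real.pi) * ∫ z, F x z := by
    intro x
    by_cases h : 0 ≤ x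
    · have hs : vsection quarterPlane x = Ici 0 := by
        ext ξ; simp [vsection, quarterPlane, h]
      simp only [wigner_eq_fourier, hs, F]
      rw [setIntegral_Ici_fourier_of_hermitian _ (hherm x), slice_apply]
      simp [Complex.mul_conj, Complex.normSq_eq_norm_sq]
    · have hs : vsection quarterPlane x = ∅ := by
        ext ξ; simp [vsection, quarterPlane, h]
      have hF : ∀ z, F x z = 0 := by
        intro z
        have : slice u u x z = 0 := by
          by_contra hc
          have := hsupp x z hc
          linarith
        simp [F, this]
      simp only [hs, hF, hu x (by linarith)]
      simp
  rw [wignerForm_eq_iterated hE]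
  simp only [hx]
  let K : ℝ × ℝ → ℂ := fun p => (((u p.1 * conj (u p.2)).im / (p.1 - p.2) : ℝ) : ℂ)
  let k : ℝ × ℝ → ℂ := fun q =>
    ((cschHalf q.2 * (Φ (q.1 + q.2 / 2) * conj (Φ (q.1 - q.2 / 2))).im : ℝ) : ℂ)
  have hdet : |(1 : ℝ) * (-1 / 2) - 1 / 2 * 1| = 1 := by norm_num
  obtain ⟨D, hD0, hD⟩ := schwartz_lipschitz Φ
  -- The Lipschitz bound for Φ supplies a factor r which cancels the pole of `cschHalf`.
  have hk : Integrable k := by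
    have h1 := (integrable_shear (f := fun r => ((r * cschHalf r : ℝ) : ℂ))
      integrable_mul_cschHalf.ofReal Φ.integrable).norm.const_mul D
    refine h1.mono' ?_ (Eventually.of_forall fun q => ?_)
    · refine Measurable.aestronglyMeasurable (Complex.measurable_ofReal.comp
        ((measurable_cschHalf.comp measurable_snd).mul (Complex.measurable_im.comp ?_)))
      exact ((Φ.continuous.comp (by fun_prop)).mul
        (Complex.continuous_conj.comp (Φ.continuous.comp (by fun_prop)))).measurable
    · simp only [k, Complex.norm_real, Real.norm_eq_abs, norm_mul]
      have h2 := hD (q.1 + q.2 / 2) (q.1 - q.2 / 2)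
      rw [show q.1 + q.2 / 2 - (q.1 - q.2 / 2) = q.2 by ring] at h2
      calc _ ≤ |cschHalf q.2| * (D * |q.2| * ‖Φ (q.1 - q.2 / 2)‖) := by
            gcongr
            exact (abs_im_mul_conj_le _ _).trans (by gcongr)
        _ = _ := by ring
  obtain ⟨hFint, hFeq⟩ := integral_integral_eq_of_logCoord (F := F) (K := K) hdet (by
    intro x z
    simp only [F, K, planeMap_apply]
    by_cases h : slice u u x z = 0
    · have h' : u (1 * x + 1 / 2 * z) * conj (u (1 * x + -1 / 2 * z)) = 0 := by
        rw [slice_apply] at h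
        rw [← h]; congr 3 <;> ring
      simp only [indicator, h, h', Complex.zero_im, zero_div, Complex.ofReal_zero, ite_self]
    · obtain ⟨h1, h2⟩ := hsupp x z h
      rw [indicator_of_mem (show ((1 * x + 1 / 2 * z, 1 * x + -1 / 2 * z) : ℝ × ℝ) ∈
          Ioi (0 : ℝ) ×ˢ Ioi (0 : ℝ) from ⟨by simp; linarith, by simp; linarith⟩), slice_apply]
      push_cast
      congr 1
      · congr 5 <;> ring
      · ring) hk (by
    rintro ⟨s, r⟩
    simp only [K, k, logCoord]
    rw [← hΦ.exp_mul hΦ, Complex.real_smul, ← Complex.ofReal_mul, one_mul, one_mul,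
      Complex.im_ofReal_mul]
    have e1 : Real.exp (s + r / 2) - Real.exp (s - r / 2) =
        Real.exp s * (2 * Real.sinh (r / 2)) := by
      rw [Real.sinh_eq, Real.exp_add, sub_eq_add_neg s, Real.exp_add]; ring
    have e2 : Real.exp (2 * s) = Real.exp s * Real.exp s := by rw [← Real.exp_add]; ring_nf
    rw [e1, e2, cschHalf]
    have h0 := Real.exp_ne_zero s
    congr 1
    field_simp)
  have hcorr : ∀ r, ∫ s, k (s, r) =
      ∫ τ, ((cschHalf r * Real.sin (2 * Real.pi * τ * r) * ‖𝓕 Φ τ‖ ^ 2 : ℝ) : ℂ) := by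
    intro r
    have h0 : Integrable (fun s => Φ (s + r / 2) * conj (Φ (s - r / 2))) := by
      refine (mulSchwartz (affineComp Φ (r / 2) 1 one_ne_zero)
        (conjSchwartz (affineComp Φ (-(r / 2)) 1 one_ne_zero))).integrable.congr
        (Eventually.of_forall fun s => ?_)
      simp only [mulSchwartz_apply, conjSchwartz_apply, affineComp_apply, one_mul]
      rw [add_comm (r / 2), neg_add_eq_sub]
    have h1 : Integrable (fun τ => Complex.exp (((2 * Real.pi * τ * r : ℝ) : ℂ) * Complex.I) *
        (𝓕 Φ τ * conj (𝓕 Φ τ))) :=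
      (integrable_fourier_mul Φ Φ).bdd_mul (c := 1)
        (Continuous.aestronglyMeasurable (by fun_prop))
        (Eventually.of_forall fun q => (Complex.norm_exp_ofReal_mul_I _).le)
    have h2 := congrArg Complex.im (integral_correlation Φ Φ r)
    have e1 := integral_im h0
    have e2 := integral_im h1
    simp only [RCLike.im_to_complex] at e1 e2
    rw [← e1, ← e2] at h2
    simp only [k]
    rw [integral_complex_ofReal, integral_const_mul, h2, ← integral_const_mul, integral_complex_ofReal]
    congr 2 with τ
    rw [Complex.mul_conj, Complex.normSq_eq_norm_sq, Complex.im_mul_ofReal,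
      Complex.exp_ofReal_mul_I_im]
    ring
  have hint : Integrable (fun q : ℝ × ℝ =>
      cschHalf q.1 * Real.sin (2 * Real.pi * q.2 * q.1) * ‖𝓕 Φ q.2‖ ^ 2) (volume.prod volume) := by
    -- Likewise |sin(2πτr)| ≤ 2π|τ||r| trades the pole in r for a factor |τ|, harmless against the
    -- Schwartz function 𝓕 Φ.
    have h1 : Integrable (fun τ : ℝ => 2 * Real.pi * ‖τ * (𝓕 Φ τ * conj (𝓕 Φ τ))‖) :=
      ((mulX (mulSchwartz (𝓕 Φ) (conjSchwartz (𝓕 Φ)))).integrable.norm.const_mul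
        (2 * Real.pi)).congr (Eventually.of_forall fun τ => by simp)
    refine (integrable_mul_cschHalf.norm.mul_prod h1).mono' ?_ (Eventually.of_forall fun q => ?_)
    · refine Measurable.aestronglyMeasurable (((measurable_cschHalf.comp measurable_fst).mul
        (by fun_prop)).mul (Measurable.pow_const (Continuous.measurable ?_) 2))
      exact ((𝓕 Φ).continuous.comp continuous_snd).norm
    · rw [norm_mul, norm_mul, norm_pow, norm_norm]
      simp only [norm_mul, Complex.norm_real, RCLike.norm_conj]
      have h2 : ‖Real.sin (2 * Real.pi * q.2 * q.1)‖ ≤ 2 * Real.pi * ‖q.2‖ * ‖q.1‖ := by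
        refine (Real.abs_sin_le_abs).trans_eq ?_
        rw [abs_mul, abs_mul, abs_of_pos Real.two_pi_pos]
        rfl
      calc _ ≤ ‖cschHalf q.1‖ * (2 * Real.pi * ‖q.2‖ * ‖q.1‖) * ‖𝓕 Φ q.2‖ ^ 2 := by gcongr
        _ = _ := by ring
  have hsq : Integrable (fun τ => ‖𝓕 Φ τ‖ ^ 2) :=
    ((𝓕 Φ).memLp 2 volume).integrable_norm_pow (by norm_num)
  have hint2 : Integrable (fun τ => cschTransform (2 * Real.pi * τ) * ‖𝓕 Φ τ‖ ^ 2) := by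
    refine hint.integral_prod_right.congr (Eventually.of_forall fun τ => ?_)
    simp only [cschTransform]
    rw [integral_mul_const]
  rw [integral_add, integral_const_mul, integral_const_mul, hFeq]
  · simp only [hcorr]
    rw [integral_integral_swap hint.ofReal]
    have e : ∀ τ, ∫ r, ((cschHalf r * Real.sin (2 * Real.pi * τ * r) * ‖𝓕 Φ τ‖ ^ 2 : ℝ) : ℂ) =
        ((cschTransform (2 * Real.pi * τ) * ‖𝓕 Φ τ‖ ^ 2 : ℝ) : ℂ) := by
      intro τ
      rw [integral_complex_ofReal, integral_mul_const, cschTransform]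
    simp only [e]
    rw [integral_complex_ofReal, integral_complex_ofReal, ← nrm_sq, ← hΦ.nrm_pos hu, ← nrm_fourier_sq]
    simp only [add_mul, mul_assoc (1 / (2 * Real.pi))]
    rw [integral_add (hsq.const_mul _) (hint2.const_mul _), integral_const_mul,
      integral_const_mul]
    push_cast
    ring
  · exact (((u.memLp 2 volume).integrable_norm_pow (by norm_num)).ofReal).const_mul _
  · exact hFint.const_mul _

end diagonalTerm

/-! ### Closed forms of the diagonal and off-diagonal transforms -/

section laplace

lemma integrableOn_exp_mul_sin {a : ℝ} (ha : 0 < a) (ω : ℝ) :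
    IntegrableOn (fun r => Real.exp (-a * r) * Real.sin (ω * r)) (Ioi 0) := by
  refine (integrableOn_exp_mul_Ioi (a := -a) (by linarith) 0).mul_bdd (c := 1)
    (Continuous.aestronglyMeasurable (by fun_prop)) (Eventually.of_forall fun r => ?_)
  exact Real.abs_sin_le_one _

lemma integral_exp_mul_sin {a : ℝ} (ha : 0 < a) (ω : ℝ) :
    ∫ r in Ioi (0 : ℝ), Real.exp (-a * r) * Real.sin (ω * r) = ω / (ω ^ 2 + a ^ 2) := by
  have hre : (-(a : ℂ) + ω * Complex.I).re < 0 := by simpa using ha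
  have h1 := integral_im (integrableOn_exp_mul_complex_Ioi hre 0)
  rw [integral_exp_mul_complex_Ioi hre] at h1
  simp only [RCLike.im_to_complex] at h1
  have h2 : ∀ r : ℝ, (Complex.exp ((-(a : ℂ) + ω * Complex.I) * r)).im =
      Real.exp (-a * r) * Real.sin (ω * r) := by
    intro r
    rw [Complex.exp_im]
    simp
  simp only [h2] at h1
  rw [h1]
  simp only [Complex.ofReal_zero, mul_zero, Complex.exp_zero, Complex.div_im, Complex.normSq_apply]
  simp
  ring

lemma integral_mul_exp {a : ℝ} (ha : 0 < a) (n : ℕ) :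
    IntegrableOn (fun r : ℝ => r ^ n * Real.exp (-a * r)) (Ioi 0) ∧
    ∫ r in Ioi (0 : ℝ), r ^ n * Real.exp (-a * r) = n.factorial / a ^ (n + 1) := by
  have h := Real.integral_rpow_mul_exp_neg_mul_Ioi (a := n + 1) (by positivity) ha
  have e : ∀ r : ℝ, r ^ ((n : ℝ) + 1 - 1) * Real.exp (-(a * r)) = r ^ n * Real.exp (-a * r) := by
    intro r; rw [add_sub_cancel_right, Real.rpow_natCast, neg_mul]
  simp only [e] at h
  have h2 : (1 / a) ^ ((n : ℝ) + 1) * Real.Gamma (n + 1) = n.factorial / a ^ (n + 1) := by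
    rw [Real.Gamma_nat_eq_factorial, show (n : ℝ) + 1 = ((n + 1 : ℕ) : ℝ) by push_cast; ring,
      Real.rpow_natCast, one_div, inv_pow]
    ring
  rw [h2] at h
  exact ⟨.of_integral_ne_zero (by rw [h]; positivity), h⟩

end laplace

section tanh

/-- This is the partial fraction expansion of π cot(πx) at x = 1/2 + iω. -/
lemma tanh_partial_fractions (ω : ℝ) :
    Tendsto (fun n : ℕ => ∑ k ∈ Finset.range n, 2 * ω / (ω ^ 2 + (k + 1 / 2) ^ 2)) atTop
      (𝓝 (Real.pi * Real.tanh (Real.pi * ω))) := by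
  let x : ℂ := 1 / 2 + ω * Complex.I
  have hxre : x.re = 1 / 2 := by simp [x]
  have hne : ∀ m : ℤ, x + m ≠ 0 := by
    intro m h
    have h1 := congrArg Complex.re h
    simp only [Complex.add_re, hxre, Complex.intCast_re, Complex.zero_re] at h1
    have h2 : (1 + 2 * m : ℤ) = 0 := by exact_mod_cast (by linarith : (1 : ℝ) + 2 * m = 0)
    omega
  have hx : x ∈ Complex.integerComplement := by
    rintro ⟨m, hm⟩
    exact hne (-m) (by push_cast; rw [hm]; ring)
  have h1 := tendsto_logDeriv_euler_cot_sub hx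
  -- The poles are regrouped by pairing 1/(x - (n + 1)) with 1/(x + n), whose combination is purely
  -- imaginary; one unpaired term 1/(x + n) is left and tends to 0.
  have hsum : ∀ n : ℕ, 1 / x + ∑ j ∈ Finset.range n, cotTerm x j =
      -Complex.I * ((∑ k ∈ Finset.range n, 2 * ω / (ω ^ 2 + (k + 1 / 2) ^ 2) : ℝ) : ℂ) +
        1 / (x + n) := by
    intro n
    induction n with
    | zero => simp
    | succ n ih =>
      rw [Finset.sum_range_succ, Finset.sum_range_succ, ← add_assoc, ih]
      have e1 : x + n ≠ 0 := by simpa using hne n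
      have e2 : x - (n + 1) ≠ 0 := by
        have := hne (-(n + 1)); push_cast at this; rwa [← sub_eq_add_neg] at this
      have e3 : x + (n + 1) ≠ 0 := by have := hne (n + 1); push_cast at this; exact this
      have e4 : 1 / (x - (n + 1)) + 1 / (x + n) =
          -Complex.I * ((2 * ω / (ω ^ 2 + (n + 1 / 2) ^ 2) : ℝ) : ℂ) := by
        have e5 : (x - (n + 1)) * (x + n) = -((ω ^ 2 + (n + 1 / 2) ^ 2 : ℝ) : ℂ) := by
          simp only [x]; push_cast
          linear_combination (ω : ℂ) ^ 2 * Complex.I_sq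
        have e6 : ((ω ^ 2 + (n + 1 / 2) ^ 2 : ℝ) : ℂ) ≠ 0 := by
          rw [← neg_ne_zero, ← e5]; exact mul_ne_zero e2 e1
        rw [div_add_div _ _ e2 e1, e5, Complex.ofReal_div, div_eq_iff
          (neg_ne_zero.2 e6), mul_assoc, div_mul_eq_mul_div, mul_div_assoc, neg_div_self e6]
        simp only [x]; push_cast; ring
      simp only [cotTerm]
      push_cast at e4 ⊢
      linear_combination e4
  have h2 : Tendsto (fun n : ℕ => 1 / (x + n)) atTop (𝓝 0) := by
    have : Tendsto (fun n : ℕ => ‖x + n‖) atTop atTop := by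
      refine tendsto_atTop_mono (fun n => ?_) tendsto_natCast_atTop_atTop
      refine le_trans ?_ (Complex.re_le_norm _)
      rw [Complex.add_re, hxre, Complex.natCast_re]
      linarith
    simp only [one_div]
    exact tendsto_inv₀_cobounded.comp (tendsto_norm_atTop_iff_cobounded.1 this)
  have h3 : Tendsto (fun n : ℕ => Complex.I * (1 / x + ∑ j ∈ Finset.range n, cotTerm x j -
      1 / (x + n))) atTop (𝓝 (Complex.I * (Real.pi * Complex.cot (Real.pi * x)))) := by
    have := ((h1.const_add (1 / x)).sub h2).const_mul Complex.I
    rwa [sub_zero, add_sub_cancel] at this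
  have hcot : Complex.I * (Real.pi * Complex.cot (Real.pi * x)) =
      ((Real.pi * Real.tanh (Real.pi * ω) : ℝ) : ℂ) := by
    have e1 : (Real.pi : ℂ) * x = (Real.pi * ω : ℝ) * Complex.I + Real.pi / 2 := by
      simp only [x]; push_cast; ring
    rw [e1, Complex.cot, Complex.cos_add_pi_div_two, Complex.sin_add_pi_div_two, Complex.sin_mul_I,
      Complex.cos_mul_I, Real.tanh_eq_sinh_div_cosh]
    push_cast
    linear_combination (-(Real.pi : ℂ) * Complex.sinh (Real.pi * ω) /
      Complex.cosh (Real.pi * ω)) * Complex.I_sq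
  rw [hcot] at h3
  have h4 : ∀ n : ℕ, Complex.I * (1 / x + ∑ j ∈ Finset.range n, cotTerm x j - 1 / (x + n)) =
      ((∑ k ∈ Finset.range n, 2 * ω / (ω ^ 2 + (k + 1 / 2) ^ 2) : ℝ) : ℂ) := by
    intro n
    rw [hsum, add_sub_cancel_right, ← mul_assoc]
    simp
  simp only [h4] at h3
  exact_mod_cast (Complex.continuous_re.tendsto _).comp h3

lemma cschHalf_pos {r : ℝ} (hr : 0 < r) : 0 < cschHalf r := by
  have : 0 < Real.sinh (r / 2) := Real.sinh_pos_iff.2 (by linarith)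
  unfold cschHalf; positivity

/-- A finite geometric series in exp(-r), with exact remainder. -/
lemma cschHalf_expansion {r : ℝ} (hr : 0 < r) (n : ℕ) : cschHalf r =
    ∑ k ∈ Finset.range n, Real.exp (-(k + 1 / 2) * r) + Real.exp (-n * r) * cschHalf r := by
  induction n with
  | zero => simp
  | succ n ih =>
    have hs : 0 < Real.sinh (r / 2) := Real.sinh_pos_iff.2 (by linarith)
    have key : (1 - Real.exp (-r)) * cschHalf r = Real.exp (-r / 2) := by
      rw [cschHalf, mul_one_div, div_eq_iff (by positivity), Real.sinh_eq]
      have e1 : Real.exp (-r / 2) * Real.exp (r / 2) = 1 := by rw [← Real.exp_add]; ring_nf; simp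
      have e2 : Real.exp (-r / 2) * Real.exp (-(r / 2)) = Real.exp (-r) := by
        rw [← Real.exp_add]; ring_nf
      linear_combination e2 - e1
    rw [Finset.sum_range_succ, add_assoc]
    convert ih using 2
    have e3 : Real.exp (-(n + 1 / 2) * r) = Real.exp (-n * r) * Real.exp (-r / 2) := by
      rw [← Real.exp_add]; ring_nf
    have e4 : Real.exp (-((n + 1 : ℕ) : ℝ) * r) = Real.exp (-n * r) * Real.exp (-r) := by
      rw [← Real.exp_add]; push_cast; ring_nf
    rw [e3, e4]
    linear_combination (-Real.exp (-n * r)) * key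

lemma cschHalf_mul_sin_even (ω r : ℝ) :
    cschHalf |r| * Real.sin (ω * |r|) = cschHalf r * Real.sin (ω * r) := by
  rcases abs_choice r with h | h <;> rw [h]
  rw [cschHalf, neg_div, Real.sinh_neg, mul_neg ω, Real.sin_neg, cschHalf, mul_neg, mul_neg, div_neg]
  ring

/-- The sine transform of `1 / (2 sinh (r/2))`. -/
lemma cschTransform_eq (ω : ℝ) : cschTransform ω = Real.pi * Real.tanh (Real.pi * ω) := by
  have h1 : cschTransform ω = 2 * ∫ r in Ioi (0 : ℝ), cschHalf r * Real.sin (ω * r) := by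
    rw [cschTransform, ← integral_comp_abs (f := fun r => cschHalf r * Real.sin (ω * r))]
    simp only [cschHalf_mul_sin_even]
  refine tendsto_nhds_unique (f := fun n : ℕ =>
    ∑ k ∈ Finset.range n, 2 * ω / (ω ^ 2 + (k + 1 / 2) ^ 2)) (l := atTop) ?_
    (tanh_partial_fractions ω)
  rw [tendsto_iff_norm_sub_tendsto_zero]
  refine squeeze_zero' (Eventually.of_forall fun n => norm_nonneg _) ?_
    (g := fun n : ℕ => 2 * |ω| * (1 / (n : ℝ))) ?_
  · filter_upwards [eventually_gt_atTop 0] with n hn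
    have hn' : (0 : ℝ) < n := by exact_mod_cast hn
    obtain ⟨hi, hv⟩ := integral_mul_exp hn' 0
    simp only [pow_zero, one_mul] at hi hv
    -- Since |sin(ωr)| ≤ |ω|r and r · `cschHalf r` ≤ 1, the tail of the expansion contributes at
    -- most |ω|/n.
    have hbound : ∀ r ∈ Ioi (0 : ℝ), ‖Real.exp (-n * r) * cschHalf r * Real.sin (ω * r)‖ ≤
        |ω| * Real.exp (-n * r) := by
      intro r hr
      have hr' : (0 : ℝ) < r := hr
      have e1 : |Real.sin (ω * r)| ≤ |ω| * r := by
        refine Real.abs_sin_le_abs.trans_eq ?_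
        rw [abs_mul, abs_of_pos hr']
      have e2 : r * cschHalf r ≤ 1 := by
        have := Real.self_le_sinh_iff.2 (by positivity : 0 ≤ r / 2)
        have hs : 0 < Real.sinh (r / 2) := by linarith
        rw [cschHalf, mul_one_div, div_le_one (by positivity)]
        linarith
      rw [Real.norm_eq_abs, abs_mul, abs_mul, abs_of_pos (Real.exp_pos _),
        abs_of_pos (cschHalf_pos hr')]
      calc _ ≤ Real.exp (-n * r) * cschHalf r * (|ω| * r) := by
            have := cschHalf_pos hr'
            gcongr
        _ = |ω| * Real.exp (-n * r) * (r * cschHalf r) := by ring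
        _ ≤ |ω| * Real.exp (-n * r) * 1 := by gcongr
        _ = _ := mul_one _
    have hR : IntegrableOn (fun r => Real.exp (-n * r) * cschHalf r * Real.sin (ω * r)) (Ioi 0) :=
      (hi.const_mul |ω|).mono' (((by fun_prop : Measurable fun r : ℝ => Real.exp (-n * r)).mul
        measurable_cschHalf).mul (by fun_prop)).aestronglyMeasurable
        ((ae_restrict_iff' measurableSet_Ioi).2 (Eventually.of_forall hbound))
    have hsplit : ∫ r in Ioi (0 : ℝ), cschHalf r * Real.sin (ω * r) =
        ∑ k ∈ Finset.range n, ω / (ω ^ 2 + (k + 1 / 2) ^ 2) +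
          ∫ r in Ioi (0 : ℝ), Real.exp (-n * r) * cschHalf r * Real.sin (ω * r) := by
      have e1 : ∀ k : ℕ, (0 : ℝ) < k + 1 / 2 := fun k => by positivity
      rw [Finset.sum_congr rfl fun (k : ℕ) _ => (integral_exp_mul_sin (e1 k) ω).symm,
        ← integral_finsetSum _ fun (k : ℕ) _ => integrableOn_exp_mul_sin (e1 k) ω,
        ← integral_add (integrable_finsetSum _ fun (k : ℕ) _ =>
          integrableOn_exp_mul_sin (e1 k) ω) hR]
      refine setIntegral_congr_fun measurableSet_Ioi fun r hr => ?_
      rw [← Finset.sum_mul, ← add_mul, ← cschHalf_expansion hr n]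
    have hfin : ∑ k ∈ Finset.range n, 2 * ω / (ω ^ 2 + (k + 1 / 2) ^ 2) =
        2 * ∑ k ∈ Finset.range n, ω / (ω ^ 2 + (k + 1 / 2) ^ 2) := by
      rw [Finset.mul_sum]
      exact Finset.sum_congr rfl fun k _ => by ring
    rw [h1, hsplit, hfin, mul_add, sub_add_cancel_left, norm_neg, norm_mul, Real.norm_two,
      mul_assoc]
    gcongr
    refine (norm_integral_le_of_norm_le (hi.const_mul |ω|)
      ((ae_restrict_iff' measurableSet_Ioi).2 (Eventually.of_forall hbound))).trans_eq ?_
    rw [integral_const_mul, hv]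
    simp
  · simpa using tendsto_one_div_atTop_nhds_zero_nat.const_mul (2 * |ω|)

lemma diagonal_multiplier (ω : ℝ) :
    1 / 2 + 1 / (2 * Real.pi) * cschTransform ω = 1 / (1 + Real.exp (-(2 * Real.pi * ω))) := by
  have hpi := Real.pi_pos
  rw [cschTransform_eq, Real.tanh_eq_sinh_div_cosh, Real.sinh_eq, Real.cosh_eq]
  have e1 : Real.exp (-(2 * Real.pi * ω)) * Real.exp (Real.pi * ω) = Real.exp (-(Real.pi * ω)) := by
    rw [← Real.exp_add]; ring_nf
  rw [← e1]
  have := Real.exp_pos (Real.pi * ω)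
  have := Real.exp_pos (-(2 * Real.pi * ω))
  field_simp
  ring

end tanh

section sech

lemma sigmoid_eq (r : ℝ) : Real.sigmoid r = Real.exp (r / 2) * sechHalf r := by
  have h1 : Real.exp r = Real.exp (r / 2) * Real.exp (r / 2) := by rw [← Real.exp_add]; ring_nf
  rw [Real.sigmoid_def, sechHalf_eq, Real.exp_neg, ← mul_div_assoc, ← h1]
  have := Real.exp_pos r
  field_simp
  ring

/-- The substitution t = `Real.sigmoid r` gives the Beta integral at 1/2 + iω and 1/2 - iω,
evaluated by the reflection formula for Γ. -/
lemma integral_exp_mul_sechHalf (ω : ℝ) :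
    ∫ r : ℝ, Complex.exp ((ω * r : ℝ) * Complex.I) * sechHalf r =
      ((Real.pi / Real.cosh (Real.pi * ω) : ℝ) : ℂ) := by
  let u : ℂ := 1 / 2 + ω * Complex.I
  let v : ℂ := 1 / 2 - ω * Complex.I
  have h1 : Complex.Gamma u * Complex.Gamma v = Complex.betaIntegral u v := by
    rw [Complex.Gamma_mul_Gamma_eq_betaIntegral (by simp [u]) (by simp [v])]
    have : u + v = 1 := by simp only [u, v]; ring
    rw [this, Complex.Gamma_one, one_mul]
  have h2 : Complex.Gamma u * Complex.Gamma v =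
      ((Real.pi / Real.cosh (Real.pi * ω) : ℝ) : ℂ) := by
    have hv : v = 1 - u := by simp only [u, v]; ring
    have e1 : (Real.pi : ℂ) * u = (Real.pi * ω : ℝ) * Complex.I + Real.pi / 2 := by
      simp only [u]; push_cast; ring
    rw [hv, Complex.Gamma_mul_Gamma_one_sub, e1, Complex.sin_add_pi_div_two, Complex.cos_mul_I]
    push_cast; rfl
  rw [← h2, h1, Complex.betaIntegral, intervalIntegral.integral_of_le zero_le_one,
    integral_Ioc_eq_integral_Ioo, ← Real.range_sigmoid, ← image_univ,
    integral_image_eq_integral_abs_deriv_smul MeasurableSet.univ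
    (fun s _ => (Real.hasDerivAt_sigmoid s).hasDerivWithinAt) Real.sigmoid_injective.injOn,
    Measure.restrict_univ]
  congr 1 with r
  have p1 := Real.sigmoid_pos r
  have p2 : 0 < 1 - Real.sigmoid r := by linarith [Real.sigmoid_lt_one r]
  have hs := sechHalf_pos r
  have q2 : 1 - Real.sigmoid r = Real.exp (-(r / 2)) * sechHalf r := by
    rw [← Real.sigmoid_neg, sigmoid_eq, neg_div]
    congr 1
    rw [sechHalf_neg]
  have l1 : Real.log (Real.sigmoid r) = r / 2 + Real.log (sechHalf r) := by
    rw [sigmoid_eq, Real.log_mul (Real.exp_ne_zero _) hs.ne', Real.log_exp]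
  have l2 : Real.log (1 - Real.sigmoid r) = -(r / 2) + Real.log (sechHalf r) := by
    rw [q2, Real.log_mul (Real.exp_ne_zero _) hs.ne', Real.log_exp]
  have l3 : |Real.sigmoid r * (1 - Real.sigmoid r)| = Real.exp (2 * Real.log (sechHalf r)) := by
    rw [abs_of_pos (mul_pos p1 p2), sigmoid_eq, two_mul, Real.exp_add, Real.exp_log hs,
      ← sigmoid_eq, q2, sigmoid_eq]
    have : Real.exp (r / 2) * Real.exp (-(r / 2)) = 1 := by rw [← Real.exp_add]; simp
    linear_combination sechHalf r ^ 2 * this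
  have l4 : ((sechHalf r : ℝ) : ℂ) = Complex.exp (Real.log (sechHalf r)) := by
    rw [← Complex.ofReal_exp, Real.exp_log hs]
  rw [l3, ← Complex.ofReal_one, ← Complex.ofReal_sub,
    Complex.cpow_def_of_ne_zero (by exact_mod_cast p1.ne'),
    Complex.cpow_def_of_ne_zero (by exact_mod_cast p2.ne'), ← Complex.ofReal_log p1.le,
    ← Complex.ofReal_log p2.le, l1, l2, l4, Complex.real_smul, Complex.ofReal_exp,
    ← Complex.exp_add, ← Complex.exp_add, ← Complex.exp_add]
  congr 1
  simp only [u, v]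
  push_cast
  ring

lemma integrable_exp_mul_sechHalf (ω : ℝ) :
    Integrable (fun r : ℝ => Complex.exp ((ω * r : ℝ) * Complex.I) * sechHalf r) :=
  integrable_sechHalf.ofReal.bdd_mul (c := 1) (Continuous.aestronglyMeasurable (by fun_prop))
    (Eventually.of_forall fun _ => (Complex.norm_exp_ofReal_mul_I _).le)

/-- The sine transform `∫₀^∞ sin(ωr) / (2 cosh (r/2)) dr`. -/
noncomputable def sechSine (ω : ℝ) : ℝ := ∫ r in Ioi (0 : ℝ), sechHalf r * Real.sin (ω * r)

lemma sechTransform_im (ω : ℝ) : (sechTransform ω).im = sechSine ω := by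
  have h := integral_im ((integrable_exp_mul_sechHalf ω).integrableOn (s := Ici (0 : ℝ)))
  simp only [RCLike.im_to_complex] at h
  rw [sechTransform, ← h, integral_Ici_eq_integral_Ioi, sechSine]
  congr 1 with r
  rw [Complex.im_mul_ofReal, Complex.exp_ofReal_mul_I_im, mul_comm]

lemma sechTransform_re (ω : ℝ) : (sechTransform ω).re = Real.pi / (2 * Real.cosh (Real.pi * ω)) := by
  have h := integral_re ((integrable_exp_mul_sechHalf ω).integrableOn (s := Ici (0 : ℝ)))
  have h' := integral_re (integrable_exp_mul_sechHalf ω)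
  simp only [RCLike.re_to_complex, Complex.re_mul_ofReal, Complex.exp_ofReal_mul_I_re] at h h'
  have hv : ∀ r, Real.cos (ω * |r|) * sechHalf |r| = Real.cos (ω * r) * sechHalf r := by
    intro r
    rcases abs_choice r with h | h <;> rw [h]
    rw [sechHalf_neg, mul_neg, Real.cos_neg]
  have h2 := integral_comp_abs (f := fun r => Real.cos (ω * r) * sechHalf r)
  simp only [hv] at h2
  rw [h', integral_exp_mul_sechHalf, Complex.ofReal_re] at h2
  rw [sechTransform, ← h, integral_Ici_eq_integral_Ioi]
  have := Real.cosh_pos (Real.pi * ω)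
  rw [eq_div_iff (by positivity)]
  rw [div_eq_iff this.ne'] at h2
  linarith

/-- The real part is half of a full-line integral, hence explicit; only the imaginary part, the sine
transform, needs numerical estimates. -/
lemma norm_sechTransform_sq (ω : ℝ) : ‖sechTransform ω‖ ^ 2 =
    Real.pi ^ 2 * (Real.exp (-(2 * Real.pi * ω)) / (1 + Real.exp (-(2 * Real.pi * ω))) ^ 2) +
      sechSine ω ^ 2 := by
  rw [← Complex.normSq_eq_norm_sq, Complex.normSq_apply, sechTransform_re, sechTransform_im,
    Real.cosh_eq]
  have e1 : Real.exp (-(2 * Real.pi * ω)) * Real.exp (Real.pi * ω) = Real.exp (-(Real.pi * ω)) := by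
    rw [← Real.exp_add]; ring_nf
  have e2 : Real.exp (-(2 * Real.pi * ω)) * Real.exp (Real.pi * ω) ^ 2 = 1 := by
    rw [sq, ← mul_assoc, e1, ← Real.exp_add]; simp
  have h1 := Real.exp_pos (Real.pi * ω)
  have h2 := Real.exp_pos (-(2 * Real.pi * ω))
  rw [← e1]
  generalize Real.exp (-(2 * Real.pi * ω)) = a at *
  generalize Real.exp (Real.pi * ω) = b at *
  field_simp
  linear_combination (-Real.pi ^ 2) * e2

lemma norm_sechTransform_le (ω : ℝ) : ‖sechTransform ω‖ ≤ Real.pi / 2 := by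
  rw [← integral_sechHalf, ← integral_Ici_eq_integral_Ioi, sechTransform]
  refine (norm_integral_le_integral_norm _).trans_eq ?_
  congr 1 with r
  rw [norm_mul, Complex.norm_exp_ofReal_mul_I, one_mul, Complex.norm_real,
    Real.norm_of_nonneg (sechHalf_pos r).le]

end sech

/-! ### The sine transform as an alternating series -/

section sineSeries

/-- The Laplace transform `∫₀^∞ exp(-ar) sin(ωr) dr = ω / (ω² + a²)`. -/
noncomputable def laplaceSine (a ω : ℝ) : ℝ := ω / (ω ^ 2 + a ^ 2)

/-- The partial sums of the alternating series of the sine transform of `1 / (2 cosh (r/2))`. -/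
noncomputable def sineSum (n : ℕ) (ω : ℝ) : ℝ :=
  ∑ k ∈ Finset.range n, (-1) ^ k * laplaceSine (k + 1 / 2) ω

lemma sechHalf_expansion (r : ℝ) (n : ℕ) : sechHalf r =
    ∑ k ∈ Finset.range n, (-1) ^ k * Real.exp (-(k + 1 / 2) * r) +
      (-1) ^ n * (Real.exp (-n * r) * sechHalf r) := by
  induction n with
  | zero => simp
  | succ n ih =>
    have key : (1 + Real.exp (-r)) * sechHalf r = Real.exp (-r / 2) := by
      have := Real.cosh_pos (r / 2)
      rw [sechHalf, mul_one_div, div_eq_iff (by positivity), Real.cosh_eq]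
      have e1 : Real.exp (-r / 2) * Real.exp (r / 2) = 1 := by rw [← Real.exp_add]; ring_nf; simp
      have e2 : Real.exp (-r / 2) * Real.exp (-(r / 2)) = Real.exp (-r) := by
        rw [← Real.exp_add]; ring_nf
      linear_combination -e2 - e1
    rw [Finset.sum_range_succ, add_assoc]
    convert ih using 2
    have e3 : Real.exp (-(n + 1 / 2) * r) = Real.exp (-n * r) * Real.exp (-r / 2) := by
      rw [← Real.exp_add]; ring_nf
    have e4 : Real.exp (-((n + 1 : ℕ) : ℝ) * r) = Real.exp (-n * r) * Real.exp (-r) := by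
      rw [← Real.exp_add]; push_cast; ring_nf
    rw [e3, e4, pow_succ]
    linear_combination (-(-1) ^ n * Real.exp (-n * r)) * key

/-- From cosh x ≤ exp(x²/2) and exp(-y) ≥ 1 - y. It measures the error of replacing `sechHalf` by
its value 1/2 at the origin in the remainder of the series. -/
lemma half_sub_sechHalf (r : ℝ) : 0 ≤ 1 / 2 - sechHalf r ∧ 1 / 2 - sechHalf r ≤ r ^ 2 / 16 := by
  have h1 := Real.one_le_cosh (r / 2)
  constructor
  · rw [sechHalf, sub_nonneg]
    gcongr
    linarith
  · have h2 := Real.cosh_le_exp_half_sq (r / 2)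
    have h3 := Real.add_one_le_exp (-((r / 2) ^ 2 / 2))
    have h4 : Real.exp (-((r / 2) ^ 2 / 2)) ≤ 1 / Real.cosh (r / 2) := by
      rw [Real.exp_neg, ← one_div]
      gcongr
    have h5 : sechHalf r = 1 / 2 * (1 / Real.cosh (r / 2)) := by rw [sechHalf]; field_simp
    rw [h5]
    linarith

/-- The remainder carries the weight exp(-nr), so `sechHalf` there is nearly 1/2; this yields the
half term. The error is at most (ω/16)∫ r³ exp(-nr) dr, and the integral equals 6/n⁴. -/
lemma abs_sechSine_sub_le {n : ℕ} (hn : 0 < n) (he : Even n) {ω : ℝ} (hω : 0 ≤ ω) :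
    |sechSine ω - (sineSum n ω + 1 / 2 * laplaceSine n ω)| ≤ 3 / 8 * ω / n ^ 4 := by
  have hn' : (0 : ℝ) < n := by exact_mod_cast hn
  have e1 : ∀ k : ℕ, (0 : ℝ) < k + 1 / 2 := fun k => by positivity
  obtain ⟨hi, hv⟩ := integral_mul_exp hn' 3
  have hbound : ∀ r ∈ Ioi (0 : ℝ),
      ‖Real.exp (-n * r) * (1 / 2 - sechHalf r) * Real.sin (ω * r)‖ ≤
      ω / 16 * (r ^ 3 * Real.exp (-n * r)) := by
    intro r hr
    have hr' : (0 : ℝ) < r := hr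
    obtain ⟨h1, h2⟩ := half_sub_sechHalf r
    have h3 : |Real.sin (ω * r)| ≤ ω * r := by
      refine Real.abs_sin_le_abs.trans_eq ?_
      rw [abs_mul, abs_of_pos hr', abs_of_nonneg hω]
    rw [Real.norm_eq_abs, abs_mul, abs_mul, abs_of_pos (Real.exp_pos _), abs_of_nonneg h1]
    calc _ ≤ Real.exp (-n * r) * (r ^ 2 / 16) * (ω * r) := by gcongr
      _ = _ := by ring
  have hR : IntegrableOn (fun r => Real.exp (-n * r) * (1 / 2 - sechHalf r) * Real.sin (ω * r))
      (Ioi 0) := by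
    refine (hi.const_mul (ω / 16)).mono' (Continuous.aestronglyMeasurable ?_)
      ((ae_restrict_iff' measurableSet_Ioi).2 (Eventually.of_forall hbound))
    have := continuous_sechHalf
    fun_prop
  have hS : ∀ k : ℕ, IntegrableOn
      (fun r => (-1) ^ k * (Real.exp (-(k + 1 / 2) * r) * Real.sin (ω * r))) (Ioi 0) :=
    fun k => (integrableOn_exp_mul_sin (e1 k) ω).const_mul _
  have hH : IntegrableOn (fun r => 1 / 2 * (Real.exp (-n * r) * Real.sin (ω * r))) (Ioi 0) :=
    (integrableOn_exp_mul_sin hn' ω).const_mul _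
  have hsplit : sechSine ω = sineSum n ω + 1 / 2 * laplaceSine n ω -
      ∫ r in Ioi (0 : ℝ), Real.exp (-n * r) * (1 / 2 - sechHalf r) * Real.sin (ω * r) := by
    have s1 : sineSum n ω = ∫ r in Ioi (0 : ℝ), ∑ k ∈ Finset.range n,
        (-1) ^ k * (Real.exp (-(k + 1 / 2) * r) * Real.sin (ω * r)) := by
      rw [integral_finsetSum _ fun k _ => hS k, sineSum]
      refine Finset.sum_congr rfl fun k _ => ?_
      rw [integral_const_mul, integral_exp_mul_sin (e1 k), laplaceSine]
    have s2 : 1 / 2 * laplaceSine n ω =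
        ∫ r in Ioi (0 : ℝ), 1 / 2 * (Real.exp (-n * r) * Real.sin (ω * r)) := by
      rw [integral_const_mul, integral_exp_mul_sin hn', laplaceSine]
    have hadd : IntegrableOn (fun r => ∑ k ∈ Finset.range n,
        (-1) ^ k * (Real.exp (-(k + 1 / 2) * r) * Real.sin (ω * r)) +
          1 / 2 * (Real.exp (-n * r) * Real.sin (ω * r))) (Ioi 0) :=
      (integrable_finsetSum _ fun k _ => hS k).add hH
    rw [s1, s2, ← integral_add (integrable_finsetSum _ fun k _ => hS k) hH,
      ← integral_sub hadd hR, sechSine]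
    refine setIntegral_congr_fun measurableSet_Ioi fun r _ => ?_
    have h := sechHalf_expansion r n
    rw [he.neg_one_pow, one_mul] at h
    simp only [← mul_assoc]
    rw [← Finset.sum_mul]
    linear_combination Real.sin (ω * r) * h
  rw [hsplit, sub_sub_cancel_left, abs_neg]
  refine (norm_integral_le_of_norm_le (hi.const_mul (ω / 16))
    ((ae_restrict_iff' measurableSet_Ioi).2 (Eventually.of_forall hbound))).trans_eq ?_
  rw [integral_const_mul, hv]
  norm_num [Nat.factorial]
  ring

lemma laplaceSine_nonneg (a : ℝ) {ω : ℝ} (hω : 0 ≤ ω) : 0 ≤ laplaceSine a ω := by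
  unfold laplaceSine; positivity

lemma laplaceSine_anti {a b ω : ℝ} (ha : 0 < a) (hab : a ≤ b) (hω : 0 ≤ ω) :
    laplaceSine b ω ≤ laplaceSine a ω := by
  unfold laplaceSine; gcongr

lemma sineSum_bounds (m : ℕ) {ω : ℝ} (hω : 0 ≤ ω) :
    0 ≤ sineSum (2 * m) ω ∧
      sineSum (2 * m) ω + laplaceSine (2 * m + 1 / 2) ω ≤ laplaceSine (1 / 2) ω := by
  induction m with
  | zero => simp [sineSum]
  | succ m ih =>
    have h : sineSum (2 * (m + 1)) ω = sineSum (2 * m) ω + laplaceSine (2 * m + 1 / 2) ω -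
        laplaceSine (2 * m + 1 + 1 / 2) ω := by
      rw [show 2 * (m + 1) = 2 * m + 1 + 1 by ring, sineSum, Finset.sum_range_succ,
        Finset.sum_range_succ, ← sineSum, (even_two_mul m).neg_one_pow,
        (even_two_mul m).add_one.neg_one_pow]
      push_cast; ring
    have h1 := laplaceSine_anti (a := 2 * m + 1 / 2) (b := 2 * m + 1 + 1 / 2) (by positivity)
      (by linarith) hω
    have h2 := laplaceSine_anti (a := 2 * m + 1 + 1 / 2) (b := 2 * ((m + 1 : ℕ) : ℝ) + 1 / 2)
      (by positivity) (by push_cast; linarith) hω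
    rw [h]
    constructor
    · linarith
    · linarith

lemma sechSine_bounds {ω : ℝ} (hω : 0 ≤ ω) :
    0 ≤ sechSine ω ∧ sechSine ω ≤ laplaceSine (1 / 2) ω := by
  have hT : Tendsto (fun m : ℕ => 3 / 8 * ω / ((2 * (m + 1) : ℕ) : ℝ) ^ 4) atTop (𝓝 0) := by
    have h1 : Tendsto (fun m : ℕ => ((2 * (m + 1) : ℕ) : ℝ) ^ 4) atTop atTop := by
      refine (tendsto_pow_atTop (by norm_num)).comp (tendsto_natCast_atTop_atTop.comp ?_)
      exact tendsto_atTop_mono (fun m => by simp only [id]; omega) tendsto_id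
    exact h1.const_div_atTop _
  have hT2 : Tendsto (fun m : ℕ => 1 / 2 * laplaceSine ((2 * (m + 1) : ℕ) : ℝ) ω) atTop (𝓝 0) := by
    have h1 : Tendsto (fun m : ℕ => ω ^ 2 + ((2 * (m + 1) : ℕ) : ℝ) ^ 2) atTop atTop := by
      refine tendsto_atTop_add_const_left _ _ ((tendsto_pow_atTop (by norm_num)).comp
        (tendsto_natCast_atTop_atTop.comp ?_))
      exact tendsto_atTop_mono (fun m => by simp only [id]; omega) tendsto_id
    simpa only [laplaceSine, mul_zero] using (h1.const_div_atTop ω).const_mul (1 / 2)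
  have key : ∀ m : ℕ, |sechSine ω - (sineSum (2 * (m + 1)) ω +
      1 / 2 * laplaceSine ((2 * (m + 1) : ℕ) : ℝ) ω)| ≤ 3 / 8 * ω / ((2 * (m + 1) : ℕ) : ℝ) ^ 4 :=
    fun m => abs_sechSine_sub_le (by positivity) (even_two_mul _) hω
  constructor
  · refine ge_of_tendsto' (f := fun m : ℕ => sechSine ω + 3 / 8 * ω / ((2 * (m + 1) : ℕ) : ℝ) ^ 4)
      (by simpa using hT.const_add (sechSine ω)) fun m => ?_
    have h1 := (abs_le.1 (key m)).1
    have h2 := (sineSum_bounds (m + 1) hω).1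
    have h3 := laplaceSine_nonneg ((2 * (m + 1) : ℕ) : ℝ) hω
    linarith
  · refine le_of_tendsto' (f := fun m : ℕ => sechSine ω - 3 / 8 * ω / ((2 * (m + 1) : ℕ) : ℝ) ^ 4 -
      1 / 2 * laplaceSine ((2 * (m + 1) : ℕ) : ℝ) ω)
      (by simpa using (hT.const_sub (sechSine ω)).sub hT2) fun m => ?_
    have h1 := (abs_le.1 (key m)).2
    have h2 := (sineSum_bounds (m + 1) hω).2
    have h3 := laplaceSine_nonneg (2 * ((m + 1 : ℕ) : ℝ) + 1 / 2) hω
    linarith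

end sineSeries

/-! ### A parabola above the sine transform -/

section tangent

/-- The derivative of `laplaceSine a`. -/
noncomputable def laplaceSineDeriv (a w : ℝ) : ℝ := (a ^ 2 - w ^ 2) / (w ^ 2 + a ^ 2) ^ 2

/-- An exact second-order expansion with factored remainder, so that bounding the curvature is a
rational inequality. -/
lemma laplaceSine_tangent {a w ω : ℝ} (ha : 0 < a) :
    laplaceSine a ω = laplaceSine a w + laplaceSineDeriv a w * (ω - w) -
      ((a ^ 2 - w ^ 2) * ω + 2 * a ^ 2 * w) / ((ω ^ 2 + a ^ 2) * (w ^ 2 + a ^ 2) ^ 2) *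
        (ω - w) ^ 2 := by
  unfold laplaceSine laplaceSineDeriv
  field_simp
  ring

/-- Upper bounds for the second order terms of the alternating sine series. -/
noncomputable def sineCurvature (w : ℝ) (k : ℕ) : ℝ :=
  if k = 0 then 137 / 1000 else if k = 1 then 21 / 100 else
    34444 / 10000 / (w ^ 2 + (k + 1 / 2) ^ 2) ^ 2

lemma signed_laplaceSine_le {ω : ℝ} (h0 : 0 ≤ ω) (h1 : ω ≤ 17 / 10) (k : ℕ) :
    (-1) ^ k * laplaceSine (k + 1 / 2) ω ≤ (-1) ^ k * laplaceSine (k + 1 / 2) (4361 / 5000) +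
      (-1) ^ k * laplaceSineDeriv (k + 1 / 2) (4361 / 5000) * (ω - 4361 / 5000) +
      sineCurvature (4361 / 5000) k * (ω - 4361 / 5000) ^ 2 := by
  have ha : (0 : ℝ) < k + 1 / 2 := by positivity
  rw [laplaceSine_tangent (w := 4361 / 5000) ha]
  set w : ℝ := 4361 / 5000 with hw
  set a : ℝ := (k : ℝ) + 1 / 2 with hadef
  set T : ℝ := ((a ^ 2 - w ^ 2) * ω + 2 * a ^ 2 * w) / ((ω ^ 2 + a ^ 2) * (w ^ 2 + a ^ 2) ^ 2)
    with hT
  suffices -((-1) ^ k * T) ≤ sineCurvature w k by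
    nlinarith [mul_le_mul_of_nonneg_right this (sq_nonneg (ω - w))]
  have hpos : 0 < (ω ^ 2 + a ^ 2) * (w ^ 2 + a ^ 2) ^ 2 := by positivity
  rcases Nat.lt_or_ge k 2 with hk | hk
  · have hk' : k = 0 ∨ k = 1 := by omega
    rcases hk' with rfl | rfl
    · simp only [sineCurvature, if_true, pow_zero, one_mul]
      rw [hT, ← neg_div, div_le_iff₀ hpos, hadef, hw]
      push_cast
      -- The square is centred near the maximiser of the quotient being bounded; the same holds of
      -- 2/5 in the next case.
      nlinarith [sq_nonneg (ω - 1838 / 1000)]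
    · simp only [sineCurvature, if_true, pow_one, one_ne_zero, if_false]
      rw [neg_one_mul, neg_neg, hT, div_le_iff₀ hpos, hadef, hw]
      push_cast
      nlinarith [sq_nonneg (ω - 2 / 5)]
  · have hk2 : (2 : ℝ) ≤ k := by exact_mod_cast hk
    have hwa : w ^ 2 ≤ a ^ 2 := by
      rw [hw, hadef]; nlinarith
    have hC : sineCurvature w k = 34444 / 10000 / (w ^ 2 + a ^ 2) ^ 2 := by
      rw [sineCurvature, if_neg (by omega), if_neg (by omega)]
    have hw0 : 0 < w := by rw [hw]; norm_num
    have hT0 : 0 ≤ T := by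
      have : 0 ≤ a ^ 2 - w ^ 2 := by linarith
      rw [hT]; positivity
    have hT1 : T ≤ 34444 / 10000 / (w ^ 2 + a ^ 2) ^ 2 := by
      rw [hT, ← div_div]
      -- The constant 34444/10000 is 17/10 + 2w: the bound on ω plus twice the base point.
      refine div_le_div_of_nonneg_right ?_ (by positivity)
      rw [div_le_iff₀ (by positivity)]
      have e1 : (a ^ 2 - w ^ 2) * ω ≤ a ^ 2 * (17 / 10) := by
        have : 0 ≤ a ^ 2 - w ^ 2 := by linarith
        nlinarith [sq_nonneg w]
      have e2 : 2 * a ^ 2 * w = a ^ 2 * (17444 / 10000) := by rw [hw]; ring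
      nlinarith [sq_nonneg ω]
    rw [hC]
    rcases neg_one_pow_eq_or ℝ k with h | h <;> rw [h]
    · have : 0 ≤ 34444 / 10000 / (w ^ 2 + a ^ 2) ^ 2 := hT0.trans hT1
      linarith
    · linarith

lemma sineSum_tangent_value :
    (∑ k ∈ Finset.range 20, (-1) ^ k * laplaceSine (k + 1 / 2) (4361 / 5000)) +
      1 / 2 * laplaceSine 20 (4361 / 5000) ≤ 6556412847 / 10000000000 ∧
    6556412845 / 10000000000 ≤
      (∑ k ∈ Finset.range 20, (-1) ^ k * laplaceSine (k + 1 / 2) (4361 / 5000)) +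
      1 / 2 * laplaceSine 20 (4361 / 5000) := by
  constructor <;> norm_num [Finset.sum_range_succ, laplaceSine]

/-- The summand 3/8/20⁴ is the series error at n = 20; being linear in ω, it can be counted as part
of the slope. -/
lemma sineSum_tangent_slope :
    |(∑ k ∈ Finset.range 20, (-1) ^ k * laplaceSineDeriv (k + 1 / 2) (4361 / 5000)) +
      1 / 2 * laplaceSineDeriv 20 (4361 / 5000) + 3 / 8 / 20 ^ 4 + 594125 / 1000000| ≤
      1 / 10000000 := by
  rw [abs_le]
  constructor <;> norm_num [Finset.sum_range_succ, laplaceSineDeriv]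

lemma sineSum_tangent_curvature :
    ∑ k ∈ Finset.range 20, sineCurvature (4361 / 5000) k ≤ 46 / 100 := by
  norm_num [Finset.sum_range_succ, sineCurvature]

/-- Each signed term lies below its tangent at 4361/5000 plus a quadratic term. Summing 20 terms
reduces the claim to three rational evaluations: value, slope and curvature. -/
lemma sechSine_le_parabola {ω : ℝ} (h0 : 0 ≤ ω) (h1 : ω ≤ 17 / 10) :
    sechSine ω ≤ 6556435 / 10000000 - 594125 / 1000000 * (ω - 4361 / 5000) +
      46 / 100 * (ω - 4361 / 5000) ^ 2 := by
  have hA := (abs_le.1 (abs_sechSine_sub_le (n := 20) (by norm_num) (by decide) h0)).2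
  have hS : sineSum 20 ω ≤ _ := Finset.sum_le_sum fun k _ => signed_laplaceSine_le h0 h1 k
  rw [Finset.sum_add_distrib, Finset.sum_add_distrib, ← Finset.sum_mul, ← Finset.sum_mul] at hS
  have hV := sineSum_tangent_value.1
  have hD := sineSum_tangent_slope
  have hC := mul_le_mul_of_nonneg_right sineSum_tangent_curvature (sq_nonneg (ω - 4361 / 5000))
  have hL : laplaceSine 20 ω ≤ laplaceSine 20 (4361 / 5000) +
      laplaceSineDeriv 20 (4361 / 5000) * (ω - 4361 / 5000) := by
    rw [laplaceSine_tangent (w := 4361 / 5000) (by norm_num : (0 : ℝ) < 20)]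
    have : 0 ≤ (((20 : ℝ) ^ 2 - (4361 / 5000) ^ 2) * ω + 2 * 20 ^ 2 * (4361 / 5000)) /
        ((ω ^ 2 + 20 ^ 2) * ((4361 / 5000) ^ 2 + 20 ^ 2) ^ 2) * (ω - 4361 / 5000) ^ 2 := by
      have : 0 ≤ (20 : ℝ) ^ 2 - (4361 / 5000) ^ 2 := by norm_num
      positivity
    linarith
  set s0 := ∑ k ∈ Finset.range 20, (-1) ^ k * laplaceSine ((k : ℝ) + 1 / 2) (4361 / 5000)
  set s1 := ∑ k ∈ Finset.range 20, (-1) ^ k * laplaceSineDeriv ((k : ℝ) + 1 / 2) (4361 / 5000)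
  set s2 := ∑ k ∈ Finset.range 20, sineCurvature (4361 / 5000) k
  push_cast at hA
  set d := ω - 4361 / 5000 with hd
  have hd1 : |d| ≤ 9 / 10 := by rw [abs_le, hd]; constructor <;> linarith
  have hslope := (le_abs_self _).trans ((abs_mul _ d).le.trans
    (mul_le_mul hD hd1 (abs_nonneg _) (by norm_num)))
  have hω : ω = 4361 / 5000 + d := by rw [hd]; ring
  linarith

end tangent

/-! ### Rational bounds for exponentials and π -/

section expBounds

/-- The product of the cubic with exp(-y) has derivative -(y³/6) exp(-y), hence its maximum at 0.
Both signs of y are needed. -/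
lemma cubic_le_exp (y : ℝ) : 1 + y + y ^ 2 / 2 + y ^ 3 / 6 ≤ Real.exp y := by
  let g : ℝ → ℝ := fun y => (1 + y + y ^ 2 / 2 + y ^ 3 / 6) * Real.exp (-y)
  have hg : ∀ y, HasDerivAt g (-(y ^ 3 / 6) * Real.exp (-y)) y := by
    intro y
    have h1 : HasDerivAt (fun y : ℝ => 1 + y + y ^ 2 / 2 + y ^ 3 / 6) (1 + y + y ^ 2 / 2) y := by
      have := ((((hasDerivAt_id y).const_add 1).add ((hasDerivAt_pow 2 y).div_const 2)).add
        ((hasDerivAt_pow 3 y).div_const 6))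
      refine this.congr_deriv ?_
      push_cast; ring
    refine (h1.mul (hasDerivAt_id y).neg.exp).congr_deriv ?_
    simp only [Pi.neg_apply, id]
    ring
  have hd : ∀ y, deriv g y = -(y ^ 3 / 6) * Real.exp (-y) := fun y => (hg y).deriv
  have hc : Continuous g := by fun_prop
  have key : g y ≤ g 0 := by
    rcases le_total 0 y with h | h
    · refine antitoneOn_of_deriv_nonpos (convex_Ici 0) hc.continuousOn
        (fun x _ => (hg x).differentiableAt.differentiableWithinAt) (fun x hx => ?_)
        self_mem_Ici h h
      rw [interior_Ici] at hx
      have hx' : 0 < x := hx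
      have := Real.exp_pos (-x)
      rw [hd, neg_mul, neg_nonpos]; positivity
    · refine monotoneOn_of_deriv_nonneg (convex_Iic 0) hc.continuousOn
        (fun x _ => (hg x).differentiableAt.differentiableWithinAt) (fun x hx => ?_)
        h self_mem_Iic h
      rw [interior_Iic] at hx
      have hx' : x < 0 := hx
      have h3 : 0 < (-x) ^ 3 := by have : 0 < -x := by linarith
                                   positivity
      have h4 : -(x ^ 3 / 6) = (-x) ^ 3 / 6 := by ring
      rw [hd, h4]; positivity
  simp only [g, neg_zero, Real.exp_zero] at key
  rw [Real.exp_neg, ← div_eq_mul_inv, div_le_iff₀ (Real.exp_pos y)] at key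
  linarith

/-- The exponents here and in `exp_lower` bracket 2π · 4361/5000. Five factors e are split off, and
a Taylor sum handles the rest. -/
lemma exp_upper : Real.exp (54801955 / 10000000) ≤ 10000000 / 41685 := by
  have h1 : Real.exp (54801955 / 10000000) = Real.exp 1 ^ 5 * Real.exp (4801955 / 10000000) := by
    rw [← Real.exp_nat_mul, ← Real.exp_add]; norm_num
  have h2 := Real.exp_bound' (x := 4801955 / 10000000) (by norm_num) (by norm_num) (n := 9)
    (by norm_num)
  have h3 := Real.exp_one_lt_d9.le
  have h4 : Real.exp 1 ^ 5 ≤ 2.7182818286 ^ 5 := by gcongr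
  rw [h1]
  refine (mul_le_mul h4 h2 (Real.exp_pos _).le (by norm_num)).trans ?_
  norm_num [Finset.sum_range_succ, Nat.factorial]

lemma exp_lower : 100000000 / 416853 ≤ Real.exp (54801941 / 10000000) := by
  have h1 : Real.exp (54801941 / 10000000) = Real.exp 1 ^ 5 * Real.exp (4801941 / 10000000) := by
    rw [← Real.exp_nat_mul, ← Real.exp_add]; norm_num
  have h2 := Real.sum_le_exp_of_nonneg (x := 4801941 / 10000000) (by norm_num) 9
  have h3 := Real.exp_one_gt_d9.le
  have h4 : 2.7182818283 ^ 5 ≤ Real.exp 1 ^ 5 := by gcongr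
  rw [h1]
  refine le_trans ?_ (mul_le_mul h4 h2 (by positivity) (by positivity))
  norm_num [Finset.sum_range_succ, Nat.factorial]

lemma exp_neg_two_pi_mul_lower {ω : ℝ} (h1 : ω ≤ 11 / 10) :
    41685 / 10000000 * Real.exp (-(628318 / 100000 * (ω - 4361 / 5000))) ≤
      Real.exp (-(2 * Real.pi * ω)) := by
  have e : Real.exp (-(2 * Real.pi * ω)) = Real.exp (-(628318 / 100000 * (4361 / 5000) +
      (2 * Real.pi - 628318 / 100000) * ω)) *
      Real.exp (-(628318 / 100000 * (ω - 4361 / 5000))) := by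
    rw [← Real.exp_add]; ring_nf
  rw [e]
  refine mul_le_mul_of_nonneg_right ?_ (Real.exp_pos _).le
  have hpi1 := Real.pi_gt_d20
  have hpi2 := Real.pi_lt_d20
  -- Replacing 2π by 6.28318 away from the base point leaves a small multiple of ω, largest at ω =
  -- 11/10.
  have h2 : 628318 / 100000 * (4361 / 5000) + (2 * Real.pi - 628318 / 100000) * ω ≤
      54801955 / 10000000 := by
    have : (2 * Real.pi - 628318 / 100000) * ω ≤ (2 * Real.pi - 628318 / 100000) * (11 / 10) :=
      mul_le_mul_of_nonneg_left h1 (by linarith)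
    linarith
  have h3 := (Real.exp_le_exp.2 h2).trans exp_upper
  rw [Real.exp_neg]
  have := inv_anti₀ (Real.exp_pos _) h3
  refine le_trans ?_ this
  norm_num

lemma exp_neg_two_pi_mul_upper :
    Real.exp (-(2 * Real.pi * (4361 / 5000))) ≤ 416853 / 100000000 := by
  have hpi1 := Real.pi_gt_d20
  have h2 : 54801941 / 10000000 ≤ 2 * Real.pi * (4361 / 5000) := by linarith
  have h3 := exp_lower.trans (Real.exp_le_exp.2 h2)
  rw [Real.exp_neg]
  refine (inv_anti₀ (by norm_num) h3).trans_eq ?_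
  norm_num

lemma inv_four_pi_sq_bounds :
    253302 / 10000000 ≤ 1 / (4 * Real.pi ^ 2) ∧ 1 / (4 * Real.pi ^ 2) ≤ 253303 / 10000000 := by
  have hpi1 := Real.pi_gt_d20
  have hpi2 := Real.pi_lt_d20
  have hpi := Real.pi_pos
  constructor
  · rw [le_div_iff₀ (by positivity)]
    nlinarith
  · rw [div_le_iff₀ (by positivity)]
    nlinarith

end expBounds

/-! ### The larger eigenvalue of the matrix multiplier -/

section multiplier

/-- Alternating truncations of the power series in e; the cubic and quartic terms left over have a
nonnegative sum because e ≤ 1/4 and l ≥ 1. -/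
lemma diagonal_gap_lower {e : ℝ} (h0 : 0 ≤ e) (h1 : e ≤ 1 / 4) {l : ℝ}
    (hl : l = 10076805 / 10000000) :
    l ^ 2 - l + (l - 1 / 4) * e - (l - 1 / 2) * e ^ 2 ≤
      l * (l - 1 / (1 + e)) - 1 / 4 * (e / (1 + e) ^ 2) := by
  have e1 : 1 / (1 + e) ≤ 1 - e + e ^ 2 - e ^ 3 + e ^ 4 := by
    rw [div_le_iff₀ (by positivity)]
    have : 0 ≤ e ^ 5 := by positivity
    linarith
  have e2 : e / (1 + e) ^ 2 ≤ e - 2 * e ^ 2 + 3 * e ^ 3 := by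
    rw [div_le_iff₀ (by positivity)]
    have : 0 ≤ 4 * e ^ 4 + 3 * e ^ 5 := by positivity
    linarith
  have e3 : 0 ≤ e ^ 3 * (1 / 4 - e) := mul_nonneg (by positivity) (by linarith)
  have e4 : 0 ≤ e ^ 3 := by positivity
  have e5 := mul_le_mul_of_nonneg_left e1 (show 0 ≤ l by rw [hl]; norm_num)
  subst hl
  linarith

/-- Here d = ω - 4361/5000 runs over the range given by 45/100 ≤ ω ≤ 11/10. The inequality is a
nonnegative combination of the products listed; the squares of 1 ± 100d absorb a small linear term
of either sign. -/
lemma multiplier_polynomial_nonneg {d : ℝ} (h0 : -(4222 / 10000) ≤ d) (h1 : d ≤ 2278 / 10000)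
    {l E U : ℝ} (hl : l = 10076805 / 10000000)
    (hE : E = 41685 / 10000000 * (1 + -(628318 / 100000 * d) + (-(628318 / 100000 * d)) ^ 2 / 2 +
      (-(628318 / 100000 * d)) ^ 3 / 6))
    (hU : U = 6556435 / 10000000 - 594125 / 1000000 * d + 46 / 100 * d ^ 2) :
    253303 / 10000000 * U ^ 2 ≤ l ^ 2 - l + (l - 1 / 4) * E - (l - 1 / 2) * E ^ 2 := by
  have f1 : 0 ≤ d ^ 2 := by positivity
  have f2 : 0 ≤ d ^ 2 * (2278 / 10000 - d) := mul_nonneg f1 (by linarith)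
  have f3 : 0 ≤ d ^ 2 * ((d + 4222 / 10000) * (2278 / 10000 - d)) :=
    mul_nonneg f1 (mul_nonneg (by linarith) (by linarith))
  have f4 : 0 ≤ d ^ 4 * (d + 4222 / 10000) := mul_nonneg (by positivity) (by linarith)
  have f5 : 0 ≤ d ^ 4 * ((4222 / 10000) ^ 2 - d ^ 2) :=
    mul_nonneg (by positivity) (by nlinarith)
  have f6 : 0 ≤ (1 + 100 * d) ^ 2 := by positivity
  have f7 : 0 ≤ (1 - 100 * d) ^ 2 := by positivity
  subst hl hE hU
  linarith

lemma laplaceSine_half_le {ω : ℝ} (h : 17 / 10 ≤ ω) : laplaceSine (1 / 2) ω ≤ 5527 / 10000 := by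
  rw [laplaceSine, div_le_iff₀ (by positivity)]
  nlinarith

/-- The determinant condition bounding the `2 × 2` matrix multiplier of the quarter plane. -/
lemma multiplier_le {l : ℝ} (hl : l = 10076805 / 10000000) (ω : ℝ) :
    1 / (4 * Real.pi ^ 2) * ‖sechTransform ω‖ ^ 2 ≤
      l * (l - 1 / (1 + Real.exp (-(2 * Real.pi * ω)))) := by
  have hpi := Real.pi_pos
  set e := Real.exp (-(2 * Real.pi * ω)) with he
  have he0 : 0 < e := Real.exp_pos _
  have hpi1 := Real.pi_gt_d20
  have hpi2 := Real.pi_lt_d20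
  -- For ω ≤ 0.45 the crude bound |q|² ≤ 1/16 suffices, since p stays below 1000/1058. Beyond that,
  -- the parabola is used up to 1.1, and a constant bound on the sine transform afterwards.
  rcases le_total ω (45 / 100) with h | h
  · have h1 : 1 / (4 * Real.pi ^ 2) * ‖sechTransform ω‖ ^ 2 ≤ 1 / 16 := by
      have := pow_le_pow_left₀ (norm_nonneg _) (norm_sechTransform_le ω) 2
      calc _ ≤ 1 / (4 * Real.pi ^ 2) * (Real.pi / 2) ^ 2 := by gcongr
        _ = _ := by field_simp; norm_num
    have h2 : 58 / 1000 ≤ e := by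
      have e1 : Real.exp (2 * Real.pi * ω) ≤ Real.exp (283 / 100) := by
        apply Real.exp_le_exp.2
        have : 2 * Real.pi * ω ≤ 2 * Real.pi * (45 / 100) := by gcongr
        linarith
      have e2 : Real.exp (283 / 100) = Real.exp 1 ^ 3 * Real.exp (-(17 / 100)) := by
        rw [← Real.exp_nat_mul, ← Real.exp_add]; norm_num
      have e3 : Real.exp (-(17 / 100)) ≤ 100 / 117 := by
        rw [Real.exp_neg, show (100 / 117 : ℝ) = (117 / 100)⁻¹ by norm_num]
        refine inv_anti₀ (by norm_num) ?_
        have := Real.add_one_le_exp (17 / 100)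
        linarith
      have e4 : Real.exp 1 ^ 3 ≤ 2.7182818286 ^ 3 := by
        have := Real.exp_one_lt_d9.le
        gcongr
      have e5 : Real.exp (2 * Real.pi * ω) ≤ 1000 / 58 := by
        rw [e2] at e1
        refine e1.trans ((mul_le_mul e4 e3 (Real.exp_pos _).le (by norm_num)).trans ?_)
        norm_num
      rw [he, Real.exp_neg]
      refine le_trans ?_ (inv_anti₀ (Real.exp_pos _) e5)
      norm_num
    have h3 : 1 / (1 + e) ≤ 1000 / 1058 := by
      rw [div_le_div_iff₀ (by positivity) (by norm_num)]
      linarith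
    refine h1.trans ?_
    rw [hl]
    linarith
  have hω : 0 ≤ ω := by linarith
  have he4 : e ≤ 1 / 4 := by
    have e1 : Real.exp (282 / 100) ≤ Real.exp (2 * Real.pi * ω) := by
      apply Real.exp_le_exp.2
      have : 2 * Real.pi * (45 / 100) ≤ 2 * Real.pi * ω := by gcongr
      linarith
    have e2 := cubic_le_exp (282 / 100)
    rw [he, Real.exp_neg, show (1 / 4 : ℝ) = 4⁻¹ by norm_num]
    refine inv_anti₀ (by norm_num) ?_
    linarith
  have hgap := diagonal_gap_lower he0.le he4 hl
  obtain ⟨hG0, hG1⟩ := sechSine_bounds hω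
  have hsplit : 1 / (4 * Real.pi ^ 2) * ‖sechTransform ω‖ ^ 2 =
      1 / 4 * (e / (1 + e) ^ 2) + 1 / (4 * Real.pi ^ 2) * sechSine ω ^ 2 := by
    rw [norm_sechTransform_sq, ← he]
    field_simp
  have hk := inv_four_pi_sq_bounds.2
  have hG : ∀ B : ℝ, sechSine ω ≤ B →
      1 / (4 * Real.pi ^ 2) * sechSine ω ^ 2 ≤ 253303 / 10000000 * B ^ 2 := fun B hB => by
    gcongr
  rw [hsplit]
  rcases le_total ω (11 / 10) with h' | h'
  · have hp := hG _ (sechSine_le_parabola hω (by linarith))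
    have hlow := exp_neg_two_pi_mul_lower h'
    rw [← he] at hlow
    have hcub := cubic_le_exp (-(628318 / 100000 * (ω - 4361 / 5000)))
    have hE := (mul_le_mul_of_nonneg_left hcub (by norm_num : (0 : ℝ) ≤ 41685 / 10000000)).trans
      hlow
    have hpol := multiplier_polynomial_nonneg (d := ω - 4361 / 5000) (by linarith) (by linarith)
      hl rfl rfl
    set E := 41685 / 10000000 * (1 + -(628318 / 100000 * (ω - 4361 / 5000)) +
      (-(628318 / 100000 * (ω - 4361 / 5000))) ^ 2 / 2 +
      (-(628318 / 100000 * (ω - 4361 / 5000))) ^ 3 / 6)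
    -- The quadratic in e is increasing in the relevant range, so e may be replaced by its
    -- polynomial lower bound E.
    have hmono : (l - 1 / 4) * E - (l - 1 / 2) * E ^ 2 ≤
        (l - 1 / 4) * e - (l - 1 / 2) * e ^ 2 := by
      have : 0 ≤ (e - E) * ((l - 1 / 4) - (l - 1 / 2) * (e + E)) :=
        mul_nonneg (by linarith) (by rw [hl]; linarith)
      linarith
    linarith
  · have hB : sechSine ω ≤ 5527 / 10000 := by
      rcases le_total ω (17 / 10) with h2 | h2
      · refine (sechSine_le_parabola hω h2).trans ?_
        nlinarith
      · exact hG1.trans (laplaceSine_half_le h2)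
    have hp := hG _ hB
    have hnn : 0 ≤ e * ((l - 1 / 4) - (l - 1 / 2) * e) :=
      mul_nonneg he0.le (by rw [hl]; linarith)
    have hnum : 253303 / 10000000 * (5527 / 10000 : ℝ) ^ 2 ≤ l ^ 2 - l := by rw [hl]; norm_num
    linarith

/-- The determinant condition fails near the maximum of the multiplier. -/
lemma multiplier_ge {l : ℝ} (hl : l = 100767975 / 100000000) :
    l * (l - 1 / (1 + Real.exp (-(2 * Real.pi * (4361 / 5000))))) ≤
      1 / (4 * Real.pi ^ 2) * ‖sechTransform (4361 / 5000)‖ ^ 2 := by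
  have hpi := Real.pi_pos
  have he := exp_neg_two_pi_mul_upper
  rw [norm_sechTransform_sq]
  set e := Real.exp (-(2 * Real.pi * (4361 / 5000)))
  have he0 : 0 < e := Real.exp_pos _
  have hG : 65563924 / 100000000 ≤ sechSine (4361 / 5000) := by
    have hA := (abs_le.1 (abs_sechSine_sub_le (n := 20) (ω := 4361 / 5000) (by norm_num)
      (by decide) (by norm_num))).1
    have hV := sineSum_tangent_value.2
    rw [sineSum] at hA
    push_cast at hA
    linarith
  have hk := inv_four_pi_sq_bounds.1
  have hsplit : ∀ G : ℝ, 1 / (4 * Real.pi ^ 2) * (Real.pi ^ 2 * (e / (1 + e) ^ 2) + G ^ 2) =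
      1 / 4 * (e / (1 + e) ^ 2) + 1 / (4 * Real.pi ^ 2) * G ^ 2 := by
    intro G; field_simp
  rw [hsplit]
  have h1 : 253302 / 10000000 * (65563924 / 100000000) ^ 2 ≤
      1 / (4 * Real.pi ^ 2) * sechSine (4361 / 5000) ^ 2 := by gcongr
  have e1 : 1 - e + e ^ 2 - e ^ 3 ≤ 1 / (1 + e) := by
    rw [le_div_iff₀ (by positivity)]
    have : 0 ≤ e ^ 4 := by positivity
    linarith
  have e2 : e - 2 * e ^ 2 ≤ e / (1 + e) ^ 2 := by
    rw [le_div_iff₀ (by positivity)]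
    have : 0 ≤ 3 * e ^ 3 + 2 * e ^ 4 := by positivity
    linarith
  have e3 := mul_le_mul_of_nonneg_left e1 (show 0 ≤ l by rw [hl]; norm_num)
  have e4 : l ^ 2 - l + (l - 1 / 4) * e - (l - 1 / 2) * e ^ 2 + l * e ^ 3 ≤
      253302 / 10000000 * (65563924 / 100000000) ^ 2 := by
    obtain ⟨m, hm⟩ : ∃ m : ℝ, m = 416853 / 100000000 := ⟨_, rfl⟩
    rw [← hm] at he
    -- The expression in e is increasing here, so e is replaced by its upper bound m.
    have m1 : 0 ≤ (m - e) * ((l - 1 / 4) - (l - 1 / 2) * (m + e)) :=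
      mul_nonneg (by linarith) (by rw [hl]; linarith)
    have m2 : e ^ 3 ≤ m ^ 3 := by gcongr
    have m3 : l ^ 2 - l + (l - 1 / 4) * m - (l - 1 / 2) * m ^ 2 + l * m ^ 3 ≤
        253302 / 10000000 * (65563924 / 100000000) ^ 2 := by rw [hl, hm]; norm_num
    have m4 := mul_le_mul_of_nonneg_left m2 (show 0 ≤ l by rw [hl]; norm_num)
    linarith
  linarith

end multiplier

/-! ### The quarter plane form through its multiplier -/

lemma measurableSet_halfPlane (a b c : ℝ) : MeasurableSet (halfPlane a b c) :=
  (isClosed_le continuous_const (by fun_prop)).measurableSet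

lemma ordConnected_vsection_halfPlane (a b c x : ℝ) : (vsection (halfPlane a b c) x).OrdConnected := by
  refine ⟨fun y hy z hz w hw => ?_⟩
  simp only [vsection, halfPlane, mem_ofPred_eq] at hy hz ⊢
  rcases le_total 0 b with hb | hb
  · nlinarith [hw.1]
  · nlinarith [hw.2]

lemma hasBound_halfPlane (a b c : ℝ) : HasBound (halfPlane a b c) 1 := by
  by_cases h : a ≠ 0 ∨ b ≠ 0
  · obtain ⟨g, hg, e⟩ := exists_covariance_halfPlane h c
    rw [e]
    exact hg.bound _ _ (hasBound_strip (Ici 0))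
  · push Not at h
    obtain ⟨rfl, rfl⟩ := h
    by_cases hc : c ≤ 0
    · convert hasBound_univ using 1
      ext p; simpa [halfPlane] using hc
    · convert hasBound_empty using 1
      ext p; simpa [halfPlane] using hc

lemma quarterPlane_eq : quarterPlane = halfPlane 0 1 0 ∩ {p | 0 ≤ p.1} := by
  ext p; simp [quarterPlane, halfPlane, and_comm]

lemma measurableSet_quarterPlane : MeasurableSet quarterPlane := by
  rw [quarterPlane_eq]
  exact (measurableSet_halfPlane _ _ _).inter measurableSet_nonneg_fst

/-- A first, non-sharp bound: cut a half plane once. It gives the existence of the operator and lets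
the sharp bound be extended by density. -/
lemma hasBound_quarterPlane : HasBound quarterPlane (cutBound 1) := by
  rw [quarterPlane_eq]
  exact (hasBound_halfPlane 0 1 0).cut (measurableSet_halfPlane _ _ _)
    (ordConnected_vsection_halfPlane 0 1 0) zero_le_one

lemma continuous_sechTransform : Continuous sechTransform := by
  refine continuous_of_dominated (bound := sechHalf) (fun ω => ?_) (fun ω => ?_)
    integrableOn_Ici_sechHalf ?_
  · refine Continuous.aestronglyMeasurable ?_
    have := continuous_sechHalf
    fun_prop
  · filter_upwards with r
    rw [norm_mul, Complex.norm_exp_ofReal_mul_I, one_mul, Complex.norm_real,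
      Real.norm_of_nonneg (sechHalf_pos r).le]
  · filter_upwards with r
    fun_prop

/-- The off-diagonal entry of the matrix valued Fourier multiplier of the quarter plane. -/
noncomputable def offDiagonal (ω : ℝ) : ℂ := 1 / (2 * Real.pi * Complex.I) * sechTransform ω

lemma norm_offDiagonal (ω : ℝ) : ‖offDiagonal ω‖ = 1 / (2 * Real.pi) * ‖sechTransform ω‖ := by
  rw [offDiagonal, norm_mul, norm_div, norm_mul, norm_mul, Complex.norm_I, Complex.norm_real,
    Real.norm_of_nonneg Real.pi_pos.le]
  simp

lemma norm_offDiagonal_le (ω : ℝ) : ‖offDiagonal ω‖ ≤ 1 / 4 := by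
  rw [norm_offDiagonal]
  have hpi := Real.pi_pos
  calc 1 / (2 * Real.pi) * ‖sechTransform ω‖ ≤ 1 / (2 * Real.pi) * (Real.pi / 2) := by
        gcongr; exact norm_sechTransform_le ω
    _ = 1 / 4 := by field_simp; norm_num

lemma norm_offDiagonal_sq (ω : ℝ) :
    ‖offDiagonal ω‖ ^ 2 = 1 / (4 * Real.pi ^ 2) * ‖sechTransform ω‖ ^ 2 := by
  rw [norm_offDiagonal]; ring

/-- The quadratic form of the matrix valued Fourier multiplier of the quarter plane. -/
noncomputable def formMultiplier (ω : ℝ) (a b : ℂ) : ℝ :=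
  1 / (1 + Real.exp (-(2 * Real.pi * ω))) * ‖a‖ ^ 2 + 2 * (offDiagonal ω * (a * conj b)).re

lemma sigmoid_bounds (t : ℝ) : 0 ≤ 1 / (1 + Real.exp t) ∧ 1 / (1 + Real.exp t) ≤ 1 := by
  have := Real.exp_pos t
  exact ⟨by positivity, by rw [div_le_one (by positivity)]; linarith⟩

lemma abs_re_offDiagonal_le (ω : ℝ) (a b : ℂ) :
    |(offDiagonal ω * (a * conj b)).re| ≤ ‖offDiagonal ω‖ * (‖a‖ * ‖b‖) := by
  refine (Complex.abs_re_le_norm _).trans ?_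
  rw [norm_mul, norm_mul, RCLike.norm_conj]

/-- The diagonal term is nonnegative and the off-diagonal entry is at most 1/4. This keeps the
negative spectrum far from -‖A‖. -/
lemma le_formMultiplier (ω : ℝ) (a b : ℂ) :
    -(1 / 4) * (‖a‖ ^ 2 + ‖b‖ ^ 2) ≤ formMultiplier ω a b := by
  have h1 := (abs_le.1 (abs_re_offDiagonal_le ω a b)).1
  have h2 : ‖offDiagonal ω‖ * (‖a‖ * ‖b‖) ≤ 1 / 4 * (‖a‖ * ‖b‖) := by
    gcongr; exact norm_offDiagonal_le ω
  have h3 : 0 ≤ 1 / (1 + Real.exp (-(2 * Real.pi * ω))) * ‖a‖ ^ 2 :=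
    mul_nonneg (sigmoid_bounds _).1 (by positivity)
  unfold formMultiplier
  nlinarith [sq_nonneg (‖a‖ - ‖b‖)]

/-- The inequality |q|² ≤ l(l - p) with p ≤ l says that l minus the matrix is positive semidefinite.
-/
lemma formMultiplier_le {l : ℝ} (hl : l = 10076805 / 10000000) (ω : ℝ) (a b : ℂ) :
    formMultiplier ω a b ≤ l * (‖a‖ ^ 2 + ‖b‖ ^ 2) := by
  have h1 := (abs_le.1 (abs_re_offDiagonal_le ω a b)).2
  have h2 := multiplier_le hl ω
  rw [← norm_offDiagonal_sq] at h2
  have h3 := (sigmoid_bounds (-(2 * Real.pi * ω))).2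
  unfold formMultiplier
  set p := 1 / (1 + Real.exp (-(2 * Real.pi * ω)))
  have hl0 : 0 < l := by rw [hl]; norm_num
  have hlp : 0 ≤ l - p := by rw [hl]; linarith
  have h4 : ‖offDiagonal ω‖ ≤ Real.sqrt l * Real.sqrt (l - p) := by
    rw [← Real.sqrt_mul hl0.le]
    exact Real.le_sqrt_of_sq_le h2
  have h5 : ‖offDiagonal ω‖ * (‖a‖ * ‖b‖) ≤ Real.sqrt l * Real.sqrt (l - p) * (‖a‖ * ‖b‖) := by
    gcongr
  have e1 := Real.sq_sqrt hl0.le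
  have e2 := Real.sq_sqrt hlp
  nlinarith [sq_nonneg (Real.sqrt (l - p) * ‖a‖ - Real.sqrt l * ‖b‖)]

lemma integrable_formMultiplier (Φ Ψ : 𝓢(ℝ, ℂ)) :
    Integrable (fun τ => formMultiplier (2 * Real.pi * τ) (𝓕 Φ τ) (𝓕 Ψ τ)) ∧
    Integrable (fun τ => offDiagonal (2 * Real.pi * τ) * (𝓕 Φ τ * conj (𝓕 Ψ τ))) := by
  have hsech : Continuous fun τ => offDiagonal (2 * Real.pi * τ) :=
    continuous_const.mul (continuous_sechTransform.comp (by fun_prop))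
  have h1 : Integrable (fun τ => offDiagonal (2 * Real.pi * τ) * (𝓕 Φ τ * conj (𝓕 Ψ τ))) :=
    (integrable_fourier_mul Φ Ψ).bdd_mul hsech.aestronglyMeasurable
      (Eventually.of_forall fun τ => norm_offDiagonal_le _)
  refine ⟨Integrable.add ?_ (h1.re.const_mul 2), h1⟩
  refine (((𝓕 Φ : 𝓢(ℝ, ℂ)).memLp 2 volume).integrable_norm_pow (by norm_num)).bdd_mul (c := 1)
    (Continuous.aestronglyMeasurable ?_) (Eventually.of_forall fun τ => ?_)
  · exact continuous_const.div (by fun_prop) fun τ => by positivity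
  · have := sigmoid_bounds (-(2 * Real.pi * (2 * Real.pi * τ)))
    rw [Real.norm_of_nonneg this.1]
    exact this.2

/-- The quadratic form of the quarter plane in Mellin coordinates. -/
lemma re_wignerForm_quarterPlane {p n Φ Ψ : 𝓢(ℝ, ℂ)} {ε : ℝ} (hε : 0 < ε)
    (hp : ∀ y, y ≤ ε → p y = 0) (hn : ∀ y, -ε ≤ y → n y = 0)
    (hΦ : IsMellinOf 1 p Φ) (hΨ : IsMellinOf (-1) n Ψ) :
    (wignerForm quarterPlane (p + n) (p + n)).re =
      ∫ τ, formMultiplier (2 * Real.pi * τ) (𝓕 Φ τ) (𝓕 Ψ τ) := by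
  have hnn : wignerForm quarterPlane n n = 0 := by
    rw [quarterPlane_eq]
    exact wignerForm_cut_negative (fun y hy => hn y (by linarith)) (fun y hy => hn y (by linarith))
  have hpp := wignerForm_quarterPlane_self (fun y hy => hp y (by linarith)) hΦ
  have hpn := wignerForm_quarterPlane_cross hε hp hn hΦ hΨ
  obtain ⟨hF, hO⟩ := integrable_formMultiplier Φ Ψ
  have hpn' : (wignerForm quarterPlane p n).re =
      ∫ τ, (offDiagonal (2 * Real.pi * τ) * (𝓕 Φ τ * conj (𝓕 Ψ τ))).re := by
    have : ∫ τ, (offDiagonal (2 * Real.pi * τ) * (𝓕 Φ τ * conj (𝓕 Ψ τ))).re =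
        (∫ τ, offDiagonal (2 * Real.pi * τ) * (𝓕 Φ τ * conj (𝓕 Ψ τ))).re := integral_re hO
    rw [this, hpn, ← integral_const_mul]
    congr 2 with τ
    rw [offDiagonal]; ring
  have hd : Integrable fun τ => 1 / (1 + Real.exp (-(2 * Real.pi * (2 * Real.pi * τ)))) *
      ‖𝓕 Φ τ‖ ^ 2 := by
    refine (hF.sub (hO.re.const_mul 2)).congr (Eventually.of_forall fun τ => ?_)
    simp [formMultiplier]
  have hsplit : ∫ τ, formMultiplier (2 * Real.pi * τ) (𝓕 Φ τ) (𝓕 Ψ τ) =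
      (∫ τ, 1 / (1 + Real.exp (-(2 * Real.pi * (2 * Real.pi * τ)))) * ‖𝓕 Φ τ‖ ^ 2) +
      2 * ∫ τ, (offDiagonal (2 * Real.pi * τ) * (𝓕 Φ τ * conj (𝓕 Ψ τ))).re := by
    rw [← integral_const_mul]
    exact integral_add hd (hO.re.const_mul 2)
  rw [wignerForm_add_left, wignerForm_add_right, wignerForm_add_right, hnn,
    wignerForm_conj quarterPlane p n, hsplit, ← hpn', hpp]
  simp only [diagonal_multiplier, Complex.add_re, Complex.ofReal_re, Complex.conj_re,
    add_zero]
  ring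

lemma exists_isMellinOf (σ : ℝ) (u : 𝓢(ℝ, ℂ)) (a b : ℝ)
    (h : ∀ s, s ∉ Icc a b → u (σ * Real.exp s) = 0) : ∃ Φ, IsMellinOf σ u Φ := by
  have h1 : HasCompactSupport fun s : ℝ => ((Real.exp (s / 2) : ℝ) : ℂ) * u (σ * Real.exp s) :=
    HasCompactSupport.intro (isCompact_Icc (a := a) (b := b)) fun s hs => by rw [h s hs, mul_zero]
  have h2 : ContDiff ℝ (⊤ : ℕ∞)
      fun s : ℝ => ((Real.exp (s / 2) : ℝ) : ℂ) * u (σ * Real.exp s) := by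
    exact (Complex.ofRealCLM.contDiff.comp (Real.contDiff_exp.comp (contDiff_id.div_const 2))).mul
      ((u.smooth ⊤).comp (contDiff_const.mul Real.contDiff_exp))
  exact ⟨h1.toSchwartzMap h2, fun s => rfl⟩

/-- For support away from 0 and infinity the Mellin profiles are Schwartz, and the pointwise bounds
of the multiplier integrate by Plancherel. -/
lemma quarterPlane_form_bounds_of_vanishes {l : ℝ} (hl : l = 10076805 / 10000000) {u : 𝓢(ℝ, ℂ)}
    (hu : VanishesNearZero u) {R : ℝ} (hR : ∀ y, R ≤ |y| → u y = 0) :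
    -(1 / 4) * nrm u ^ 2 ≤ (wignerForm quarterPlane u u).re ∧
      (wignerForm quarterPlane u u).re ≤ l * nrm u ^ 2 := by
  obtain ⟨p, n, ε, hε, rfl, hp, hn, hpu, hnu⟩ := hu.decompose
  have hout : ∀ s, s ∉ Icc (Real.log ε) (Real.log (max R 1)) →
      Real.exp s ≤ ε ∨ R ≤ Real.exp s := by
    intro s hs
    by_contra! hc
    refine hs ⟨?_, ?_⟩
    · rw [Real.log_le_iff_le_exp hε]; exact hc.1.le
    · rw [Real.le_log_iff_exp_le (by positivity)]; exact hc.2.le.trans (le_max_left _ _)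
  obtain ⟨Φ, hΦ⟩ := exists_isMellinOf 1 p (Real.log ε) (Real.log (max R 1)) fun s hs => by
    rw [one_mul]
    rcases hout s hs with h | h
    · exact hp _ h
    · rw [hpu _ (Real.exp_pos s)]; exact hR _ (by rwa [Real.abs_exp])
  obtain ⟨Ψ, hΨ⟩ := exists_isMellinOf (-1) n (Real.log ε) (Real.log (max R 1)) fun s hs => by
    rw [neg_one_mul]
    rcases hout s hs with h | h
    · exact hn _ (by linarith)
    · rw [hnu _ (by linarith [Real.exp_pos s])]; exact hR _ (by rwa [abs_neg, Real.abs_exp])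
  have hnorm : nrm (p + n) ^ 2 = ∫ τ, (‖𝓕 Φ τ‖ ^ 2 + ‖𝓕 Ψ τ‖ ^ 2) := by
    rw [integral_add (((𝓕 Φ : 𝓢(ℝ, ℂ)).memLp 2 volume).integrable_norm_pow (by norm_num))
      (((𝓕 Ψ : 𝓢(ℝ, ℂ)).memLp 2 volume).integrable_norm_pow (by norm_num)), nrm_fourier_sq,
      nrm_fourier_sq, hΦ.nrm_pos fun y hy => hp y (by linarith),
      hΨ.nrm_neg fun y hy => hn y (by linarith)]
    exact nrm_sq_decompose rfl fun y =>
      (le_total y 0).imp (fun h => hp y (by linarith)) (fun h => hn y (by linarith))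
  have hint : Integrable fun τ => ‖𝓕 Φ τ‖ ^ 2 + ‖𝓕 Ψ τ‖ ^ 2 :=
    (((𝓕 Φ : 𝓢(ℝ, ℂ)).memLp 2 volume).integrable_norm_pow (by norm_num)).add
      (((𝓕 Ψ : 𝓢(ℝ, ℂ)).memLp 2 volume).integrable_norm_pow (by norm_num))
  obtain ⟨hF, -⟩ := integrable_formMultiplier Φ Ψ
  rw [re_wignerForm_quarterPlane hε hp hn hΦ hΨ, hnorm, ← integral_const_mul, ← integral_const_mul]
  exact ⟨integral_mono (hint.const_mul _) hF fun τ => le_formMultiplier _ _ _,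
    integral_mono hF (hint.const_mul _) fun τ => formMultiplier_le hl _ _ _⟩

/-- Functions supported away from the origin and from infinity approximate `u`. -/
lemma exists_approximation (u : 𝓢(ℝ, ℂ)) : ∃ w : ℕ → 𝓢(ℝ, ℂ),
    (∀ k, VanishesNearZero (w k)) ∧ (∀ k, ∃ R, ∀ y, R ≤ |y| → w k y = 0) ∧
    Tendsto (fun k => ((w k).toLp 2 volume : L2R)) atTop (𝓝 (u.toLp 2 volume)) := by
  obtain ⟨χ, h1, h2, h3⟩ := exists_bump
  -- Since `nearZero` rescales by k + 1, the inner scale 1/(k + 1)² yields the outer cutoff χ(y/(k +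
  -- 1)), from which the inner one χ((k + 1)y) is subtracted.
  let w : ℕ → 𝓢(ℝ, ℂ) := fun k => nearZero (affineComp χ 0 (1 / ((k : ℝ) + 1) ^ 2) (by positivity)
    - χ) u k
  have hw : ∀ k y, w k y = (χ (y / (k + 1)) - χ ((k + 1) * y)) * u y := by
    intro k y
    simp only [w, nearZero_apply, sub_apply, affineComp_apply, zero_add]
    congr 3
    have : (k : ℝ) + 1 ≠ 0 := by positivity
    field_simp
  have hpos : ∀ k : ℕ, (0 : ℝ) < k + 1 := fun k => by positivity
  refine ⟨w, fun k => ⟨1 / (k + 1), by positivity, fun y hy => ?_⟩,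
    fun k => ⟨2 * (k + 1), fun y hy => ?_⟩, ?_⟩
  · have hk := hpos k
    rw [le_div_iff₀' hk] at hy
    have hy1 : |y| ≤ k + 1 := by nlinarith [abs_nonneg y, (Nat.cast_nonneg k : (0 : ℝ) ≤ k)]
    rw [hw, h1, h1, sub_self, zero_mul]
    · rwa [abs_mul, abs_of_pos hk]
    · rwa [abs_div, abs_of_pos hk, div_le_one hk]
  · have hk := hpos k
    rw [hw, h2, h2, sub_self, zero_mul]
    · rw [abs_mul, abs_of_pos hk]
      nlinarith [(Nat.cast_nonneg k : (0 : ℝ) ≤ k)]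
    · rwa [abs_div, abs_of_pos hk, le_div_iff₀ hk]
  · rw [tendsto_iff_norm_sub_tendsto_zero]
    have hn : ∀ k, ‖((w k).toLp 2 volume : L2R) - u.toLp 2 volume‖ = nrm (w k - u) := fun k => rfl
    simp only [hn]
    have hlim : Tendsto (fun k => ∫ y, ‖(w k - u) y‖ ^ 2) atTop (𝓝 (∫ y : ℝ, (0 : ℝ))) := by
      refine tendsto_integral_of_dominated_convergence (fun y => 2 ^ 2 * ‖u y‖ ^ 2)
        (fun k => ((w k - u).continuous.norm.pow 2).aestronglyMeasurable)
        (((u.memLp 2 volume).integrable_norm_pow (by norm_num)).const_mul _) (fun k => ?_) ?_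
      · filter_upwards with y
        rw [Real.norm_of_nonneg (by positivity), ← mul_pow]
        gcongr
        rw [sub_apply, hw, ← sub_one_mul, norm_mul]
        gcongr
        rw [show χ (y / (k + 1)) - χ ((k + 1) * y) - 1 =
          -((1 - χ (y / (k + 1))) + χ ((k + 1) * y)) by ring, norm_neg]
        exact (norm_add_le _ _).trans (by linarith [(h3 (y / (k + 1))).1, (h3 ((k + 1) * y)).2])
      · have h0 : ∀ᵐ y : ℝ, y ≠ 0 := by simp [ae_iff]
        filter_upwards [h0] with y hy
        refine tendsto_const_nhds.congr' ?_
        filter_upwards [eventually_ge_atTop ⌈|y|⌉₊, eventually_ge_atTop ⌈2 / |y|⌉₊] with k hk hk'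
        have hk := (Nat.le_ceil _).trans (Nat.cast_le (α := ℝ).2 hk)
        have hk' := (Nat.le_ceil _).trans (Nat.cast_le (α := ℝ).2 hk')
        have hy' := abs_pos.2 hy
        rw [div_le_iff₀ hy'] at hk'
        rw [sub_apply, hw, h1, h2]
        · simp
        · rw [abs_mul, abs_of_pos (hpos k)]; linarith
        · rw [abs_div, abs_of_pos (hpos k), div_le_one (hpos k)]; linarith
    rw [integral_zero] at hlim
    simp only [nrm_eq_sqrt]
    simpa using hlim.sqrt

/-! ### Sharpness of the multiplier bound -/

/-- The inverse Mellin rescaling is y^{-1/2} Φ(log y) for y > 0; compact support of Φ makes it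
vanish near 0, hence smooth across it. -/
lemma exists_schwartz_of_mellin (Φ : 𝓢(ℝ, ℂ)) {R : ℝ} (hΦ : ∀ s, R ≤ |s| → Φ s = 0) :
    ∃ p : 𝓢(ℝ, ℂ), IsMellinOf 1 p Φ ∧ ∃ ε > 0, ∀ y, y ≤ ε → p y = 0 := by
  let f : ℝ → ℂ := fun y => if 0 < y then ((Real.exp (-(Real.log y / 2)) : ℝ) : ℂ) * Φ (Real.log y)
    else 0
  have hsmall : ∀ y, y ≤ Real.exp (-R) → f y = 0 := by
    intro y hy
    by_cases h : 0 < y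
    · have h1 : Real.log y ≤ -R := by rwa [Real.log_le_iff_le_exp h]
      have h2 : R ≤ |Real.log y| := (by linarith : R ≤ -Real.log y).trans (neg_le_abs _)
      simp [f, h, hΦ _ h2]
    · simp [f, h]
  have hlarge : ∀ y, Real.exp R ≤ y → f y = 0 := by
    intro y hy
    have h : 0 < y := (Real.exp_pos R).trans_le hy
    have h2 : R ≤ |Real.log y| := ((Real.le_log_iff_exp_le h).2 hy).trans (le_abs_self _)
    simp [f, h, hΦ _ h2]
  have hsupp : HasCompactSupport f :=
    HasCompactSupport.intro (isCompact_Icc (a := Real.exp (-R)) (b := Real.exp R)) fun y hy => by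
      by_contra hne
      exact hy ⟨(not_le.1 fun h => hne (hsmall y h)).le, (not_le.1 fun h => hne (hlarge y h)).le⟩
  have hsmooth : ContDiff ℝ (⊤ : ℕ∞) f := by
    rw [contDiff_iff_contDiffAt]
    intro y
    rcases lt_or_ge y (Real.exp (-R)) with hy | hy
    · refine (contDiffAt_const (c := (0 : ℂ))).congr_of_eventuallyEq ?_
      filter_upwards [Iio_mem_nhds hy] with z hz
      exact hsmall z (le_of_lt hz)
    · have hy0 : 0 < y := (Real.exp_pos _).trans_le hy
      have hlog : ContDiffAt ℝ (⊤ : ℕ∞) Real.log y := Real.contDiffAt_log.2 hy0.ne'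
      refine ContDiffAt.congr_of_eventuallyEq
        (f := fun y => ((Real.exp (-(Real.log y / 2)) : ℝ) : ℂ) * Φ (Real.log y)) ?_ ?_
      · exact (Complex.ofRealCLM.contDiff.contDiffAt.comp y
          (Real.contDiff_exp.contDiffAt.comp y (hlog.div_const 2).neg)).mul
          ((Φ.smooth ⊤).contDiffAt.comp y hlog)
      · filter_upwards [Ioi_mem_nhds hy0] with z hz
        simp only [f, if_pos (show 0 < z from hz)]
  refine ⟨hsupp.toSchwartzMap hsmooth, fun s => ?_, Real.exp (-R), Real.exp_pos _, hsmall⟩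
  change Φ s = _ * f (1 * Real.exp s)
  simp only [f, one_mul, Real.exp_pos, if_true, Real.log_exp]
  rw [← mul_assoc, ← Complex.ofReal_mul, ← Real.exp_add]
  simp

lemma fourier_chirp (a : ℝ) (f : 𝓢(ℝ, ℂ)) (τ : ℝ) : 𝓕 (chirp a 0 f) τ = 𝓕 f (τ - a) := by
  rw [SchwartzMap.fourier_coe, SchwartzMap.fourier_coe, Real.fourier_real_eq_integral_exp_smul,
    Real.fourier_real_eq_integral_exp_smul]
  congr 1 with y
  rw [chirp_apply, smul_eq_mul, smul_eq_mul, ← mul_assoc, ← Complex.exp_add]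
  congr 2
  push_cast; ring

lemma formMultiplier_mul (ω : ℝ) (a b z : ℂ) :
    formMultiplier ω (a * z) (b * z) = formMultiplier ω a b * ‖z‖ ^ 2 := by
  have h : offDiagonal ω * (a * z * conj (b * z)) =
      ((‖z‖ ^ 2 : ℝ) : ℂ) * (offDiagonal ω * (a * conj b)) := by
    have := Complex.mul_conj' z
    rw [map_mul]
    push_cast
    linear_combination offDiagonal ω * a * conj b * this
  rw [formMultiplier, h, Complex.re_ofReal_mul, formMultiplier, norm_mul]
  ring

lemma IsMellinOf.smul {σ : ℝ} {u Φ : 𝓢(ℝ, ℂ)} (h : IsMellinOf σ u Φ) (c : ℂ) :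
    IsMellinOf σ (c • u) (c • Φ) := fun s => by
  rw [smul_apply, smul_apply, h s, smul_eq_mul, smul_eq_mul]; ring

/-- Test the form on a function with one common profile Φ on both half lines, with weights a and b.
-/
lemma integral_formMultiplier_le {M : ℝ} (hM : HasBound quarterPlane M) (a b : ℂ) (Φ : 𝓢(ℝ, ℂ))
    {R : ℝ} (hΦ : ∀ s, R ≤ |s| → Φ s = 0) :
    ∫ τ, formMultiplier (2 * Real.pi * τ) a b * ‖𝓕 Φ τ‖ ^ 2 ≤
      M * (‖a‖ ^ 2 + ‖b‖ ^ 2) * nrm Φ ^ 2 := by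
  obtain ⟨p, hp, ε, hε, hpε⟩ := exists_schwartz_of_mellin Φ hΦ
  let n : 𝓢(ℝ, ℂ) := affineComp p 0 (-1) (by norm_num)
  have hn : IsMellinOf (-1) n Φ := fun s => by simp [n, hp s]
  have hp0 : ∀ y, y ≤ ε → (a • p) y = 0 := fun y hy => by simp [hpε y hy]
  have hn0 : ∀ y, -ε ≤ y → (b • n) y = 0 := fun y hy => by
    simp [n, hpε (-y) (by linarith)]
  have hnorm : nrm (a • p + b • n) ^ 2 = (‖a‖ ^ 2 + ‖b‖ ^ 2) * nrm Φ ^ 2 := by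
    rw [nrm_sq_decompose rfl fun y => (le_total y 0).imp (fun h => hp0 y (by linarith))
        (fun h => hn0 y (by linarith)), ← (hp.smul a).nrm_pos fun y hy => hp0 y (by linarith),
      ← (hn.smul b).nrm_neg fun y hy => hn0 y (by linarith), nrm_sq, nrm_sq, nrm_sq]
    simp only [smul_apply, norm_smul, mul_pow, integral_const_mul]
    ring
  have h1 := re_wignerForm_quarterPlane hε hp0 hn0 (hp.smul a) (hn.smul b)
  have h2 : ∀ (c : ℂ) τ, 𝓕 (c • Φ) τ = c * 𝓕 Φ τ := fun c τ => by
    rw [FourierTransform.fourier_smul, smul_apply, smul_eq_mul]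
  simp only [h2, formMultiplier_mul] at h1
  rw [← h1, mul_assoc, ← hnorm]
  refine (Complex.re_le_norm _).trans ((hM _ _).trans_eq (by ring))

/-- The multiplier is bounded by every bound of the quadratic form. -/
lemma formMultiplier_le_of_hasBound {M : ℝ} (hM : HasBound quarterPlane M) (ω : ℝ) (a b : ℂ) :
    formMultiplier ω a b ≤ M * (‖a‖ ^ 2 + ‖b‖ ^ 2) := by
  obtain ⟨χ, h1, h2, -⟩ := exists_bump
  have hpi := Real.pi_pos
  let τ₀ : ℝ := ω / (2 * Real.pi)
  let m : ℝ → ℝ := fun τ => formMultiplier (2 * Real.pi * τ) a b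
  have hm : Continuous m := by
    have := continuous_sechTransform
    refine ((continuous_const.div (by fun_prop) fun τ => by positivity).mul continuous_const).add
      (continuous_const.mul (Complex.continuous_re.comp ?_))
    unfold offDiagonal
    fun_prop
  have hm0 : m τ₀ = formMultiplier ω a b := by
    simp only [m, τ₀]; congr 1; field_simp
  have hmb : ∀ τ, ‖m τ‖ ≤ 2 * (‖a‖ ^ 2 + ‖b‖ ^ 2) := by
    intro τ
    have h1 := le_formMultiplier (2 * Real.pi * τ) a b
    have h2 := formMultiplier_le rfl (2 * Real.pi * τ) a b
    have h3 : 0 ≤ ‖a‖ ^ 2 + ‖b‖ ^ 2 := by positivity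
    rw [Real.norm_eq_abs, abs_le]
    constructor <;> simp only [m] <;> linarith
  have hχ : 0 < nrm χ ^ 2 := by
    refine pow_pos (lt_of_le_of_ne (nrm_nonneg χ) fun h => ?_) 2
    have h3 : (χ.toLp 2 volume : L2R) = 0 := norm_eq_zero.1 h.symm
    have h4 : χ = 0 := SchwartzMap.injective_toLp 2 volume
      (h3.trans (map_zero (SchwartzMap.toLpCLM ℂ ℂ 2 volume)).symm)
    have h5 := h1 0 (by simp)
    rw [h4] at h5
    simp at h5
  have key : ∀ k : ℕ, ∫ t, m (τ₀ + t / (k + 1)) * ‖𝓕 χ t‖ ^ 2 ≤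
      M * (‖a‖ ^ 2 + ‖b‖ ^ 2) * nrm χ ^ 2 := by
    intro k
    have hk : (0 : ℝ) < k + 1 := by positivity
    have hk0 := hk.ne'
    -- Stretching χ by k + 1 and modulating by τ₀ concentrates the Fourier mass at τ₀, so the
    -- averages tend to the value of the multiplier there.
    let f : 𝓢(ℝ, ℂ) := affineComp χ 0 (1 / ((k : ℝ) + 1)) (by positivity)
    have h3 := integral_formMultiplier_le hM a b (chirp τ₀ 0 f) (R := 2 * (k + 1)) fun s hs => by
      rw [chirp_apply]
      simp only [f, affineComp_apply, zero_add]
      rw [h2, mul_zero]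
      rw [abs_mul, abs_of_pos (by positivity)]
      rw [one_div, inv_mul_eq_div, le_div_iff₀ hk]; exact hs
    have hF : ∀ τ, ‖𝓕 (chirp τ₀ 0 f) τ‖ ^ 2 = (k + 1) ^ 2 * ‖𝓕 χ ((k + 1) * (τ - τ₀))‖ ^ 2 := by
      intro τ
      rw [fourier_chirp, fourier_affineComp, norm_mul, Complex.norm_exp_ofReal_mul_I, one_mul,
        norm_smul, mul_pow, Real.norm_eq_abs, abs_abs, one_div, inv_inv, abs_of_pos hk,
        div_inv_eq_mul, mul_comm (τ - τ₀)]
    have hN : nrm (chirp τ₀ 0 f) ^ 2 = (k + 1) * nrm χ ^ 2 := by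
      rw [nrm_chirp, nrm_sq, nrm_sq]
      simp only [f, affineComp_apply, zero_add]
      rw [Measure.integral_comp_mul_left (fun y => ‖χ y‖ ^ 2), smul_eq_mul, one_div, inv_inv,
        abs_of_pos hk]
    have hI : ∫ τ, m τ * ((k + 1) ^ 2 * ‖𝓕 χ ((k + 1) * (τ - τ₀))‖ ^ 2) =
        (k + 1) * ∫ t, m (τ₀ + t / (k + 1)) * ‖𝓕 χ t‖ ^ 2 := by
      rw [← integral_add_right_eq_self _ τ₀]
      simp only [add_sub_cancel_right]
      have h4 := Measure.integral_comp_mul_left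
        (fun t => m (τ₀ + t / (k + 1)) * ‖𝓕 χ t‖ ^ 2) ((k : ℝ) + 1)
      rw [smul_eq_mul, abs_of_pos (inv_pos.2 hk)] at h4
      have h5 : ∀ τ : ℝ, m (τ + τ₀) * ((k + 1) ^ 2 * ‖𝓕 χ ((k + 1) * τ)‖ ^ 2) =
          (k + 1) ^ 2 * (m (τ₀ + (k + 1) * τ / (k + 1)) * ‖𝓕 χ ((k + 1) * τ)‖ ^ 2) := by
        intro τ
        rw [mul_div_cancel_left₀ _ hk0, add_comm τ₀]; ring
      simp only [h5]
      rw [integral_const_mul, h4]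
      field_simp
    simp only [hF] at h3
    rw [hN] at h3
    have h6 : (k + 1) * ∫ t, m (τ₀ + t / (k + 1)) * ‖𝓕 χ t‖ ^ 2 ≤
        (k + 1) * (M * (‖a‖ ^ 2 + ‖b‖ ^ 2) * nrm χ ^ 2) := by
      rw [← hI]; refine h3.trans_eq (by ring)
    exact le_of_mul_le_mul_left h6 hk
  have hlim : Tendsto (fun k : ℕ => ∫ t, m (τ₀ + t / (k + 1)) * ‖𝓕 χ t‖ ^ 2) atTop
      (𝓝 (∫ t, m τ₀ * ‖𝓕 χ t‖ ^ 2)) := by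
    have hc := (𝓕 χ : 𝓢(ℝ, ℂ)).continuous
    refine tendsto_integral_of_dominated_convergence
      (fun t => 2 * (‖a‖ ^ 2 + ‖b‖ ^ 2) * ‖𝓕 χ t‖ ^ 2) (fun k => ?_)
      ((((𝓕 χ : 𝓢(ℝ, ℂ)).memLp 2 volume).integrable_norm_pow (by norm_num)).const_mul _)
      (fun k => ?_) ?_
    · refine Continuous.aestronglyMeasurable ?_
      fun_prop
    · filter_upwards with t
      rw [norm_mul, norm_pow, norm_norm]
      gcongr
      exact hmb _
    · filter_upwards with t
      refine Tendsto.mul_const _ ((hm.tendsto τ₀).comp ?_)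
      have := (tendsto_one_div_add_atTop_nhds_zero_nat (𝕜 := ℝ)).const_mul t
      simpa [div_eq_mul_inv] using this.const_add τ₀
  have h3 := le_of_tendsto hlim (Eventually.of_forall key)
  rw [integral_const_mul, nrm_fourier_sq, hm0] at h3
  exact le_of_mul_le_mul_right h3 hχ

/-- Evaluate the multiplier on the vector (l, q): the form is pl² + 2l|q|², which is at least l(l² +
|q|²) precisely because |q|² ≥ l(l - p). -/
lemma le_of_hasBound_quarterPlane {M : ℝ} (hM : HasBound quarterPlane M) :
    100767975 / 100000000 ≤ M := by
  have h1 := multiplier_ge rfl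
  set l : ℝ := 100767975 / 100000000 with hl
  set q := offDiagonal (4361 / 5000)
  rw [← norm_offDiagonal_sq] at h1
  have h2 := formMultiplier_le_of_hasBound hM (4361 / 5000) l q
  have h3 : (q * (l * conj q)).re = l * ‖q‖ ^ 2 := by
    rw [show q * (l * conj q) = l * (q * conj q) by ring, Complex.mul_conj', Complex.re_ofReal_mul,
      ← Complex.ofReal_pow, Complex.ofReal_re]
  rw [formMultiplier, h3, Complex.norm_real, Real.norm_of_nonneg (by positivity)] at h2
  have h4 : 0 < l ^ 2 + ‖q‖ ^ 2 := by positivity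
  refine le_of_mul_le_mul_right ?_ h4
  refine le_trans ?_ h2
  nlinarith

/-! ### Norm and spectrum of the quarter plane operator -/

lemma le_re_inner_of_isWeylQuantization_quarterPlane {A : L2R →L[ℂ] L2R}
    (hA : IsWeylQuantization (indicatorSymbol quarterPlane) A) (f : L2R) :
    -(1 / 4) * ‖f‖ ^ 2 ≤ (inner ℂ f (A f)).re ∧
      (inner ℂ f (A f)).re ≤ 10076805 / 10000000 * ‖f‖ ^ 2 := by
  let S : Set L2R := {f | -(1 / 4) * ‖f‖ ^ 2 ≤ (inner ℂ f (A f)).re ∧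
    (inner ℂ f (A f)).re ≤ 10076805 / 10000000 * ‖f‖ ^ 2}
  have hc : Continuous fun f : L2R => (inner ℂ f (A f)).re :=
    Complex.continuous_re.comp (continuous_id.inner A.continuous)
  have hS : IsClosed S :=
    (isClosed_le (by fun_prop) hc).inter (isClosed_le hc (by fun_prop))
  refine denseRange_toLp.induction_on (p := fun f => f ∈ S) f hS fun u => ?_
  obtain ⟨w, h1, h2, h3⟩ := exists_approximation u
  refine hS.mem_of_tendsto h3 (Eventually.of_forall fun k => ?_)
  obtain ⟨R, hR⟩ := h2 k
  have := quarterPlane_form_bounds_of_vanishes rfl (h1 k) hR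
  rwa [← integral_indicatorSymbol_mul measurableSet_quarterPlane, ← hA] at this

instance : Nontrivial L2R := by
  obtain ⟨χ, h1, -, -⟩ := exists_bump
  refine ⟨⟨χ.toLp 2 volume, (0 : 𝓢(ℝ, ℂ)).toLp 2 volume, fun h => ?_⟩⟩
  have h5 := h1 0 (by simp)
  rw [SchwartzMap.injective_toLp 2 volume h] at h5
  simp at h5

section hilbert

variable {H : Type*} [NormedAddCommGroup H] [InnerProductSpace ℂ H] [CompleteSpace H]

/-- The largest element of the spectrum of a self-adjoint operator whose negative part is smaller
than its norm. -/
lemma isGreatest_spectrum_norm [Nontrivial H] {A : H →L[ℂ] H} (hsa : IsSelfAdjoint A) {m M : ℝ}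
    (hm : ∀ f, -m * ‖f‖ ^ 2 ≤ (inner ℂ f (A f)).re) (hM : ∀ f, (inner ℂ f (A f)).re ≤ M * ‖f‖ ^ 2)
    (hA : m < ‖A‖) : ‖A‖ ≤ M ∧ IsGreatest (spectrum ℝ A) ‖A‖ := by
  have hre : ∀ f, (inner ℂ (A f) f).re = (inner ℂ f (A f)).re := fun f => by
    rw [← inner_conj_symm, Complex.conj_re]
  have halg : ∀ (r : ℝ) (f : H), algebraMap ℝ (H →L[ℂ] H) r f = (r : ℂ) • f := fun r f => by
    rw [Algebra.algebraMap_eq_smul_one]; rfl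
  have hself : ∀ f : H, (inner ℂ f f : ℂ).re = ‖f‖ ^ 2 := fun f => by
    rw [inner_self_eq_norm_sq_to_K]; norm_cast
  have hge : algebraMap ℝ (H →L[ℂ] H) (-m) ≤ A := by
    rw [ContinuousLinearMap.le_def, ContinuousLinearMap.isPositive_def]
    refine ⟨(hsa.sub (IsSelfAdjoint.algebraMap _ (IsSelfAdjoint.all _))).isSymmetric, fun f => ?_⟩
    rw [ContinuousLinearMap.reApplyInnerSelf_apply, _root_.sub_apply, halg,
      inner_sub_left, inner_smul_left, Complex.conj_ofReal, RCLike.re_eq_complex_re,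
      Complex.sub_re, hre, Complex.re_ofReal_mul, hself]
    linarith [hm f]
  have hle : A ≤ algebraMap ℝ (H →L[ℂ] H) M := by
    rw [ContinuousLinearMap.le_def, ContinuousLinearMap.isPositive_def]
    refine ⟨((IsSelfAdjoint.algebraMap _ (IsSelfAdjoint.all _)).sub hsa).isSymmetric, fun f => ?_⟩
    rw [ContinuousLinearMap.reApplyInnerSelf_apply, _root_.sub_apply, halg,
      inner_sub_left, inner_smul_left, Complex.conj_ofReal, RCLike.re_eq_complex_re,
      Complex.sub_re, hre, Complex.re_ofReal_mul, hself]
    linarith [hM f]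
  rw [algebraMap_le_iff_le_spectrum hsa] at hge
  rw [le_algebraMap_iff_spectrum_le hsa] at hle
  -- One of ±‖A‖ belongs to the spectrum of a self-adjoint operator, and the lower bound -m > -‖A‖
  -- excludes the negative one.
  have hmem : ‖A‖ ∈ spectrum ℝ A := by
    refine (CStarAlgebra.norm_or_neg_norm_mem_spectrum hsa).resolve_right fun h => ?_
    have := hge _ h
    linarith
  exact ⟨hle _ hmem, hmem, fun x hx =>
    (Real.le_norm_self x).trans (spectrum.norm_le_norm_of_mem hx)⟩

end hilbert

/-- The norm and the spectrum of the quantization of the quarter plane. -/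
theorem quarterPlane_spectrum {A : L2R →L[ℂ] L2R}
    (hA : IsWeylQuantization (indicatorSymbol quarterPlane) A) :
    100767975 / 100000000 ≤ ‖A‖ ∧ ‖A‖ ≤ 10076805 / 10000000 ∧ IsGreatest (spectrum ℝ A) ‖A‖ := by
  have hlow := le_of_hasBound_quarterPlane (hA.hasBound measurableSet_quarterPlane)
  have hinner := le_re_inner_of_isWeylQuantization_quarterPlane hA
  obtain ⟨h1, h2⟩ := isGreatest_spectrum_norm (hA.isSelfAdjoint measurableSet_quarterPlane)
    (fun f => (hinner f).1) (fun f => (hinner f).2) (by linarith)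
  exact ⟨hlow, h1, h2⟩

/-! ### Convex cones -/

section cones

lemma volume_line_eq_zero {a b : ℝ} (h : a ≠ 0 ∨ b ≠ 0) (c : ℝ) :
    volume {p : ℝ × ℝ | a * p.1 + b * p.2 = c} = 0 := by
  have hm : MeasurableSet {p : ℝ × ℝ | a * p.1 + b * p.2 = c} :=
    (isClosed_eq (by fun_prop) continuous_const).measurableSet
  rw [Measure.volume_eq_prod, Measure.measure_prod_null hm]
  have hx : ∀ᵐ x : ℝ, x ≠ c / a := by simp [ae_iff]
  filter_upwards [hx] with x hx
  refine Set.Subsingleton.measure_zero (fun y hy z hz => ?_) _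
  simp only [mem_preimage, mem_ofPred_eq] at hy hz
  by_cases hb : b = 0
  · subst hb
    have ha : a ≠ 0 := by simpa using h
    exact absurd (by rw [eq_div_iff ha]; linarith) hx
  · exact mul_left_cancel₀ hb (by linarith)

lemma openHalfPlane_ae_eq {a b : ℝ} (h : a ≠ 0 ∨ b ≠ 0) (c : ℝ) :
    ({p : ℝ × ℝ | c < a * p.1 + b * p.2} : Set (ℝ × ℝ)) =ᵐ[volume] halfPlane a b c := by
  have h0 : ∀ᵐ p : ℝ × ℝ, ¬ a * p.1 + b * p.2 = c := by
    rw [ae_iff]; simpa using volume_line_eq_zero h c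
  filter_upwards [h0] with p hp
  exact propext ⟨fun hc => le_of_lt hc, fun hc => lt_of_le_of_ne hc (Ne.symm hp)⟩

/-- A sector of aperture at most `π` is an intersection of two open half planes. -/
lemma sector_eq (X₀ : ℝ × ℝ) (α : ℝ) {θ : ℝ} (h0 : 0 ≤ θ) (h1 : θ ≤ Real.pi) :
    sector X₀ α θ =
      {p | -Real.sin α * X₀.1 + Real.cos α * X₀.2 < -Real.sin α * p.1 + Real.cos α * p.2} ∩
      {p | Real.sin (α + θ) * X₀.1 + -Real.cos (α + θ) * X₀.2 <
        Real.sin (α + θ) * p.1 + -Real.cos (α + θ) * p.2} := by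
  ext X
  constructor
  · rintro ⟨r, φ, hr, hα, hθ, rfl⟩
    have e1 : 0 < Real.sin (φ - α) := Real.sin_pos_of_pos_of_lt_pi (by linarith) (by linarith)
    have e2 : 0 < Real.sin (α + θ - φ) := Real.sin_pos_of_pos_of_lt_pi (by linarith) (by linarith)
    rw [Real.sin_sub] at e1 e2
    have e3 := mul_pos hr e1
    have e4 := mul_pos hr e2
    simp only [mem_inter_iff, mem_ofPred_eq, Prod.fst_add, Prod.snd_add, Prod.smul_fst,
      Prod.smul_snd, smul_eq_mul]
    constructor <;> linarith
  · rintro ⟨e1, e2⟩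
    simp only [mem_ofPred_eq] at e1 e2
    set x := X.1 - X₀.1
    set y := X.2 - X₀.2
    have hx : X.1 = X₀.1 + x := by simp [x]
    have hy : X.2 = X₀.2 + y := by simp [y]
    rw [hx, hy] at e1 e2
    -- The vector X - X₀ turned by -α, as a complex number: the two inequalities say that its
    -- argument lies strictly between 0 and θ.
    let z : ℂ := ⟨Real.cos α * x + Real.sin α * y, -Real.sin α * x + Real.cos α * y⟩
    have hz1 : Real.cos α * x + Real.sin α * y = ‖z‖ * Real.cos z.arg := by
      rw [Complex.norm_mul_cos_arg]
    have hz2 : -Real.sin α * x + Real.cos α * y = ‖z‖ * Real.sin z.arg := by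
      rw [Complex.norm_mul_sin_arg]
    have hsc := Real.sin_sq_add_cos_sq α
    have hx' : x = ‖z‖ * Real.cos (α + z.arg) := by
      rw [Real.cos_add]
      linear_combination Real.cos α * hz1 - Real.sin α * hz2 - x * hsc
    have hy' : y = ‖z‖ * Real.sin (α + z.arg) := by
      rw [Real.sin_add]
      linear_combination Real.sin α * hz1 + Real.cos α * hz2 - y * hsc
    have hs : 0 < ‖z‖ * Real.sin z.arg := by rw [← hz2]; linarith
    have hr : 0 < ‖z‖ := by
      refine lt_of_le_of_ne (norm_nonneg z) fun h => ?_
      rw [← h, zero_mul] at hs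
      exact lt_irrefl _ hs
    have hs1 : 0 < Real.sin z.arg := pos_of_mul_pos_right hs hr.le
    have hψ : 0 < z.arg := by
      by_contra! hc
      have := Real.sin_nonpos_of_nonpos_of_neg_pi_le hc (Complex.neg_pi_lt_arg z).le
      linarith
    have hs2 : 0 < ‖z‖ * Real.sin (α + θ - (α + z.arg)) := by
      rw [Real.sin_sub]
      have : Real.sin (α + θ) * x - Real.cos (α + θ) * y = ‖z‖ * (Real.sin (α + θ) *
          Real.cos (α + z.arg) - Real.cos (α + θ) * Real.sin (α + z.arg)) := by
        rw [hx', hy']; ring_nf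
      rw [← this]; linarith
    have hs3 : 0 < Real.sin (θ - z.arg) := by
      have := pos_of_mul_pos_right hs2 hr.le
      rwa [add_sub_add_left_eq_sub] at this
    have hlt : z.arg < θ := by
      by_contra! hc
      have := Real.sin_nonpos_of_nonpos_of_neg_pi_le (x := θ - z.arg) (by linarith)
        (by linarith [Complex.arg_le_pi z])
      linarith
    refine ⟨‖z‖, α + z.arg, hr, by linarith, by linarith, ?_⟩
    ext
    · rw [hx, hx']; simp
    · rw [hy, hy']; simp

lemma sector_ae_eq (X₀ : ℝ × ℝ) (α : ℝ) {θ : ℝ} (h0 : 0 ≤ θ) (h1 : θ ≤ Real.pi) :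
    sector X₀ α θ =ᵐ[volume]
      (halfPlane (-Real.sin α) (Real.cos α) (-Real.sin α * X₀.1 + Real.cos α * X₀.2) ∩
      halfPlane (Real.sin (α + θ)) (-Real.cos (α + θ))
        (Real.sin (α + θ) * X₀.1 + -Real.cos (α + θ) * X₀.2) : Set (ℝ × ℝ)) := by
  have hne : ∀ β, Real.sin β ≠ 0 ∨ Real.cos β ≠ 0 := fun β => by
    by_contra! h
    have := Real.sin_sq_add_cos_sq β
    rw [h.1, h.2] at this
    norm_num at this
  rw [sector_eq X₀ α h0 h1]
  exact (openHalfPlane_ae_eq (by simpa using hne α) _).inter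
    (openHalfPlane_ae_eq (by simpa using hne (α + θ)) _)

lemma measurableSet_sector (X₀ : ℝ × ℝ) (α : ℝ) {θ : ℝ} (h0 : 0 ≤ θ) (h1 : θ ≤ Real.pi) :
    MeasurableSet (sector X₀ α θ) := by
  rw [sector_eq X₀ α h0 h1]
  exact (isOpen_lt continuous_const (by fun_prop)).measurableSet.inter
    (isOpen_lt continuous_const (by fun_prop)).measurableSet

lemma hasBound_sector {μ : ℝ} (h1 : 1 ≤ μ) (hq : HasBound quarterPlane μ) (X₀ : ℝ × ℝ) (α : ℝ)
    {θ : ℝ} (hθ0 : 0 ≤ θ) (hθ1 : θ ≤ Real.pi) : HasBound (sector X₀ α θ) μ :=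
  (hasBound_inter_halfPlane h1 hq _ _ _ _ _ _).congr (sector_ae_eq X₀ α hθ0 hθ1).symm

lemma sector_ae_eq_quarterPlane : sector 0 0 (Real.pi / 2) =ᵐ[volume] quarterPlane := by
  have := sector_ae_eq 0 0 (θ := Real.pi / 2) (by positivity) (by linarith [Real.pi_pos])
  have e : quarterPlane = halfPlane 0 1 0 ∩ halfPlane 1 0 0 := by
    ext p
    simp [quarterPlane, halfPlane, and_comm]
  rw [e]
  simpa using this

end cones

/-! ### Triangles -/

section triangles

lemma triangleSet_eq (L : Fin 3 → (ℝ × ℝ →ₗ[ℝ] ℝ)) (c : Fin 3 → ℝ) :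
    triangleSet L c = halfPlane (L 0 (1, 0)) (L 0 (0, 1)) (c 0) ∩
      halfPlane (L 1 (1, 0)) (L 1 (0, 1)) (c 1) ∩ halfPlane (L 2 (1, 0)) (L 2 (0, 1)) (c 2) := by
  have h : ∀ j (X : ℝ × ℝ), L j X = L j (1, 0) * X.1 + L j (0, 1) * X.2 := by
    intro j X
    have e : X = X.1 • ((1 : ℝ), (0 : ℝ)) + X.2 • ((0 : ℝ), (1 : ℝ)) := by ext <;> simp
    conv_lhs => rw [e]
    rw [map_add, map_smul, map_smul, smul_eq_mul, smul_eq_mul]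
    ring
  ext X
  have e : X ∈ triangleSet L c ↔ (c 0 ≤ L 0 X ∧ c 1 ≤ L 1 X) ∧ c 2 ≤ L 2 X := by
    simp [triangleSet, Fin.forall_fin_succ, and_assoc]
  rw [e, h 0 X, h 1 X, h 2 X]
  rfl

lemma measurableSet_triangleSet (L : Fin 3 → (ℝ × ℝ →ₗ[ℝ] ℝ)) (c : Fin 3 → ℝ) :
    MeasurableSet (triangleSet L c) := by
  rw [triangleSet_eq]
  exact ((measurableSet_halfPlane _ _ _).inter (measurableSet_halfPlane _ _ _)).inter
    (measurableSet_halfPlane _ _ _)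

lemma le_cutBound (M : ℝ) : M ≤ cutBound M := by
  have : M ≤ Real.sqrt (1 + M ^ 2) := Real.le_sqrt_of_sq_le (by linarith)
  unfold cutBound; linarith

/-- Move the third half plane to x ≥ 0 and apply the cutting lemma to the other two, whose
intersection has interval sections and bound μ. -/
lemma hasBound_inter_three_halfPlanes {μ : ℝ} (h1 : 1 ≤ μ) (hq : HasBound quarterPlane μ)
    (a b c a' b' c' a'' b'' c'' : ℝ) :
    HasBound (halfPlane a b c ∩ halfPlane a' b' c' ∩ halfPlane a'' b'' c'') (cutBound μ) := by
  by_cases h : a'' ≠ 0 ∨ b'' ≠ 0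
  · obtain ⟨g, hg, e⟩ := exists_covariance_halfPlane h c''
    obtain ⟨α, β, γ, e1⟩ := hg.half a b c
    obtain ⟨α', β', γ', e2⟩ := hg.half a' b' c'
    rw [e, e1, e2, ← preimage_inter, ← preimage_inter]
    refine hg.bound _ _ (HasBound.cut
      ((measurableSet_halfPlane _ _ _).inter (measurableSet_halfPlane _ _ _)) (fun x => ?_)
      (zero_le_one.trans h1) (hasBound_inter_halfPlane h1 hq _ _ _ _ _ _))
    exact (ordConnected_vsection_halfPlane α β γ x).inter
      (ordConnected_vsection_halfPlane α' β' γ' x)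
  · push Not at h
    obtain ⟨rfl, rfl⟩ := h
    by_cases hc : c'' ≤ 0
    · have : halfPlane 0 0 c'' = univ := by ext p; simpa [halfPlane] using hc
      rw [this, inter_univ]
      exact (hasBound_inter_halfPlane h1 hq _ _ _ _ _ _).mono (le_cutBound μ)
    · have : halfPlane 0 0 c'' = ∅ := by ext p; simpa [halfPlane] using hc
      rw [this, inter_empty]
      exact hasBound_empty.mono (h1.trans (le_cutBound μ))

lemma hasBound_triangleSet {μ : ℝ} (h1 : 1 ≤ μ) (hq : HasBound quarterPlane μ)
    (L : Fin 3 → (ℝ × ℝ →ₗ[ℝ] ℝ)) (c : Fin 3 → ℝ) : HasBound (triangleSet L c) (cutBound μ) := by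
  rw [triangleSet_eq]
  exact hasBound_inter_three_halfPlanes h1 hq _ _ _ _ _ _ _ _ _

/-- The right isosceles triangle with legs of length `n` on the axes. -/
def standardTriangle (n : ℝ) : Set (ℝ × ℝ) := {p | 0 ≤ p.1 ∧ 0 ≤ p.2 ∧ p.1 + p.2 ≤ n}

lemma standardTriangle_eq (n : ℝ) : standardTriangle n =
    triangleSet ![LinearMap.fst ℝ ℝ ℝ, LinearMap.snd ℝ ℝ ℝ,
      -(LinearMap.fst ℝ ℝ ℝ + LinearMap.snd ℝ ℝ ℝ)] ![0, 0, -n] := by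
  ext p
  simp only [standardTriangle, triangleSet, mem_ofPred_eq, Fin.forall_fin_succ]
  simp [add_comm]

lemma standardTriangle_mem {n : ℝ} (hn : 0 < n) : standardTriangle n ∈ properTriangles := by
  refine ⟨_, _, ?_, ?_, ?_, standardTriangle_eq n⟩
  · intro j k hjk
    rw [LinearIndependent.pair_iff]
    intro s t h
    have h1 := LinearMap.congr_fun h (1, 0)
    have h2 := LinearMap.congr_fun h (0, 1)
    fin_cases j <;> fin_cases k <;> simp at hjk h1 h2 ⊢ <;> constructor <;> linarith
  · rw [← standardTriangle_eq]
    have hU : IsOpen {p : ℝ × ℝ | 0 < p.1 ∧ 0 < p.2 ∧ p.1 + p.2 < n} :=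
      (isOpen_lt continuous_const continuous_fst).inter
        ((isOpen_lt continuous_const continuous_snd).inter
          (isOpen_lt (continuous_fst.add continuous_snd) continuous_const))
    refine (hU.measure_pos volume ⟨(n / 3, n / 3), ?_⟩).trans_le
      (measure_mono fun p hp => ⟨hp.1.le, hp.2.1.le, hp.2.2.le⟩)
    simp only [mem_ofPred_eq]
    refine ⟨?_, ?_, ?_⟩ <;> linarith
  · rw [← standardTriangle_eq]
    rintro ⟨X₀, h⟩
    have h0 : ((0, 0) : ℝ × ℝ) ∈ standardTriangle n := by simp [standardTriangle, hn.le]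
    have hN : ((n, 0) : ℝ × ℝ) ∈ standardTriangle n := by simp [standardTriangle, hn.le]
    -- Dilating the origin by 2 and by 1/2 forces the centre to be the origin; then (n, 0) is sent
    -- to (2n, 0), outside the triangle.
    have h2 := h _ h0 2 two_pos
    have h3 := h _ h0 (1 / 2) one_half_pos
    have h4 := h _ hN 2 two_pos
    simp only [standardTriangle, mem_ofPred_eq, Prod.fst_add, Prod.snd_add, Prod.smul_fst,
      Prod.smul_snd, Prod.fst_sub, Prod.snd_sub, smul_eq_mul] at h2 h3 h4
    linarith [h2.1, h2.2.1, h3.1, h3.2.1, h4.2.2]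

/-- The triangles increase to the quarter plane and W(u,v) is integrable, so the forms converge for
each pair of Schwartz functions. -/
lemma hasBound_quarterPlane_of_standardTriangle {M : ℝ}
    (h : ∀ n : ℕ, HasBound (standardTriangle (n + 1)) M) : HasBound quarterPlane M := by
  intro u v
  have hU : ⋃ n : ℕ, standardTriangle (n + 1) = quarterPlane := by
    ext p
    simp only [mem_iUnion, standardTriangle, quarterPlane, mem_ofPred_eq]
    constructor
    · rintro ⟨n, h1, h2, -⟩
      exact ⟨h1, h2⟩
    · rintro ⟨h1, h2⟩
      obtain ⟨n, hn⟩ := exists_nat_ge (p.1 + p.2)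
      exact ⟨n, h1, h2, by linarith⟩
  have hlim := tendsto_setIntegral_of_monotone (μ := volume) (f := wigner u v)
    (s := fun n : ℕ => standardTriangle (n + 1))
    (fun n => by rw [standardTriangle_eq]; exact measurableSet_triangleSet _ _)
    (fun m n hmn p hp => ⟨hp.1, hp.2.1, hp.2.2.trans (by gcongr)⟩)
    (wigner_integrable u v).integrableOn
  rw [hU] at hlim
  exact le_of_tendsto' hlim.norm fun n => h n u v

end triangles

/-! ### Norms, uniqueness and the numerical value of the cut bound -/

section norms

lemma IsWeylQuantization.norm_le {E : Set (ℝ × ℝ)} (hE : MeasurableSet E) {r : ℝ} (hr : 0 ≤ r)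
    (h : HasBound E r) {A : L2R →L[ℂ] L2R} (hA : IsWeylQuantization (indicatorSymbol E) A) :
    ‖A‖ ≤ r := by
  obtain ⟨B, hB, hBr⟩ := h.exists_weyl hE hr
  rwa [hA.unique hB]

lemma HasBound.existsUnique {E : Set (ℝ × ℝ)} (hE : MeasurableSet E) {r : ℝ} (hr : 0 ≤ r)
    (h : HasBound E r) : (∃! A : L2R →L[ℂ] L2R, IsWeylQuantization (indicatorSymbol E) A) ∧
      ∀ A : L2R →L[ℂ] L2R, IsWeylQuantization (indicatorSymbol E) A → IsSelfAdjoint A := by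
  obtain ⟨B, hB, -⟩ := h.exists_weyl hE hr
  exact ⟨⟨B, hB, fun A hA => hA.unique hB⟩, fun A hA => hA.isSelfAdjoint hE⟩

lemma IsWeylQuantization.congr {E F : Set (ℝ × ℝ)} (hEF : E =ᵐ[volume] F) {A : L2R →L[ℂ] L2R}
    (hA : IsWeylQuantization (indicatorSymbol E) A) :
    IsWeylQuantization (indicatorSymbol F) A := by
  intro u v
  rw [hA u v]
  refine integral_congr_ae ?_
  filter_upwards [indicator_ae_eq_of_ae_eq_set (f := fun _ => (1 : ℂ)) hEF] with p hp
  rw [indicatorSymbol, indicatorSymbol, hp]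

lemma cutBound_numeric {μ : ℝ} (h1 : 100767975 / 100000000 ≤ μ) (h2 : μ ≤ 10076805 / 10000000) :
    |cutBound μ - 1.213668| ≤ (10 : ℝ)⁻¹ ^ 6 := by
  have h3 : 1.4196543 ≤ Real.sqrt (1 + μ ^ 2) := Real.le_sqrt_of_sq_le (by norm_num at h1 ⊢; nlinarith)
  have h4 : Real.sqrt (1 + μ ^ 2) ≤ 1.4196549 := by
    rw [Real.sqrt_le_left (by norm_num)]; norm_num at h2 ⊢; nlinarith
  rw [cutBound, abs_le]
  norm_num at *
  constructor <;> linarith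

end norms

end

theorem mainTheorem9 :
    (∀ T ∈ triangles, (∃! A : L2R →L[ℂ] L2R, IsWeylQuantization (indicatorSymbol T) A) ∧
      ∀ A : L2R →L[ℂ] L2R, IsWeylQuantization (indicatorSymbol T) A → IsSelfAdjoint A) ∧
    (∀ C ∈ convexCones, (∃! A : L2R →L[ℂ] L2R, IsWeylQuantization (indicatorSymbol C) A) ∧
      ∀ A : L2R →L[ℂ] L2R, IsWeylQuantization (indicatorSymbol C) A → IsSelfAdjoint A) ∧
    ∃ μ₂ μ₃ μ₃' : ℝ,
      (∃ A₀ : L2R →L[ℂ] L2R, IsWeylQuantization (indicatorSymbol quarterPlane) A₀ ∧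
        IsGreatest (spectrum ℝ A₀) μ₂) ∧
      IsLUB (weylNorms convexCones) μ₂ ∧
      IsLUB (weylNorms triangles) μ₃ ∧
      IsLUB (weylNorms properTriangles) μ₃' ∧
      μ₂ ≤ μ₃' ∧ μ₃' ≤ μ₃ ∧
      μ₃ ≤ (μ₂ + Real.sqrt (1 + μ₂ ^ 2)) / 2 ∧
      |μ₂ - 1.007680| ≤ 5 * (10 : ℝ)⁻¹ ^ 7 ∧
      |(μ₂ + Real.sqrt (1 + μ₂ ^ 2)) / 2 - 1.213668| ≤ (10 : ℝ)⁻¹ ^ 6 := by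
  obtain ⟨A₀, hA₀, -⟩ := hasBound_quarterPlane.exists_weyl measurableSet_quarterPlane
    (cutBound_pos zero_le_one).le
  obtain ⟨hlow, hup, hspec⟩ := quarterPlane_spectrum hA₀
  -- From here on the crude bound is replaced by the exact norm μ of the quarter plane operator,
  -- which enters the bounds for all cones and triangles.
  have hq := hA₀.hasBound measurableSet_quarterPlane
  set μ := ‖A₀‖
  have h1 : 1 ≤ μ := by linarith
  have h0 : 0 ≤ μ := by linarith
  have hc0 : 0 ≤ cutBound μ := (cutBound_pos h0).le
  have hsub : weylNorms properTriangles ⊆ weylNorms triangles := by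
    rintro r ⟨E, ⟨L, c, -, -, -, rfl⟩, hA⟩
    exact ⟨_, ⟨L, c, rfl⟩, hA⟩
  have hbdd : cutBound μ ∈ upperBounds (weylNorms triangles) := by
    rintro r ⟨E, ⟨L, c, rfl⟩, A, hA, rfl⟩
    exact hA.norm_le (measurableSet_triangleSet L c) hc0 (hasBound_triangleSet h1 hq L c)
  have hstd : ∀ n : ℕ, ∃ A : L2R →L[ℂ] L2R,
      IsWeylQuantization (indicatorSymbol (standardTriangle (n + 1))) A ∧
        HasBound (standardTriangle (n + 1)) ‖A‖ := by
    intro n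
    have hm : MeasurableSet (standardTriangle (n + 1)) := by
      rw [standardTriangle_eq]; exact measurableSet_triangleSet _ _
    have hb : HasBound (standardTriangle (n + 1)) (cutBound μ) := by
      rw [standardTriangle_eq]; exact hasBound_triangleSet h1 hq _ _
    obtain ⟨A, hA, -⟩ := hb.exists_weyl hm hc0
    exact ⟨A, hA, hA.hasBound hm⟩
  have hmem : ∀ (n : ℕ) (A : L2R →L[ℂ] L2R),
      IsWeylQuantization (indicatorSymbol (standardTriangle (n + 1))) A →
      ‖A‖ ∈ weylNorms properTriangles :=
    fun n A hA => ⟨_, standardTriangle_mem (by positivity), A, hA, rfl⟩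
  have hne : (weylNorms properTriangles).Nonempty := by
    obtain ⟨A, hA, -⟩ := hstd 0
    exact ⟨_, hmem 0 A hA⟩
  obtain ⟨μ₃, hμ₃⟩ := Real.exists_isLUB (hne.mono hsub) ⟨_, hbdd⟩
  obtain ⟨μ₃', hμ₃'⟩ := Real.exists_isLUB hne ⟨_, fun r hr => hbdd (hsub hr)⟩
  refine ⟨?_, ?_, μ, μ₃, μ₃', ⟨A₀, hA₀, hspec⟩, ⟨?_, ?_⟩, hμ₃, hμ₃', ?_, ?_, hμ₃.2 hbdd, ?_,
    cutBound_numeric hlow hup⟩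
  · rintro T ⟨L, c, rfl⟩
    exact (hasBound_triangleSet h1 hq L c).existsUnique (measurableSet_triangleSet L c) hc0
  · rintro C ⟨X₀, α, θ, hθ0, hθ1, rfl⟩
    exact (hasBound_sector h1 hq X₀ α hθ0 hθ1).existsUnique (measurableSet_sector X₀ α hθ0 hθ1) h0
  · rintro r ⟨E, ⟨X₀, α, θ, hθ0, hθ1, rfl⟩, A, hA, rfl⟩
    exact hA.norm_le (measurableSet_sector X₀ α hθ0 hθ1) h0 (hasBound_sector h1 hq X₀ α hθ0 hθ1)
  · have hpi := Real.pi_pos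
    exact fun r hr => hr ⟨_, ⟨0, 0, Real.pi / 2, by positivity, by linarith, rfl⟩, A₀,
      hA₀.congr sector_ae_eq_quarterPlane.symm, rfl⟩
  -- The supremum over non-degenerate triangles bounds all standard triangles, hence the quarter
  -- plane as their limit.
  · obtain ⟨A, hA, -⟩ := hstd 0
    refine hA₀.norm_le measurableSet_quarterPlane
      ((norm_nonneg A).trans (hμ₃'.1 (hmem 0 A hA)))
      (hasBound_quarterPlane_of_standardTriangle fun n => ?_)
    obtain ⟨B, hB, hb⟩ := hstd n
    exact hb.mono (hμ₃'.1 (hmem n B hB))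
  · exact hμ₃'.2 fun r hr => hμ₃.1 (hsub hr)
  · rw [abs_le]
    norm_num at *
    constructor <;> linarith
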